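/- **Setting.** A detector is fixed: $L\ge 3$ layers $0,\dots,L-1$; the matrices $F_l\in\mathbb R^{5\times5}$, $H_l\in\mathbb R^{3\times5}$ and the noise covariances of a Kalman filter; an arbitrary criterion that decides from the coordinates of three hits whether they form a *good* seed, together with an initial state estimate (state vector, covariance, $\chi^2$) for each seed; a threshold $\chi_0^2$, a cap $\lambda\ge1$, a weight $\omega$, a maximal allowed fraction $f\in(0,1]$ of shared hits, a map that refits one track (a smoother), and a quality threshold. An event record with $n$ particles lists, for each layer $l$ and label $0\le j<n$, the coordinates in $\mathbb R^3$ of the $j$th hit of layer $l$, or says that it is missing. Let $k_{\rm seed}$ be the number of triplets of hits in layers $0,1,2$ that are good seeds. The *improved CTF* consists of four stages. (1) *Seed generation*: test all triplets of hits in layers $0,1,2$ and output the good seeds. (2) *Track finding*: for every seed and every layer $l=3,\dots,L-1$, predict the state of each current candidate track by the Kalman filter, form one new candidate for every hit of layer $l$ with predicted $\chi^2<\chi_0^2$ (one "ghost hit" at the predicted position if there is no such hit), and keep the $\lambda$ candidates of the seed with best quality $q_l=l-\#\text{ghosts}-\omega\chi^2_{\le l}$. (3) *Improved cleaning*: go through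 all candidates by decreasing quality, and accept a candidate unless it shares too many hits with an accepted one; here a track with $h$ (non-ghost) hits has $r=\lceil fh\rceil$, all its $r'$-element sets of hits with $1\le r'\le r$ are stored on acceptance in a self-balancing search tree $\mathcal T_{r',r}$, and a new track is rejected if one of its $r'$-element sets of hits lies in $\mathcal T_{r',r'}$ for some $1\le r'\le r$, or one of its $r$-element sets lies in $\mathcal T_{r,r'}$ for some $r\le r'\le\lceil fL\rceil$. (4) *Selection*: refit every remaining track and keep it unless its new quality is below the threshold. *Quantum seed generation* replaces (1). Write $b=\lceil\log_2 n\rceil$, $N=2^{3b}$ ($N=n^3$ if $n$ is a power of two), and let $G=\mathsf H(2|0\rangle\langle0|-I)\mathsf H\,O$ be the Grover operator on $3b$ qubits, where $O$ flips the sign of exactly those $|j_0,j_1,j_2\rangle$ whose labels belong to a good seed. Run a quantum counting algorithm QCount on $G$ to get $\tilde k$; let $m=\lfloor\pi/(4\arcsin\sqrt{\tilde k/N})\rfloor$; until $\tilde k$ distinct good seeds have been found, measure $G^m$ applied to the uniform superposition, and add the outcome to the set of seeds if it is a good seed. Classical time counts constant-size operations (arithmetic on a constant number of hits and constant-size matrices,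 comparisons, visited nodes of search trees). Quantum time is the number of gates: one- and two-qubit gates cost $1$, the Walsh–Hadamard transform $3b$, the reflection $O(b)$, and the oracle $O(b)$ (six QRAM accesses of cost $O(b)$ and a circuit of constant size). QCount is a family of programs, one for each $b$, which run circuits that may call $G$ (possibly controlled) but get no other information on the event, and decide how to continue from the measurement outcomes. The quantum version *runs in time* $T$ on an event if with probability at least $1/2$ it halts within time $T$ having found every good seed exactly once, and outputs the tracks that stages (2)–(4) produce from these seeds. **Statement.** There is a quantum counting algorithm QCount (for every $b$ and every set of $k$ marked basis states among $N=2^{3b}$ it outputs $k$ with probability at least $3/4$, with an expected number $\tilde O(\sqrt{N\max(1,k)})$ of calls to $G$) such that for every detector the following holds. Put $k=\max(1,k_{\rm seed})$. The constants $C,d,n_0,\delta$ below depend only on the detector and, in 2, on $a,c,c'$, not on the event. 1. There are $C,d,n_0$ such that for every event with $n>n_0$ the improved CTF with quantum seed generation runs in time $$C(\log n)^d\left(\sqrt{n^3k}+nk\right),$$ that is, it has complexity $\tilde O(\sqrt{n^3k}+nk)$. 2. Let $a<2$ and $c>0$, and consider the events with $k_{\rm seed}\le c\,n^a$. (a) For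 every $c'>0$ there are $C,d,n_0$ such that on those of these events with $n>n_0$ and $k_{\rm seed}\ge c'n$ it runs in time $C(\log n)^d\,n\,k_{\rm seed}$, that is, it has complexity $\tilde O(nk_{\rm seed})$. (b) There are $\delta>0$ and $n_0$ such that on all these events with $n>n_0$ it runs in time $n^{3-\delta}$, whereas the improved CTF with classical seed generation takes time $O(n^3)$. 3. On every event the improved CTF with classical seed generation takes time at least $h_0h_1h_2$, where $h_l$ is the number of measured hits in layer $l$ (so at least $n^3$ if no hits are missing in layers $0,1,2$). Thus the quantum version beats it in case 2. -/

import Mathlib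

open scoped Matrix

/-! ## Classical step counting -/

/-- The result of a deterministic computation together with the number of elementary steps. An
elementary step is a constant-size operation: reading a hit, arithmetic on the coordinates of a
constant number of hits or on the fixed-size vectors and matrices of one layer, one comparison,
adding one item to a list. -/
structure Timed (α : Type) where
  val : α
  time : ℕ

namespace Timed

/-- `for each a in l do f a`, where every round adds its results to the common output list. -/
def forEach {α β : Type} : List α → (α → Timed (List β)) → Timed (List β)
  | [], _ => ⟨[], 1⟩
  | a :: l, f =>
    let r := f a
    let s := forEach l f
    ⟨r.val ++ s.val, r.time + s.time + r.val.length + 1⟩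

/-- A loop that tests every element of `l` (without early exit) and reports whether any test
succeeded. -/
def anyOf {α : Type} : List α → (α → Timed Bool) → Timed Bool
  | [], _ => ⟨false, 1⟩
  | a :: l, f =>
    let r := f a
    let s := anyOf l f
    ⟨r.val || s.val, r.time + s.time + 1⟩

/-- A loop over `l` that updates a state. -/
def loop {α σ : Type} : List α → σ → (σ → α → Timed σ) → Timed σ
  | [], s, _ => ⟨s, 1⟩
  | a :: l, s, f =>
    let r := f s a
    let q := loop l r.val f
    ⟨q.val, r.time + q.time + 1⟩

end Timed

/-! ## Self-balancing search trees with step counts -/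

/-- Keys are lists of natural numbers, compared lexicographically. -/
abbrev Key := List ℕ

/-- Self-balancing binary search trees of keys. -/
abbrev KeyTree := Std.TreeSet Key compare

/-- The number of nodes that are visited on the search path of `x`. -/
def implPath (x : Key) : Std.DTreeMap.Internal.Impl Key (fun _ => Unit) → ℕ
  | .leaf => 0
  | .inner _ y _ l r =>
    match compare x y with
    | .lt => implPath x l + 1
    | .gt => implPath x r + 1
    | .eq => 1

def KeyTree.path (T : KeyTree) (x : Key) : ℕ := implPath x T.inner.inner.inner

/-- Searching costs one step per visited node (and one step to start). -/
def KeyTree.search (T : KeyTree) (x : Key) : Timed Bool :=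
  ⟨T.contains x, T.path x + 1⟩

/-- Insertion visits the nodes on the search path; there is a constant amount of rebalancing work
at each of them. -/
def KeyTree.add (T : KeyTree) (x : Key) : Timed KeyTree :=
  ⟨T.insert x, 2 * T.path x + 1⟩

/-! ## Event records, detectors and tracks -/

/-- The coordinates of a hit. -/
abbrev Hit := Fin 3 → ℝ

/-- An event record with `n` particles. `hit l j` holds the coordinates of the `j`th hit of
layer `l`, or `none` if there is no such measurement. -/
structure EventRecord where
  n : ℕ
  hit : ℕ → ℕ → Option Hit
  hit_none : ∀ l j, n ≤ j → hit l j = none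

/-- The measured hits of layer `l` with their labels. -/
def EventRecord.hits (E : EventRecord) (l : ℕ) : List (ℕ × Hit) :=
  (List.range E.n).filterMap fun j => (E.hit l j).map fun x => (j, x)

/-- A seed: a labelled hit in each of the layers 0, 1, 2. -/
structure Seed where
  j₀ : ℕ
  j₁ : ℕ
  j₂ : ℕ
  x₀ : Hit
  x₁ : Hit
  x₂ : Hit

/-- A state vector (five trajectory parameters) with its covariance matrix. -/
structure KState where
  p : Fin 5 → ℝ
  cov : Matrix (Fin 5) (Fin 5) ℝ

/-- A measurement on a track: its layer, its label (`none` for a ghost hit), its position. -/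
structure Meas where
  layer : ℕ
  label : Option ℕ
  pos : Hit

/-- A track candidate; `meas` lists the measurements, the outermost layer first; `chi` is the total
`χ²`, `quality` the quality score. -/
structure Track where
  meas : List Meas
  state : KState
  ghosts : ℕ
  chi : ℝ
  quality : ℝ

/-- The non-ghost hits of a track as pairs (layer, label). -/
def Track.realHits (t : Track) : List (ℕ × ℕ) :=
  t.meas.filterMap fun m => m.label.map fun j => (m.layer, j)

/-- Everything that is fixed by the experiment and by the configuration of the algorithm, and does
not vary with the event. -/
structure Detector where
  /-- number of layers, indexed from `0` to `L - 1` -/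
  L : ℕ
  three_le : 3 ≤ L
  /-- the matrix `F_l` of the system equation -/
  F : ℕ → Matrix (Fin 5) (Fin 5) ℝ
  /-- measurement matrix `H_l` -/
  H : ℕ → Matrix (Fin 3) (Fin 5) ℝ
  /-- covariance of the noise of the system equation -/
  W : ℕ → Matrix (Fin 5) (Fin 5) ℝ
  W_posSemidef : ∀ l, (W l).PosSemidef
  /-- covariance of the measurement noise -/
  V : ℕ → Matrix (Fin 3) (Fin 3) ℝ
  V_posDef : ∀ l, (V l).PosDef
  /-- the criterion that decides whether a triplet of hits is a good seed -/
  good : Hit → Hit → Hit → Bool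
  /-- estimate of the initial state at layer 2, and `χ²` of that estimate -/
  seedState : Hit → Hit → Hit → KState
  seedState_cov : ∀ x y z, (seedState x y z).cov.PosSemidef
  seedChi : Hit → Hit → Hit → ℝ
  /-- threshold for the predicted `χ²` of a hit -/
  chi₀ : ℝ
  /-- maximal number of tracks retained per seed at each layer -/
  lam : ℕ
  lam_pos : 1 ≤ lam
  /-- weight of `χ²` in the quality score -/
  omega : ℝ
  /-- maximal allowed fraction of shared hits -/
  frac : ℝ
  frac_pos : 0 < frac
  frac_le_one : frac ≤ 1
  /-- smoother: refits one track and recalculates its quality score -/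
  refit : Track → Track
  /-- quality threshold of the selection stage -/
  threshold : ℝ
  /-- a QRAM access to one of `2 ^ b` cells takes `qram * (b + 1)` gates -/
  qram : ℕ
  /-- number of gates of the circuit that recognizes good seeds from the hits' coordinates -/
  seedGates : ℕ
  /-- number of gates per qubit for the reflection about the all-zero state -/
  reflectGates : ℕ

namespace Detector

variable (D : Detector)

/-! ## Stage 1 (classical): seed generation -/

def seedGeneration (E : EventRecord) : Timed (List Seed) :=
  Timed.forEach (E.hits 0) fun h₀ =>
    Timed.forEach (E.hits 1) fun h₁ =>
      Timed.forEach (E.hits 2) fun h₂ =>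
        if D.good h₀.2 h₁.2 h₂.2 then ⟨[⟨h₀.1, h₁.1, h₂.1, h₀.2, h₁.2, h₂.2⟩], 2⟩ else ⟨[], 2⟩

/-- The number of good seeds of an event. -/
def kSeed (E : EventRecord) : ℕ := (D.seedGeneration E).val.length

/-! ## Stage 2: track finding with the combinatorial Kalman filter -/

/-- Predicted state at layer `l`. -/
noncomputable def predict (l : ℕ) (s : KState) : KState :=
  ⟨D.F l *ᵥ s.p, D.F l * s.cov * (D.F l)ᵀ + D.W l⟩

/-- Predicted measurement at layer `l`, from the predicted state. -/
noncomputable def predictedMeas (l : ℕ) (s : KState) : Hit := D.H l *ᵥ s.p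

/-- Covariance of the predicted residual. -/
noncomputable def residualCov (l : ℕ) (s : KState) : Matrix (Fin 3) (Fin 3) ℝ :=
  D.V l + D.H l * s.cov * (D.H l)ᵀ

/-- Predicted `χ²` of the hit `x`, from the predicted state. -/
noncomputable def predictedChi (l : ℕ) (s : KState) (x : Hit) : ℝ :=
  (x - D.predictedMeas l s) ⬝ᵥ ((D.residualCov l s)⁻¹ *ᵥ (x - D.predictedMeas l s))

/-- Kalman gain. -/
noncomputable def gain (l : ℕ) (s : KState) : Matrix (Fin 5) (Fin 3) ℝ :=
  s.cov * (D.H l)ᵀ * (D.residualCov l s)⁻¹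

/-- Filtered state, from the predicted state and the hit `x`. -/
noncomputable def update (l : ℕ) (s : KState) (x : Hit) : KState :=
  ⟨s.p + D.gain l s *ᵥ (x - D.predictedMeas l s), (1 - D.gain l s * D.H l) * s.cov⟩

/-- Quality score at layer `l`. -/
noncomputable def score (l ghosts : ℕ) (chi : ℝ) : ℝ := (l : ℝ) - ghosts - D.omega * chi

/-- The track candidate that consists of a seed. -/
noncomputable def initTrack (s : Seed) : Track :=
  { meas := [⟨2, some s.j₂, s.x₂⟩, ⟨1, some s.j₁, s.x₁⟩, ⟨0, some s.j₀, s.x₀⟩]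
    state := D.seedState s.x₀ s.x₁ s.x₂
    ghosts := 0
    chi := D.seedChi s.x₀ s.x₁ s.x₂
    quality := D.score 2 0 (D.seedChi s.x₀ s.x₁ s.x₂) }

/-- Extend the track `t` (whose predicted state at layer `l` is `s`) by the hit `x` with label
`j`. -/
noncomputable def extendHit (l : ℕ) (t : Track) (s : KState) (j : ℕ) (x : Hit) : Track :=
  { meas := ⟨l, some j, x⟩ :: t.meas
    state := D.update l s x
    ghosts := t.ghosts
    chi := t.chi + D.predictedChi l s x
    quality := D.score l t.ghosts (t.chi + D.predictedChi l s x) }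

/-- Extend the track `t` by a ghost hit at the predicted measurement: the residual vanishes and the
predicted state is kept. -/
noncomputable def extendGhost (l : ℕ) (t : Track) (s : KState) : Track :=
  { meas := ⟨l, none, D.predictedMeas l s⟩ :: t.meas
    state := s
    ghosts := t.ghosts + 1
    chi := t.chi
    quality := D.score l (t.ghosts + 1) t.chi }

open Classical in
/-- The candidates formed from one track at layer `l`. -/
noncomputable def stepTrack (E : EventRecord) (l : ℕ) (t : Track) : Timed (List Track) :=
  let s := D.predict l t.state
  let new := Timed.forEach (E.hits l) fun h =>
    if D.predictedChi l s h.2 < D.chi₀ then ⟨[D.extendHit l t s h.1 h.2], 4⟩ else ⟨[], 2⟩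
  if new.val.isEmpty then ⟨[D.extendGhost l t s], new.time + 4⟩ else ⟨new.val, new.time + 3⟩

open Classical in
/-- Insert a track into a list sorted by decreasing quality. -/
noncomputable def insertTrack (t : Track) : List Track → Timed (List Track)
  | [] => ⟨[t], 1⟩
  | u :: us =>
    if u.quality < t.quality then ⟨t :: u :: us, 2⟩
    else
      let r := insertTrack t us
      ⟨u :: r.val, r.time + 2⟩

/-- The `lam` best tracks of a list, by quality. -/
noncomputable def selectBest : List Track → Timed (List Track)
  | [] => ⟨[], 1⟩
  | t :: ts =>
    let r := selectBest ts
    let i := insertTrack t r.val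
    ⟨i.val.take D.lam, r.time + i.time + D.lam + 1⟩

/-- Propagate the candidate tracks of one seed through the given layers. -/
noncomputable def propagate (E : EventRecord) : List ℕ → List Track → Timed (List Track)
  | [], ts => ⟨ts, 1⟩
  | l :: ls, ts =>
    let new := Timed.forEach ts (D.stepTrack E l)
    let best := D.selectBest new.val
    let r := propagate E ls best.val
    ⟨r.val, new.time + best.time + r.time + 1⟩

noncomputable def trackFinding (E : EventRecord) (seeds : List Seed) : Timed (List Track) :=
  Timed.forEach seeds fun s =>
    let r := D.propagate E (List.range' 3 (D.L - 3)) [D.initTrack s]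
    ⟨r.val, r.time + 3⟩

/-! ## Stage 3: improved track cleaning -/

open Classical in
/-- Merge two lists sorted by decreasing quality. -/
noncomputable def mergeTracks : List Track → List Track → Timed (List Track)
  | [], us => ⟨us, 1⟩
  | t :: ts, [] => ⟨t :: ts, 1⟩
  | t :: ts, u :: us =>
    if u.quality ≤ t.quality then
      let r := mergeTracks ts (u :: us)
      ⟨t :: r.val, r.time + 2⟩
    else
      let r := mergeTracks (t :: ts) us
      ⟨u :: r.val, r.time + 2⟩
termination_by ts us => ts.length + us.length

/-- Merge sort by decreasing quality. -/
noncomputable def sortTracks : List Track → Timed (List Track)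
  | [] => ⟨[], 1⟩
  | [t] => ⟨[t], 1⟩
  | t :: u :: ts =>
    let h := (ts.length + 2) / 2
    let a := sortTracks ((t :: u :: ts).take h)
    let b := sortTracks ((t :: u :: ts).drop h)
    let r := mergeTracks a.val b.val
    ⟨r.val, a.time + b.time + r.time + (ts.length + 2)⟩
termination_by ts => ts.length
decreasing_by
  all_goals simp only [List.length_take, List.length_drop, List.length_cons]; omega

/-- The `r`-tuples of a track, as keys. -/
def tuples (r : ℕ) (t : Track) : List Key :=
  (List.sublistsLen r t.realHits).map fun s => s.flatMap fun h => [h.1, h.2]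

/-- The search trees `T i j`. -/
abbrev Trees := ℕ → ℕ → KeyTree

/-- The number `R` that bounds the indices of the trees. -/
noncomputable def maxShared : ℕ := ⌈D.frac * D.L⌉₊

/-- The number `r` of a track: `frac` times its number of hits, rounded up. -/
noncomputable def shared (t : Track) : ℕ := ⌈D.frac * t.realHits.length⌉₊

/-- Whether the track shares too many hits with one of the accepted tracks. -/
noncomputable def clash (T : Trees) (t : Track) : Timed Bool :=
  let r := D.shared t
  let a := Timed.anyOf (List.range' 1 r) fun i =>
    Timed.anyOf (tuples i t) fun x => (T i i).search x
  let b := Timed.anyOf (List.range' r (D.maxShared + 1 - r)) fun i =>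
    Timed.anyOf (tuples r t) fun x => (T r i).search x
  ⟨a.val || b.val, a.time + b.time + 1⟩

/-- Insert all `i`-tuples of the track, `1 ≤ i ≤ r`, into the trees `T i r`. -/
noncomputable def insertTuples (T : Trees) (t : Track) : Timed Trees :=
  let r := D.shared t
  Timed.loop (List.range' 1 r) T fun T i =>
    let q := Timed.loop (tuples i t) (T i r) fun S x => S.add x
    ⟨Function.update T i (Function.update (T i) r q.val), q.time + 1⟩

/-- The main loop of cleaning over the sorted tracks. -/
noncomputable def cleanLoop : Trees → List Track → Timed (List Track)
  | _, [] => ⟨[], 1⟩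
  | T, t :: ts =>
    let c := D.clash T t
    if c.val then
      let q := cleanLoop T ts
      ⟨q.val, c.time + q.time + 1⟩
    else
      let i := D.insertTuples T t
      let q := cleanLoop i.val ts
      ⟨t :: q.val, c.time + i.time + q.time + 2⟩

noncomputable def improvedCleaning (ts : List Track) : Timed (List Track) :=
  let s := sortTracks ts
  let q := D.cleanLoop (fun _ _ => ∅) s.val
  ⟨q.val, s.time + q.time + D.maxShared ^ 2 + 1⟩

/-! ## Stage 4: track selection -/

open Classical in
/-- Refitting a track takes a constant number of steps for each of its layers. -/
noncomputable def trackSelection (ts : List Track) : Timed (List Track) :=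
  Timed.forEach ts fun t =>
    if (D.refit t).quality < D.threshold then ⟨[], D.L + 2⟩ else ⟨[D.refit t], D.L + 2⟩

/-! ## The classical improved CTF -/

/-- The stages after seed generation: finding, improved cleaning, selection. -/
noncomputable def laterStages (E : EventRecord) (seeds : List Seed) : Timed (List Track) :=
  let a := D.trackFinding E seeds
  let b := D.improvedCleaning a.val
  let c := D.trackSelection b.val
  ⟨c.val, a.time + b.time + c.time⟩

/-- The improved CTF with classical seed generation. -/
noncomputable def classicalCTF (E : EventRecord) : Timed (List Track) :=
  let s := D.seedGeneration E
  let r := D.laterStages E s.val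
  ⟨r.val, s.time + r.time⟩

end Detector

/-! ## Quantum circuits and programs -/

/-- Computational basis states of the index register: three labels of `b` bits each. -/
abbrev Idx (b : ℕ) := Fin 3 × Fin b → Bool

/-- A placement of the index register on `q` qubits. -/
abbrev IdxWires (b q : ℕ) := (Fin 3 × Fin b) ↪ Fin q

/-- The label `j_l` encoded in a basis state. -/
def Idx.label {b : ℕ} (y : Idx b) (l : Fin 3) : ℕ := Nat.ofBits fun i => y (l, i)

/-- The Walsh-Hadamard transform. -/
noncomputable def walshMatrix (b : ℕ) : Matrix (Idx b) (Idx b) ℂ := fun x y =>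
  (-1) ^ (Finset.univ.filter fun i => x i = true ∧ y i = true).card / (Real.sqrt 2 : ℂ) ^ (3 * b)

/-- The reflection `2 |0⟩⟨0| - I`. -/
def reflectZero (b : ℕ) : Matrix (Idx b) (Idx b) ℂ :=
  2 • Matrix.single (fun _ => false) (fun _ => false) 1 - 1

/-- The phase oracle that flips the sign of the marked basis states. -/
def oracleMatrix {b : ℕ} (mark : Idx b → Bool) : Matrix (Idx b) (Idx b) ℂ :=
  Matrix.diagonal fun y => if mark y then -1 else 1

/-- The Grover operator `G = H (2 |0⟩⟨0| - I) H O`. -/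
noncomputable def groverMatrix {b : ℕ} (mark : Idx b → Bool) : Matrix (Idx b) (Idx b) ℂ :=
  walshMatrix b * reflectZero b * walshMatrix b * oracleMatrix mark

/-- Gates of circuits on `q` qubits: arbitrary one- and two-qubit gates, the Walsh-Hadamard
transform of an index register, and (controlled) calls to `G` for the marking at hand. -/
inductive Gate (b q : ℕ) : Type
  | small (m : ℕ) (hm : m ≤ 2) (U : Matrix.unitaryGroup (Fin m → Bool) ℂ) (w : Fin m ↪ Fin q)
  | walsh (w : IdxWires b q)
  | grover (w : IdxWires b q)
  | cgrover (c : Fin q) (w : IdxWires b q) (hc : c ∉ Set.range w)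

/-- Apply a matrix to the qubits selected by `w`, and the identity to the others. -/
noncomputable def applyOn {ι : Type} [Fintype ι] [DecidableEq ι] {q : ℕ} (w : ι ↪ Fin q)
    (M : Matrix (ι → Bool) (ι → Bool) ℂ) (ψ : (Fin q → Bool) → ℂ) : (Fin q → Bool) → ℂ :=
  fun x => ∑ y : ι → Bool, M (fun i => x (w i)) y * ψ (Function.extend w y x)

/-- The action of a gate on state vectors. -/
noncomputable def Gate.apply {b q : ℕ} (mark : Idx b → Bool) :
    Gate b q → ((Fin q → Bool) → ℂ) → ((Fin q → Bool) → ℂ)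
  | small _ _ U w, ψ => applyOn w U.1 ψ
  | walsh w, ψ => applyOn w (walshMatrix b) ψ
  | grover w, ψ => applyOn w (groverMatrix mark) ψ
  | cgrover c w _, ψ => fun x => if x c then applyOn w (groverMatrix mark) ψ x else ψ x

/-- Number of elementary gates of a gate, if `G` takes `g` gates. -/
def Gate.cost {b q : ℕ} (g : ℕ) : Gate b q → ℕ
  | small .. => 1
  | walsh .. => 3 * b
  | grover .. => g
  | cgrover .. => g

/-- Number of calls to `G`. -/
def Gate.calls {b q : ℕ} : Gate b q → ℕ
  | small .. => 0
  | walsh .. => 0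
  | grover .. => 1
  | cgrover .. => 1

/-- The final state of a circuit (the first gate of the list acts first) started in the all-zero
state. -/
noncomputable def finalState {b q : ℕ} (mark : Idx b → Bool) (c : List (Gate b q)) :
    (Fin q → Bool) → ℂ :=
  c.foldl (fun ψ g => g.apply mark ψ) (Pi.single (fun _ => false) 1)

/-- Quantum programs with access to `G`: halt with a result; do `t` classical steps and continue; or
run a circuit on `q` qubits, measure all qubits in the computational basis and continue depending on
the outcome. -/
inductive Prog (b : ℕ) (α : Type) : Type
  | ret (a : α)
  | step (t : ℕ) (p : Prog b α)
  | run (q : ℕ) (c : List (Gate b q)) (k : (Fin q → Bool) → Prog b α)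

namespace Prog

variable {b : ℕ} {α β : Type}

/-- Sequential composition. -/
def bind : Prog b α → (α → Prog b β) → Prog b β
  | ret a, f => f a
  | step t p, f => step t (bind p f)
  | run q c k, f => run q c fun x => bind (k x) f

/-- A classical computation as a program. -/
def ofTimed (r : Timed α) : Prog b α := step r.time (ret r.val)

/-- The expectation of `φ result time calls` over the runs of a program, where the outcome `x` of
measuring the state `ψ` has probability `‖ψ x‖ ^ 2`, the time counts the gates (with `g` gates for
each use of `G`) and the classical steps, and `calls` is the number of uses of `G`. -/
noncomputable def expect (mark : Idx b → Bool) (g : ℕ) : Prog b α → (α → ℕ → ℕ → ℝ) → ℝ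
  | ret a, φ => φ a 0 0
  | step t p, φ => expect mark g p fun a s m => φ a (t + s) m
  | run _ c k, φ => ∑ x, ‖finalState mark c x‖ ^ 2 *
      expect mark g (k x) fun a s m =>
        φ a ((c.map (Gate.cost g)).sum + s) ((c.map Gate.calls).sum + m)

open Classical in
/-- The probability that result and time satisfy `P`. -/
noncomputable def prob (mark : Idx b → Bool) (g : ℕ) (p : Prog b α) (P : α → ℕ → Prop) : ℝ :=
  p.expect mark g fun a t _ => if P a t then 1 else 0

/-- The expected number of calls to `G`. -/
noncomputable def expectedCalls (mark : Idx b → Bool) (p : Prog b α) : ℝ :=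
  p.expect mark 0 fun _ _ m => (m : ℝ)

end Prog

/-- The number of marked basis states. -/
def countMarked {b : ℕ} (mark : Idx b → Bool) : ℕ :=
  (Finset.univ.filter fun y => mark y = true).card

/-- A quantum counting algorithm: whatever the marking, it outputs the number `k` of marked basis
states among the `N = 2 ^ (3 * b)` with probability at least `3 / 4`, and the expected number of
calls to `G` is `√(N k)`, up to a factor that is polynomial in `log N` (with `1` in place of `k` if
`k = 0`). -/
def IsQuantumCounting (QCount : (b : ℕ) → Prog b ℕ) : Prop :=
  (∀ (b : ℕ) (mark : Idx b → Bool) (g : ℕ),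
    3 / 4 ≤ (QCount b).prob mark g fun k _ => k = countMarked mark) ∧
  ∃ (C : ℝ) (d : ℕ), ∀ (b : ℕ) (mark : Idx b → Bool),
    (QCount b).expectedCalls mark ≤
      C * ((b : ℝ) + 1) ^ d * Real.sqrt ((2 : ℝ) ^ (3 * b) * (max 1 (countMarked mark) : ℕ))

namespace Detector

variable (D : Detector)

/-! ## Stage 1 (quantum): seed generation with quantum search -/

/-- The number of bits of a label; if `n` is a power of two then `2 ^ E.bits = n`. -/
def _root_.EventRecord.bits (E : EventRecord) : ℕ := Nat.clog 2 E.n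

/-- The good seed with labels `j₀`, `j₁`, `j₂`, if there is one. -/
def seedAt (E : EventRecord) (j₀ j₁ j₂ : ℕ) : Option Seed :=
  match E.hit 0 j₀, E.hit 1 j₁, E.hit 2 j₂ with
  | some x₀, some x₁, some x₂ => if D.good x₀ x₁ x₂ then some ⟨j₀, j₁, j₂, x₀, x₁, x₂⟩ else none
  | _, _, _ => none

/-- The basis states marked by the oracle: those whose labels are those of a good seed. -/
def markSeed (E : EventRecord) : Idx E.bits → Bool := fun y =>
  (D.seedAt E (y.label 0) (y.label 1) (y.label 2)).isSome

/-- Number of gates of the oracle on labels of `b` bits: load three hits through the QRAM, apply the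
seed recognizing circuit, unload the hits. -/
def oracleGates (b : ℕ) : ℕ := 6 * (D.qram * (b + 1)) + D.seedGates

/-- Number of gates of `G`: two Walsh-Hadamard transforms, the reflection and the oracle. -/
def groverGates (b : ℕ) : ℕ := 6 * b + D.reflectGates * (3 * b + 1) + D.oracleGates b + 1

/-- The number `m` of Grover iterations, for the estimate `k` of the number of marked states. -/
noncomputable def _root_.groverIterations (b k : ℕ) : ℕ :=
  ⌊Real.pi / (4 * Real.arcsin (Real.sqrt (k / (2 : ℝ) ^ (3 * b))))⌋₊

/-- The index register as the register of all `3 * b` qubits. -/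
def _root_.allWires (b : ℕ) : IdxWires b (3 * b) := finProdFinEquiv.toEmbedding

/-- Prepare the uniform superposition and apply `G` to it `m` times. -/
def _root_.groverCircuit (b m : ℕ) : List (Gate b (3 * b)) :=
  Gate.walsh (allWires b) :: List.replicate m (Gate.grover (allWires b))

/-- The loop `while fewer than k seeds are found: prepare and measure the Grover state, and if the
outcome is a good seed, add it to the output`. The output is a set: a seed that is already there
(which is decided with a search tree `T`) is not added again. The loop is cut off with result `none`
if it has not ended after `fuel` rounds. -/
noncomputable def seedLoop (E : EventRecord) (k m : ℕ) :
    ℕ → List Seed → KeyTree → Prog E.bits (Option (List Seed))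
  | fuel, found, T =>
    if k ≤ found.length then .step 1 (.ret (some found))
    else match fuel with
      | 0 => .ret none
      | fuel + 1 => .run (3 * E.bits) (groverCircuit E.bits m) fun z =>
          let y : Idx E.bits := fun i => z (allWires E.bits i)
          match D.seedAt E (y.label 0) (y.label 1) (y.label 2) with
          | none => .step 5 (seedLoop E k m fuel found T)
          | some s =>
            let c := T.search [s.j₀, s.j₁, s.j₂]
            if c.val then .step (c.time + 5) (seedLoop E k m fuel found T)
            else
              let i := T.add [s.j₀, s.j₁, s.j₂]
              .step (c.time + i.time + 6) (seedLoop E k m fuel (s :: found) i.val)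

/-- Seed generation with quantum search, with the loop cut off after `fuel` rounds. -/
noncomputable def quantumSeeding (QCount : (b : ℕ) → Prog b ℕ) (E : EventRecord) (fuel : ℕ) :
    Prog E.bits (Option (List Seed)) :=
  (QCount E.bits).bind fun k =>
    .step 2 (D.seedLoop E k (groverIterations E.bits k) fuel [] ∅)

/-- The improved CTF with quantum seed generation. A run that halts returns the seeds that were
formed and the reconstructed tracks. -/
noncomputable def quantumCTF (QCount : (b : ℕ) → Prog b ℕ) (E : EventRecord) (fuel : ℕ) :
    Prog E.bits (Option (List Seed × List Track)) :=
  (D.quantumSeeding QCount E fuel).bind fun o =>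
    match o with
    | none => .ret none
    | some seeds => (Prog.ofTimed (D.laterStages E seeds)).bind fun ts => .ret (some (seeds, ts))

/-- With probability at least `1 / 2`, the improved CTF with quantum seed generation halts within
time `T` after having found every good seed exactly once (in some order), and outputs the tracks
that the later stages produce from these seeds. -/
def QuantumCTFWithin (QCount : (b : ℕ) → Prog b ℕ) (E : EventRecord) (T : ℝ) : Prop :=
  ∃ fuel : ℕ, 1 / 2 ≤ (D.quantumCTF QCount E fuel).prob (D.markSeed E) (D.groverGates E.bits)
    fun o t => ∃ seeds : List Seed, o = some (seeds, (D.laterStages E seeds).val) ∧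
      seeds.Perm (D.seedGeneration E).val ∧ (t : ℝ) ≤ T

end Detector

/-! ## Search paths in balanced trees -/

/-! Marked basis states correspond one to one to good seeds, so the whole quantum part is governed
by the angle `θ` with `sin² θ = k / N`. In the plane of the normalized sums of the marked and of the
unmarked states, `G` is the rotation by `2θ` (`grover_planeVec`), and the uniform superposition has
angle `θ` (`walsh_single`).

Counting. A Hadamard test for `G ^ m` on the uniform superposition yields a sign with mean `cos
(2mθ)` (`sum_norm_hadamardTest`). The algorithm keeps an interval that should contain `θ`. By
`exists_power_separating` there is an `m` for which `cos (2m ·)` is monotone on the interval and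
differs by a constant between the two points that cut off its outer thirds. A number of tests linear
in `b` then decides which outer third to discard, and after linearly many rounds only one count is
left (`countLoop_fail`). Such an `m` is at most of the order of the inverse width, and as long as
the true count has a competitor the width is at least of the order of `1 / √(N (k + 1))`
(`groverAngle_spacing_abs`); this gives the number of calls. A wrong decision may lead to powers of
order `N`, but its probability is made as small as `1 / (8 N)`, so that the expectation is not
affected (`quantumCount_fail`).

Search. After `m = ⌊π / (4θ)⌋` iterations a marked state is measured with probability `p ≥ 1 / 2`
(`half_le_hitProb`), uniformly among the `k` marked ones. The expected number of missing seeds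
shrinks by the factor `1 - p / k` in each round (`seedLoop_fail`), so a number of rounds of order `k
b` suffices. Since `k m ≤ √(N k)` (`mul_groverIterations_le`), they cost `√(N k)` up to powers of
`b`.

Later stages. The cap on candidates makes track finding linear in `n` for each seed. A track has a
number of keys that depends only on the detector, and search paths in weight-balanced trees are
logarithmic, so cleaning takes time of order `k log k`. Altogether the later stages take time of
order `n k log k` (`laterStages_time_le`).

The failure probabilities of counting and search add up to at most `1 / 8 + 1 / 4`, and `N ≤ 8 n³`,
which gives the first bound. If `k ≥ c' n`, then `√(n³ k)` is dominated by `n k`. If `k ≤ c n ^ a`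
with `a < 2`, both terms have exponents below `3`, and the gap absorbs the logarithms. Classical
seeding visits every triplet of hits. -/

open Std.DTreeMap.Internal in
-- With weight `size + 1`, the balance condition with factor `delta = 3` makes each subtree weigh at
-- most `3 / 4` of the tree. Hence a path of length `p` needs weight at least `(4 / 3) ^ p`.
theorem implPath_pow_le (x : Key) (t : Impl Key (fun _ => Unit)) (ht : t.Balanced) :
    4 ^ implPath x t ≤ 3 ^ implPath x t * (t.size + 1) := by
  induction t with
  | leaf => simp [implPath]
  | inner sz y v l r ihl ihr =>
    obtain ⟨hl, hr, hb, hs⟩ := Impl.balanced_inner_iff.1 ht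
    have hsz : (Impl.inner sz y v l r).size = l.size + 1 + r.size := by rw [← hs]; rfl
    rw [hsz, implPath]
    have hb' : 4 * (l.size + 1) ≤ 3 * (l.size + 1 + r.size + 1) ∧
        4 * (r.size + 1) ≤ 3 * (l.size + 1 + r.size + 1) := by
      rcases hb with h | h
      · omega
      · simp only [Std.DTreeMap.Internal.delta] at h; omega
    split
    · calc 4 ^ (implPath x l + 1) = 4 * 4 ^ implPath x l := by ring
        _ ≤ 4 * (3 ^ implPath x l * (l.size + 1)) := Nat.mul_le_mul_left _ (ihl hl)
        _ = 3 ^ implPath x l * (4 * (l.size + 1)) := by ring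
        _ ≤ 3 ^ implPath x l * (3 * (l.size + 1 + r.size + 1)) := Nat.mul_le_mul_left _ hb'.1
        _ = _ := by ring
    · calc 4 ^ (implPath x r + 1) = 4 * 4 ^ implPath x r := by ring
        _ ≤ 4 * (3 ^ implPath x r * (r.size + 1)) := Nat.mul_le_mul_left _ (ihr hr)
        _ = 3 ^ implPath x r * (4 * (r.size + 1)) := by ring
        _ ≤ 3 ^ implPath x r * (3 * (l.size + 1 + r.size + 1)) := Nat.mul_le_mul_left _ hb'.2
        _ = _ := by ring
    · omega

/-- Three levels more than halve the weight, because `(4 / 3) ^ 3 = 64 / 27 > 2`. -/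
theorem le_three_mul_of_pow_le {p e s : ℕ} (h : 4 ^ p ≤ 3 ^ p * s) (hs : s ≤ 2 ^ e) :
    p ≤ 3 * e := by
  by_contra hlt
  push Not at hlt
  obtain ⟨c, rfl⟩ : ∃ c, p = 3 * e + (c + 1) := ⟨p - 3 * e - 1, by omega⟩
  have h1 : 27 ^ e * 2 ^ e ≤ 64 ^ e := by
    rw [← Nat.mul_pow]; exact Nat.pow_le_pow_left (by norm_num) e
  have h2 : 3 ^ (c + 1) < 4 ^ (c + 1) := Nat.pow_lt_pow_left (by norm_num) (by omega)
  have h3 : (4 : ℕ) ^ (3 * e + (c + 1)) = 64 ^ e * 4 ^ (c + 1) := by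
    rw [pow_add, pow_mul]; norm_num
  have h4 : (3 : ℕ) ^ (3 * e + (c + 1)) = 27 ^ e * 3 ^ (c + 1) := by
    rw [pow_add, pow_mul]; norm_num
  rw [h3, h4] at h
  have h5 : 27 ^ e * 3 ^ (c + 1) * s ≤ 64 ^ e * 3 ^ (c + 1) := by
    calc 27 ^ e * 3 ^ (c + 1) * s ≤ 27 ^ e * 3 ^ (c + 1) * 2 ^ e := Nat.mul_le_mul_left _ hs
      _ = (27 ^ e * 2 ^ e) * 3 ^ (c + 1) := by ring
      _ ≤ _ := Nat.mul_le_mul_right _ h1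
  have h6 : 64 ^ e * 3 ^ (c + 1) < 64 ^ e * 4 ^ (c + 1) :=
    Nat.mul_lt_mul_of_pos_left h2 (by positivity)
  omega

/-- A bound for the search paths in trees of size at most `s`. -/
def pathBound (s : ℕ) : ℕ := 3 * Nat.clog 2 (s + 1)

theorem pathBound_mono {s t : ℕ} (h : s ≤ t) : pathBound s ≤ pathBound t :=
  Nat.mul_le_mul_left _ (Nat.clog_mono_right 2 (by omega))

theorem KeyTree.path_le {T : KeyTree} {s : ℕ} (h : T.size ≤ s) (x : Key) :
    T.path x ≤ pathBound s := by
  refine le_three_mul_of_pow_le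
    (implPath_pow_le x T.inner.inner.inner T.inner.inner.wf.balanced) ?_
  refine le_trans ?_ (Nat.le_pow_clog (by norm_num) _)
  exact Nat.succ_le_succ h

theorem KeyTree.search_time_le {T : KeyTree} {s : ℕ} (h : T.size ≤ s) (x : Key) :
    (T.search x).time ≤ pathBound s + 1 := Nat.succ_le_succ (T.path_le h x)

theorem KeyTree.add_time_le {T : KeyTree} {s : ℕ} (h : T.size ≤ s) (x : Key) :
    (T.add x).time ≤ 2 * pathBound s + 1 := by
  have := T.path_le h x
  simp only [KeyTree.add]; omega

theorem KeyTree.size_add_le (T : KeyTree) (x : Key) : (T.add x).val.size ≤ T.size + 1 :=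
  Std.TreeSet.size_insert_le

/-! ## Loops -/

namespace Timed

variable {α β σ : Type}

theorem forEach_time_le {l : List α} {f : α → Timed (List β)} {B : ℕ}
    (h : ∀ a ∈ l, (f a).time + (f a).val.length ≤ B) :
    (forEach l f).time ≤ l.length * (B + 1) + 1 := by
  induction l with
  | nil => simp [forEach]
  | cons a l ih =>
    have h1 := h a (by simp)
    have h2 := ih fun b hb => h b (by simp [hb])
    simp only [forEach, List.length_cons, Nat.add_mul] at *
    omega

theorem forEach_length_le {l : List α} {f : α → Timed (List β)} {B : ℕ}
    (h : ∀ a ∈ l, (f a).val.length ≤ B) : (forEach l f).val.length ≤ l.length * B := by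
  induction l with
  | nil => simp [forEach]
  | cons a l ih =>
    have h1 := h a (by simp)
    have h2 := ih fun b hb => h b (by simp [hb])
    simp only [forEach, List.length_cons, List.length_append, Nat.add_mul] at *
    omega

theorem forEach_val (l : List α) (f : α → Timed (List β)) :
    (forEach l f).val = l.flatMap fun a => (f a).val := by
  induction l with
  | nil => rfl
  | cons a l ih => simp [forEach, ih]

theorem length_mul_le_forEach_time {l : List α} {f : α → Timed (List β)} {B : ℕ}
    (h : ∀ a ∈ l, B ≤ (f a).time) : l.length * B ≤ (forEach l f).time := by
  induction l with
  | nil => simp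
  | cons a l ih =>
    have h1 := h a (by simp)
    have h2 := ih fun b hb => h b (by simp [hb])
    simp only [forEach, List.length_cons, Nat.add_mul] at *
    omega

theorem anyOf_time_le {l : List α} {f : α → Timed Bool} {B : ℕ}
    (h : ∀ a ∈ l, (f a).time ≤ B) : (anyOf l f).time ≤ l.length * (B + 1) + 1 := by
  induction l with
  | nil => simp [anyOf]
  | cons a l ih =>
    have h1 := h a (by simp)
    have h2 := ih fun b hb => h b (by simp [hb])
    simp only [anyOf, List.length_cons, Nat.add_mul] at *
    omega

/-- A loop whose state has a size that grows by at most `c` in every round. -/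
theorem loop_time_size_le {l : List α} {f : σ → α → Timed σ} (P : ℕ → σ → Prop) {B c S : ℕ}
    (h : ∀ a ∈ l, ∀ s σ, s + c ≤ S → P s σ → (f σ a).time ≤ B ∧ P (s + c) (f σ a).val)
    (s : ℕ) (hs : s + l.length * c ≤ S) (x : σ) (hx : P s x) :
    (loop l x f).time ≤ l.length * (B + 1) + 1 ∧ P (s + l.length * c) (loop l x f).val := by
  induction l generalizing s x with
  | nil => simpa [loop] using hx
  | cons a l ih =>
    simp only [List.length_cons, Nat.add_mul, one_mul] at hs ⊢
    obtain ⟨h1, h2⟩ := h a (by simp) s x (by omega) hx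
    obtain ⟨h3, h4⟩ := ih (fun b hb => h b (by simp [hb])) (s + c) (by omega) _ h2
    refine ⟨by simp only [loop]; omega, ?_⟩
    have e : s + (l.length * c + c) = s + c + l.length * c := by omega
    rw [e]
    exact h4

end Timed

theorem EventRecord.length_hits_le (E : EventRecord) (l : ℕ) : (E.hits l).length ≤ E.n := by
  simpa [EventRecord.hits] using
    List.length_filterMap_le (fun j => (E.hit l j).map fun x => (j, x)) (List.range E.n)

namespace Detector

variable (D : Detector)

/-! ## Seed generation -/

theorem mul_le_seedGeneration_time (E : EventRecord) :
    (E.hits 0).length * (E.hits 1).length * (E.hits 2).length ≤ (D.seedGeneration E).time := by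
  rw [mul_assoc]
  refine Timed.length_mul_le_forEach_time fun h₀ _ =>
    Timed.length_mul_le_forEach_time fun h₁ _ => ?_
  rw [← mul_one (E.hits 2).length]
  refine Timed.length_mul_le_forEach_time fun h₂ _ => ?_
  split <;> simp

/-- A loop is also charged for appending the output of its body, so time and output length of the
inner loops have to be bounded together. The constant `21` is generous. -/
theorem seedGeneration_time_le (E : EventRecord) :
    (D.seedGeneration E).time ≤ 21 * (E.n + 1) ^ 3 := by
  set n := E.n with hn
  have hl : ∀ l, (E.hits l).length ≤ n := E.length_hits_le
  have H2 : ∀ h₀ h₁ : ℕ × Hit, (Timed.forEach (E.hits 2) fun h₂ =>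
      if D.good h₀.2 h₁.2 h₂.2 then (⟨[⟨h₀.1, h₁.1, h₂.1, h₀.2, h₁.2, h₂.2⟩], 2⟩ : Timed (List Seed))
      else ⟨[], 2⟩).time ≤ 4 * n + 1 ∧ (Timed.forEach (E.hits 2) fun h₂ =>
      if D.good h₀.2 h₁.2 h₂.2 then (⟨[⟨h₀.1, h₁.1, h₂.1, h₀.2, h₁.2, h₂.2⟩], 2⟩ : Timed (List Seed))
      else ⟨[], 2⟩).val.length ≤ n := by
    intro h₀ h₁
    constructor
    · refine (Timed.forEach_time_le (B := 3) fun a _ => ?_).trans ?_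
      · split <;> simp
      · have := hl 2; omega
    · refine (Timed.forEach_length_le (B := 1) fun a _ => ?_).trans ?_
      · split <;> simp
      · simpa using hl 2
  have H1 : ∀ h₀ : ℕ × Hit, (Timed.forEach (E.hits 1) fun h₁ => Timed.forEach (E.hits 2) fun h₂ =>
      if D.good h₀.2 h₁.2 h₂.2 then (⟨[⟨h₀.1, h₁.1, h₂.1, h₀.2, h₁.2, h₂.2⟩], 2⟩ : Timed (List Seed))
      else ⟨[], 2⟩).time ≤ n * (5 * n + 2) + 1 ∧ (Timed.forEach (E.hits 1) fun h₁ =>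
      Timed.forEach (E.hits 2) fun h₂ =>
      if D.good h₀.2 h₁.2 h₂.2 then (⟨[⟨h₀.1, h₁.1, h₂.1, h₀.2, h₁.2, h₂.2⟩], 2⟩ : Timed (List Seed))
      else ⟨[], 2⟩).val.length ≤ n * n := by
    intro h₀
    constructor
    · refine (Timed.forEach_time_le (B := 5 * n + 1) fun a _ => ?_).trans ?_
      · have := H2 h₀ a; omega
      · exact Nat.succ_le_succ (Nat.mul_le_mul_right _ (hl 1))
    · exact (Timed.forEach_length_le (B := n) fun a _ => (H2 h₀ a).2).trans
        (Nat.mul_le_mul_right _ (hl 1))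
  refine (Timed.forEach_time_le (B := n * (5 * n + 2) + 1 + n * n) fun a _ => ?_).trans ?_
  · have := H1 a; omega
  · refine (Nat.succ_le_succ (Nat.mul_le_mul_right _ (hl 0))).trans ?_
    nlinarith [sq_nonneg (n : ℤ)]

/-! ## Track finding -/

/-- The extra `1` in the length allows for the ghost candidate, which exists even if the layer has
no hits at all. -/
theorem stepTrack_time_length_le (E : EventRecord) (l : ℕ) (t : Track) :
    (D.stepTrack E l t).time ≤ 6 * E.n + 5 ∧ (D.stepTrack E l t).val.length ≤ E.n + 1 := by
  classical
  have hn := E.length_hits_le l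
  have h1 : (Timed.forEach (E.hits l) fun h =>
      if D.predictedChi l (D.predict l t.state) h.2 < D.chi₀ then
        (⟨[D.extendHit l t (D.predict l t.state) h.1 h.2], 4⟩ : Timed (List Track))
      else ⟨[], 2⟩).time ≤ 6 * E.n + 1 := by
    refine (Timed.forEach_time_le (B := 5) fun a _ => ?_).trans ?_
    · split <;> simp
    · omega
  have h2 : (Timed.forEach (E.hits l) fun h =>
      if D.predictedChi l (D.predict l t.state) h.2 < D.chi₀ then
        (⟨[D.extendHit l t (D.predict l t.state) h.1 h.2], 4⟩ : Timed (List Track))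
      else ⟨[], 2⟩).val.length ≤ E.n := by
    refine (Timed.forEach_length_le (B := 1) fun a _ => ?_).trans ?_
    · split <;> simp
    · omega
  unfold stepTrack
  dsimp only
  split
  · exact ⟨by simpa using h1, by simp⟩
  · exact ⟨by dsimp only; convert (Nat.add_le_add_right h1 3).trans (Nat.le_succ _) using 1,
      by dsimp only; exact h2.trans (by omega)⟩

/-- Ghosts are counted here too, so a track has exactly one measurement per layer passed. This
bounds its number of hits, and thus of keys in cleaning, by a constant of the detector. -/
theorem stepTrack_meas (E : EventRecord) (l : ℕ) (t u : Track) (hu : u ∈ (D.stepTrack E l t).val) :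
    u.meas.length = t.meas.length + 1 := by
  classical
  unfold stepTrack at hu
  dsimp only at hu
  split at hu
  · simp only [List.mem_singleton] at hu
    simp [hu, extendGhost]
  · simp only [Timed.forEach_val, List.mem_flatMap] at hu
    obtain ⟨a, -, ha⟩ := hu
    split at ha
    · simp only [List.mem_singleton] at ha
      simp [ha, extendHit]
    · simp at ha

theorem insertTrack_perm (t : Track) (l : List Track) : (insertTrack t l).val.Perm (t :: l) := by
  classical
  induction l with
  | nil => simp [insertTrack]
  | cons u us ih =>
    unfold insertTrack
    split
    · exact List.Perm.refl _
    · exact (ih.cons u).trans (List.Perm.swap t u us)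

theorem insertTrack_time_le (t : Track) (l : List Track) :
    (insertTrack t l).time ≤ 2 * l.length + 1 := by
  classical
  induction l with
  | nil => simp [insertTrack]
  | cons u us ih =>
    unfold insertTrack
    split
    · simp only [List.length_cons]; omega
    · simp only [List.length_cons]; omega

theorem selectBest_length_le (l : List Track) : (D.selectBest l).val.length ≤ D.lam := by
  cases l with
  | nil => simp [selectBest]
  | cons t ts => simp [selectBest]

theorem mem_of_mem_selectBest {l : List Track} {t : Track} (h : t ∈ (D.selectBest l).val) :
    t ∈ l := by
  induction l generalizing t with
  | nil => simp [selectBest] at h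
  | cons u us ih =>
    rcases List.mem_cons.1 ((insertTrack_perm u _).mem_iff.1 (List.mem_of_mem_take h)) with h | h
    · simp [h]
    · exact List.mem_cons_of_mem _ (ih h)

/-- The list into which a candidate is inserted is cut down to `lam` entries after every insertion,
so each candidate costs a constant. -/
theorem selectBest_time_le (l : List Track) :
    (D.selectBest l).time ≤ l.length * (3 * D.lam + 2) + 1 := by
  induction l with
  | nil => simp [selectBest]
  | cons t ts ih =>
    have h1 := insertTrack_time_le t (D.selectBest ts).val
    have h2 := D.selectBest_length_le ts
    simp only [selectBest, List.length_cons, Nat.add_mul] at *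
    omega

/-- A bound for the time of track finding for one seed in one layer. -/
def layerTime (n : ℕ) : ℕ := (9 * D.lam + 3 * D.lam ^ 2 + 3) * (n + 1)

/-- The selection restores the bound `lam` on the number of candidates after every layer. There is
therefore no growth from layer to layer, and each layer costs a constant times `n + 1`. -/
theorem propagate_bounds (E : EventRecord) (ls : List ℕ) (ts : List Track)
    (hts : ts.length ≤ D.lam) (c : ℕ) (hc : ∀ t ∈ ts, t.meas.length ≤ c) :
    (D.propagate E ls ts).time ≤ ls.length * D.layerTime E.n + 1 ∧
    (D.propagate E ls ts).val.length ≤ D.lam ∧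
    ∀ t ∈ (D.propagate E ls ts).val, t.meas.length ≤ c + ls.length := by
  induction ls generalizing ts c with
  | nil => exact ⟨by simp [propagate], hts, hc⟩
  | cons l ls ih =>
    set new := Timed.forEach ts (D.stepTrack E l) with hnew
    have h1 : new.time ≤ D.lam * (7 * E.n + 7) + 1 := by
      refine (Timed.forEach_time_le (B := 7 * E.n + 6) fun t _ => ?_).trans
        (Nat.succ_le_succ (Nat.mul_le_mul_right _ hts))
      have := D.stepTrack_time_length_le E l t
      omega
    have h2 : new.val.length ≤ D.lam * (E.n + 1) :=
      (Timed.forEach_length_le fun t _ => (D.stepTrack_time_length_le E l t).2).trans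
        (Nat.mul_le_mul_right _ hts)
    have h3 := (D.selectBest_time_le new.val).trans
      (Nat.succ_le_succ (Nat.mul_le_mul_right (3 * D.lam + 2) h2))
    have hmeas : ∀ t ∈ (D.selectBest new.val).val, t.meas.length ≤ c + 1 := by
      intro t ht
      have := D.mem_of_mem_selectBest ht
      rw [hnew, Timed.forEach_val, List.mem_flatMap] at this
      obtain ⟨u, hu, htu⟩ := this
      rw [D.stepTrack_meas E l u t htu]
      exact Nat.succ_le_succ (hc u hu)
    obtain ⟨h4, h5, h6⟩ := ih _ (D.selectBest_length_le new.val) (c + 1) hmeas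
    refine ⟨?_, h5, fun t ht => (h6 t ht).trans (by simp only [List.length_cons]; omega)⟩
    have h7 : D.lam * (7 * E.n + 7) + 1 + (D.lam * (E.n + 1) * (3 * D.lam + 2) + 1) + 1 ≤
        D.layerTime E.n := by
      simp only [layerTime]; nlinarith
    simp only [propagate, List.length_cons, Nat.add_mul, ← hnew]
    omega

theorem trackFinding_bounds (E : EventRecord) (seeds : List Seed) :
    (D.trackFinding E seeds).time ≤
      seeds.length * (D.L * D.layerTime E.n + D.lam + 5) + 1 ∧
    (D.trackFinding E seeds).val.length ≤ seeds.length * D.lam ∧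
    ∀ t ∈ (D.trackFinding E seeds).val, t.meas.length ≤ D.L := by
  have H := fun s : Seed => D.propagate_bounds E (List.range' 3 (D.L - 3)) [D.initTrack s]
    (by simpa using D.lam_pos) 3 (by simp [initTrack])
  have h3 := D.three_le
  simp only [List.length_range'] at H
  have hL : (D.L - 3) * D.layerTime E.n ≤ D.L * D.layerTime E.n :=
    Nat.mul_le_mul_right _ (by omega)
  refine ⟨?_, ?_, ?_⟩
  · refine (Timed.forEach_time_le (B := D.L * D.layerTime E.n + D.lam + 4) fun s _ => ?_).trans ?_
    · have := H s; dsimp only; omega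
    · simp
  · exact Timed.forEach_length_le fun s _ => (H s).2.1
  · intro t ht
    rw [trackFinding, Timed.forEach_val, List.mem_flatMap] at ht
    obtain ⟨s, -, hs⟩ := ht
    have := (H s).2.2 t hs
    omega

/-! ## Cleaning -/

theorem mergeTracks_perm_time (ts us : List Track) :
    (mergeTracks ts us).val.Perm (ts ++ us) ∧
      (mergeTracks ts us).time ≤ 2 * (ts.length + us.length) + 1 := by
  classical
  induction ts, us using mergeTracks.induct with
  | case1 us => simp [mergeTracks]
  | case2 t ts => simp [mergeTracks]
  | case3 t ts u us h ih =>
    rw [mergeTracks, if_pos h]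
    refine ⟨ih.1.cons t, ?_⟩
    have := ih.2
    simp only [List.length_cons] at this ⊢
    omega
  | case4 t ts u us h ih =>
    rw [mergeTracks, if_neg h]
    refine ⟨(ih.1.cons u).trans ?_, ?_⟩
    · exact (List.perm_middle (a := u) (l₁ := t :: ts) (l₂ := us)).symm
    · have := ih.2
      simp only [List.length_cons] at this ⊢
      omega

/-- Halving a list of length `N ≥ 2` lowers `Nat.clog 2 N` by one for the larger half. One level
costs `N` for splitting and at most `2 N + 1` for merging; together with the additive constants of
the two recursive calls this is `3 N + 3 ≤ 4 N + 1`. -/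
theorem sortTracks_perm_time (ts : List Track) :
    (sortTracks ts).val.Perm ts ∧
      (sortTracks ts).time ≤ 4 * ts.length * Nat.clog 2 ts.length + 1 := by
  induction ts using sortTracks.induct with
  | case1 => simp [sortTracks]
  | case2 t => simp [sortTracks]
  | case3 t u ts h ih1 ih2 =>
    rw [sortTracks]
    obtain ⟨p1, t1⟩ := ih1
    obtain ⟨p2, t2⟩ := ih2
    have hm := mergeTracks_perm_time (sortTracks ((t :: u :: ts).take h)).val
      (sortTracks ((t :: u :: ts).drop h)).val
    refine ⟨hm.1.trans ((p1.append p2).trans (by rw [List.take_append_drop])), ?_⟩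
    have hm2 := hm.2
    rw [p1.length_eq, p2.length_eq] at hm2
    rw [List.length_take] at t1 hm2
    rw [List.length_drop] at t2 hm2
    set N := (t :: u :: ts).length with hN
    have hN2 : N = ts.length + 2 := by simp [hN]
    have hh : h = N / 2 := by rw [hN2]
    have hc : Nat.clog 2 N = Nat.clog 2 ((N + 1) / 2) + 1 := by
      rw [Nat.clog_of_two_le (by norm_num) (by omega)]; rfl
    have e1 : min h N = h := by omega
    rw [e1] at t1 hm2
    have c1 : Nat.clog 2 h ≤ Nat.clog 2 ((N + 1) / 2) := Nat.clog_mono_right 2 (by omega)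
    have c2 : Nat.clog 2 (N - h) ≤ Nat.clog 2 ((N + 1) / 2) := Nat.clog_mono_right 2 (by omega)
    have t1' := t1.trans (Nat.succ_le_succ (Nat.mul_le_mul_left (4 * h) c1))
    have t2' := t2.trans (Nat.succ_le_succ (Nat.mul_le_mul_left (4 * (N - h)) c2))
    have hsum : 4 * h * Nat.clog 2 ((N + 1) / 2) + 4 * (N - h) * Nat.clog 2 ((N + 1) / 2) =
        4 * N * Nat.clog 2 ((N + 1) / 2) := by
      rw [← Nat.add_mul]; congr 1; omega
    rw [hc, Nat.mul_add]
    dsimp only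
    change (sortTracks ((t :: u :: ts).take h)).time + (sortTracks ((t :: u :: ts).drop h)).time +
      (mergeTracks (sortTracks ((t :: u :: ts).take h)).val
        (sortTracks ((t :: u :: ts).drop h)).val).time + (ts.length + 2) ≤ _
    omega

theorem realHits_length_le (t : Track) : t.realHits.length ≤ t.meas.length :=
  List.length_filterMap_le _ _

theorem shared_le {t : Track} (ht : t.meas.length ≤ D.L) : D.shared t ≤ D.L := by
  refine Nat.ceil_le.2 ?_
  have h1 : (t.realHits.length : ℝ) ≤ D.L := by exact_mod_cast (realHits_length_le t).trans ht
  nlinarith [D.frac_le_one, D.frac_pos, (Nat.cast_nonneg t.realHits.length : (0 : ℝ) ≤ _)]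

theorem maxShared_le : D.maxShared ≤ D.L := by
  refine Nat.ceil_le.2 ?_
  nlinarith [D.frac_le_one, D.frac_pos, (Nat.cast_nonneg D.L : (0 : ℝ) ≤ _)]

theorem tuples_length_le (i : ℕ) {t : Track} {L : ℕ} (ht : t.meas.length ≤ L) :
    (tuples i t).length ≤ 2 ^ L := by
  rw [tuples, List.length_map, List.length_sublistsLen]
  exact (Nat.choose_le_two_pow _ _).trans
    (Nat.pow_le_pow_right (by norm_num) ((realHits_length_le t).trans ht))

/-- A track has at most `2 ^ L` tuples of each size, and each of the two loops consults at most `L +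
1` trees. Only the length of a search path depends on the number of tracks. -/
theorem clash_time_le (T : Trees) {t : Track} (ht : t.meas.length ≤ D.L) {S : ℕ}
    (hT : ∀ i j, (T i j).size ≤ S) :
    (D.clash T t).time ≤ 2 * (D.L + 1) * (2 ^ D.L * (pathBound S + 2) + 2) + 3 := by
  have H : ∀ (r i j : ℕ), (Timed.anyOf (tuples r t) fun x => (T i j).search x).time ≤
      2 ^ D.L * (pathBound S + 2) + 1 := fun r i j =>
    (Timed.anyOf_time_le fun x _ => (T i j).search_time_le (hT i j) x).trans
      (Nat.succ_le_succ (Nat.mul_le_mul_right _ (tuples_length_le r ht)))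
  have hs := D.shared_le ht
  have hm := D.maxShared_le
  have h1 : (Timed.anyOf (List.range' 1 (D.shared t)) fun i =>
      Timed.anyOf (tuples i t) fun x => (T i i).search x).time ≤
      (D.L + 1) * (2 ^ D.L * (pathBound S + 2) + 2) + 1 := by
    refine (Timed.anyOf_time_le fun i _ => H i i i).trans ?_
    rw [List.length_range']
    exact Nat.succ_le_succ (Nat.mul_le_mul_right _ (by omega))
  have h2 : (Timed.anyOf (List.range' (D.shared t) (D.maxShared + 1 - D.shared t)) fun i =>
      Timed.anyOf (tuples (D.shared t) t) fun x => (T (D.shared t) i).search x).time ≤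
      (D.L + 1) * (2 ^ D.L * (pathBound S + 2) + 2) + 1 := by
    refine (Timed.anyOf_time_le fun i _ => H (D.shared t) (D.shared t) i).trans ?_
    rw [List.length_range']
    exact Nat.succ_le_succ (Nat.mul_le_mul_right _ (by omega))
  simp only [clash]
  rw [mul_assoc]
  omega

/-- `s` bounds the trees before the insertions and `S` throughout, so that one path bound serves all
insertions. The growth is bounded crudely: every one of the at most `L` rounds is allowed to enlarge
all trees by `2 ^ L`. -/
theorem insertTuples_bounds (T : Trees) {t : Track} (ht : t.meas.length ≤ D.L) {s S : ℕ}
    (hT : ∀ i j, (T i j).size ≤ s) (hS : s + D.L * 2 ^ D.L ≤ S) :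
    (D.insertTuples T t).time ≤ D.L * (2 ^ D.L * (2 * pathBound S + 2) + 3) + 1 ∧
    ∀ i j, ((D.insertTuples T t).val i j).size ≤ s + D.L * 2 ^ D.L := by
  have hs := D.shared_le ht
  have hr : D.shared t * 2 ^ D.L ≤ D.L * 2 ^ D.L := Nat.mul_le_mul_right _ hs
  have key := Timed.loop_time_size_le (l := List.range' 1 (D.shared t))
    (f := fun (T : Trees) i =>
      (⟨Function.update T i (Function.update (T i) (D.shared t)
        (Timed.loop (tuples i t) (T i (D.shared t)) fun S x => S.add x).val),
        (Timed.loop (tuples i t) (T i (D.shared t)) fun S x => S.add x).time + 1⟩ : Timed Trees))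
    (fun m T => ∀ i j, (T i j).size ≤ m) (B := 2 ^ D.L * (2 * pathBound S + 2) + 2)
    (c := 2 ^ D.L) (S := S)
    (by
      intro i hi m T hm hT
      have htl := tuples_length_le i ht
      have h := Timed.loop_time_size_le (l := tuples i t) (f := fun (S : KeyTree) x => S.add x)
        (fun m T => T.size ≤ m) (B := 2 * pathBound S + 1) (c := 1) (S := S)
        (fun x _ m U hm hU => ⟨U.add_time_le (hU.trans (by omega)) x,
          (U.size_add_le x).trans (Nat.succ_le_succ hU)⟩) m (by omega) (T i (D.shared t)) (hT _ _)
      refine ⟨?_, ?_⟩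
      · refine Nat.succ_le_succ (h.1.trans (Nat.succ_le_succ (Nat.mul_le_mul_right _ htl)))
      · intro i' j'
        dsimp only
        by_cases hi : i' = i
        · subst hi
          rw [Function.update_self]
          by_cases hj : j' = D.shared t
          · subst hj
            rw [Function.update_self]
            have := h.2
            omega
          · rw [Function.update_of_ne hj]
            exact (hT _ _).trans (by omega)
        · rw [Function.update_of_ne hi]
          exact (hT _ _).trans (by omega))
    s
    (by rw [List.length_range']; omega) T hT
  rw [List.length_range'] at key
  exact ⟨key.1.trans (Nat.succ_le_succ (Nat.mul_le_mul_right _ hs)),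
    fun i j => (key.2 i j).trans (by omega)⟩

/-- A bound for the time of one round of cleaning with trees of size at most `S`. -/
def cleanTime (S : ℕ) : ℕ :=
  2 * (D.L + 1) * (2 ^ D.L * (pathBound S + 2) + 2) + 3 +
    (D.L * (2 ^ D.L * (2 * pathBound S + 2) + 3) + 1)

/-- `S` bounds the trees as they can be after all tracks have been accepted, so that every round has
the same time bound. -/
theorem cleanLoop_bounds {ts : List Track} (hts : ∀ t ∈ ts, t.meas.length ≤ D.L) (T : Trees)
    {s S : ℕ} (hT : ∀ i j, (T i j).size ≤ s) (hS : s + ts.length * (D.L * 2 ^ D.L) ≤ S) :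
    (D.cleanLoop T ts).time ≤ ts.length * (D.cleanTime S + 2) + 1 ∧
    (D.cleanLoop T ts).val.length ≤ ts.length := by
  induction ts generalizing T s with
  | nil => simp [cleanLoop]
  | cons t ts ih =>
    simp only [List.length_cons, Nat.add_mul, one_mul] at hS ⊢
    have ht := hts t (by simp)
    have hts' : ∀ u ∈ ts, u.meas.length ≤ D.L := fun u hu => hts u (by simp [hu])
    have h1 := D.clash_time_le T ht fun i j => (hT i j).trans (show s ≤ S by omega)
    obtain ⟨h2, h3⟩ := D.insertTuples_bounds T ht hT (S := S) (by omega)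
    unfold cleanLoop
    dsimp only
    split
    · have := ih hts' T hT (by omega)
      simp only [cleanTime] at *
      exact ⟨by omega, by omega⟩
    · have := ih hts' _ h3 (by omega)
      simp only [cleanTime, List.length_cons] at *
      exact ⟨by omega, by omega⟩

theorem improvedCleaning_bounds {ts : List Track} (hts : ∀ t ∈ ts, t.meas.length ≤ D.L) :
    (D.improvedCleaning ts).time ≤ 4 * ts.length * Nat.clog 2 ts.length +
      ts.length * (D.cleanTime (ts.length * (D.L * 2 ^ D.L)) + 2) + D.L ^ 2 + 3 ∧
    (D.improvedCleaning ts).val.length ≤ ts.length := by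
  obtain ⟨hp, ht⟩ := sortTracks_perm_time ts
  have h := D.cleanLoop_bounds (ts := (sortTracks ts).val)
    (fun t h => hts t (hp.mem_iff.1 h)) (fun _ _ => ∅) (s := 0)
    (S := ts.length * (D.L * 2 ^ D.L)) (fun i j => Nat.le_of_eq rfl) (by rw [hp.length_eq]; omega)
  rw [hp.length_eq] at h
  have hm : D.maxShared ^ 2 ≤ D.L ^ 2 := Nat.pow_le_pow_left D.maxShared_le 2
  refine ⟨?_, h.2⟩
  simp only [improvedCleaning]
  omega

theorem trackSelection_time_le (ts : List Track) :
    (D.trackSelection ts).time ≤ ts.length * (D.L + 4) + 1 := by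
  classical
  refine Timed.forEach_time_le fun t _ => ?_
  split <;> simp

/-- It separates the logarithm of the number of seeds from that of a constant of the detector. -/
theorem clog_mul_add_one_le (s A : ℕ) :
    Nat.clog 2 (s * A + 1) ≤ Nat.clog 2 (s + 1) + Nat.clog 2 (A + 1) := by
  refine (Nat.clog_le_iff_le_pow (by norm_num)).2 ?_
  rw [pow_add]
  calc s * A + 1 ≤ (s + 1) * (A + 1) := by nlinarith
    _ ≤ _ := Nat.mul_le_mul (Nat.le_pow_clog (by norm_num) _) (Nat.le_pow_clog (by norm_num) _)

theorem add_le_succ_mul_succ (p c : ℕ) : p + c ≤ (c + 1) * (p + 1) := by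
  have := Nat.zero_le (c * p)
  linarith [show (c + 1) * (p + 1) = c * p + c + p + 1 by ring]

/-- The stages after seed generation take time `O(n k log k)`. -/
theorem laterStages_time_le : ∃ K : ℕ, ∀ (E : EventRecord) (seeds : List Seed),
    (D.laterStages E seeds).time ≤
      K * ((E.n + 1) * (seeds.length + 1) * (Nat.clog 2 (seeds.length + 1) + 1)) := by
  -- Each seed contributes at most `A` keys to a tree: `lam` candidates with at most `L * 2 ^ L`
  -- keys each.
  set A := D.lam * (D.L * 2 ^ D.L) with hA
  set c := Nat.clog 2 (A + 1) with hc
  set c' := Nat.clog 2 (D.lam + 1) with hc'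
  -- `Q` is `cleanTime` with the path bound replaced by `3 (c + 1)`. As `p + c ≤ (c + 1) (p + 1)`,
  -- one round of cleaning takes at most `Q (p + 1)`, where `p` is the logarithm of the number of
  -- seeds.
  set Q := 2 * (D.L + 1) * (2 ^ D.L * (3 * (c + 1) + 2) + 2) + 3 +
    (D.L * (2 ^ D.L * (2 * (3 * (c + 1)) + 2) + 3) + 1) with hQ
  refine ⟨D.L * (9 * D.lam + 3 * D.lam ^ 2 + 3) + D.lam + 5 + 1 + 4 * D.lam * (c' + 1) +
    D.lam * (Q + 2) + D.L ^ 2 + 3 + D.lam * (D.L + 4) + 1, fun E seeds => ?_⟩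
  obtain ⟨f1, f2, f3⟩ := D.trackFinding_bounds E seeds
  obtain ⟨g1, g2⟩ := D.improvedCleaning_bounds f3
  have h1 := D.trackSelection_time_le (D.improvedCleaning (D.trackFinding E seeds).val).val
  simp only [laterStages]
  set s := seeds.length
  set len := (D.trackFinding E seeds).val.length
  set p := Nat.clog 2 (s + 1) with hp
  set X := (E.n + 1) * (s + 1) * (p + 1) with hX
  have cl1 : Nat.clog 2 (s * D.lam + 1) ≤ p + c' := clog_mul_add_one_le s D.lam
  have cl2 : Nat.clog 2 (s * A + 1) ≤ p + c := clog_mul_add_one_le s A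
  clear_value Q c c' p s len
  have hX1 : (E.n + 1) * (s + 1) ≤ X := Nat.le_mul_of_pos_right _ (by omega)
  have hX2 : (s + 1) * (p + 1) ≤ X := Nat.mul_le_mul_right _ (Nat.le_mul_of_pos_left _ (by omega))
  have hX3 : s ≤ X := le_trans (by nlinarith) hX1
  have hX4 : 1 ≤ X := Nat.mul_pos (Nat.mul_pos (by omega) (by omega)) (by omega)
  have hX5 : s * (p + 1) ≤ X := le_trans (Nat.mul_le_mul_right _ (by omega)) hX2
  have a1 : s * (D.L * D.layerTime E.n + D.lam + 5) + 1 ≤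
      (D.L * (9 * D.lam + 3 * D.lam ^ 2 + 3) + D.lam + 5 + 1) * X := by
    have e1 : s * (E.n + 1) ≤ X := by nlinarith
    calc s * (D.L * D.layerTime E.n + D.lam + 5) + 1
        = D.L * (9 * D.lam + 3 * D.lam ^ 2 + 3) * (s * (E.n + 1)) + (D.lam + 5) * s + 1 := by
          simp only [layerTime]; ring
      _ ≤ D.L * (9 * D.lam + 3 * D.lam ^ 2 + 3) * X + (D.lam + 5) * X + X := by gcongr
      _ = _ := by ring
  have b1 : Nat.clog 2 len ≤ p + c' :=
    (Nat.clog_mono_right 2 (f2.trans (Nat.le_succ _))).trans cl1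
  have a2 : 4 * len * Nat.clog 2 len ≤ 4 * D.lam * (c' + 1) * X := by
    calc 4 * len * Nat.clog 2 len ≤ 4 * (s * D.lam) * (p + c') := by gcongr
      _ ≤ 4 * (s * D.lam) * ((c' + 1) * (p + 1)) :=
          Nat.mul_le_mul_left _ (add_le_succ_mul_succ p c')
      _ = 4 * D.lam * (c' + 1) * (s * (p + 1)) := by ring
      _ ≤ _ := Nat.mul_le_mul_left _ hX5
  have b2 : pathBound (len * (D.L * 2 ^ D.L)) ≤ 3 * (c + 1) * (p + 1) := by
    have e : len * (D.L * 2 ^ D.L) ≤ s * A := by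
      rw [hA, ← mul_assoc s]; exact Nat.mul_le_mul_right _ f2
    calc pathBound (len * (D.L * 2 ^ D.L)) ≤ pathBound (s * A) := pathBound_mono e
      _ ≤ 3 * (p + c) := Nat.mul_le_mul_left _ cl2
      _ ≤ 3 * ((c + 1) * (p + 1)) := Nat.mul_le_mul_left _ (add_le_succ_mul_succ p c)
      _ = _ := by ring
  have b3 : D.cleanTime (len * (D.L * 2 ^ D.L)) ≤ Q * (p + 1) := by
    simp only [cleanTime]
    set P := pathBound (len * (D.L * 2 ^ D.L))
    calc _ ≤ 2 * (D.L + 1) * (2 ^ D.L * (3 * (c + 1) * (p + 1) + 2 * (p + 1)) + 2 * (p + 1)) +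
            3 * (p + 1) +
          (D.L * (2 ^ D.L * (2 * (3 * (c + 1) * (p + 1)) + 2 * (p + 1)) + 3 * (p + 1)) +
            1 * (p + 1)) := by
          gcongr <;> omega
      _ = _ := by rw [hQ]; ring
  have a3 : len * (D.cleanTime (len * (D.L * 2 ^ D.L)) + 2) ≤ D.lam * (Q + 2) * X := by
    calc _ ≤ (s * D.lam) * (Q * (p + 1) + 2 * (p + 1)) := by gcongr; omega
      _ = D.lam * (Q + 2) * (s * (p + 1)) := by ring
      _ ≤ _ := by gcongr
  have a4 : (D.improvedCleaning (D.trackFinding E seeds).val).val.length * (D.L + 4) ≤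
      D.lam * (D.L + 4) * X := by
    calc _ ≤ (s * D.lam) * (D.L + 4) := by gcongr; exact g2.trans f2
      _ = D.lam * (D.L + 4) * s := by ring
      _ ≤ _ := by gcongr
  have a5 : D.L ^ 2 + 3 ≤ (D.L ^ 2 + 3) * X := Nat.le_mul_of_pos_right _ hX4
  linarith

end Detector

/-! ## Good seeds and marked basis states -/

/-- An element of the result reveals through `g` which entry of `l` produced it, so different
entries have disjoint outputs. -/
theorem List.nodup_flatMap_of_key {α β : Type*} {l : List α} {f : α → List β} (g : β → α)
    (hg : ∀ a ∈ l, ∀ b ∈ f a, g b = a) (hl : l.Nodup) (hf : ∀ a ∈ l, (f a).Nodup) :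
    (l.flatMap f).Nodup := by
  refine List.nodup_flatMap.2 ⟨hf, ?_⟩
  refine List.Pairwise.imp_of_mem (fun {a b} ha hb hab => ?_) hl
  intro x hxa hxb
  exact hab ((hg a ha x hxa).symm.trans (hg b hb x hxb))

theorem EventRecord.mem_hits {E : EventRecord} {l : ℕ} {h : ℕ × Hit} :
    h ∈ E.hits l ↔ E.hit l h.1 = some h.2 := by
  simp only [EventRecord.hits, List.mem_filterMap, List.mem_range, Option.map_eq_some_iff]
  constructor
  · rintro ⟨j, -, x, hx, rfl⟩
    exact hx
  · intro hh
    refine ⟨h.1, ?_, h.2, hh, rfl⟩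
    by_contra hlt
    rw [E.hit_none l h.1 (not_lt.1 hlt)] at hh
    cases hh

theorem EventRecord.nodup_hits (E : EventRecord) (l : ℕ) : (E.hits l).Nodup := by
  refine List.Nodup.filterMap ?_ List.nodup_range
  intro a a' b hb hb'
  simp only [Option.mem_def, Option.map_eq_some_iff] at hb hb'
  obtain ⟨x, -, rfl⟩ := hb
  obtain ⟨y, -, h⟩ := hb'
  exact (congrArg Prod.fst h).symm

theorem EventRecord.lt_two_pow_bits (E : EventRecord) {l j : ℕ} {x : Hit}
    (h : E.hit l j = some x) : j < 2 ^ E.bits := by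
  have : j < E.n := by
    by_contra hlt
    rw [E.hit_none l j (not_lt.1 hlt)] at h
    cases h
  exact this.trans_le (Nat.le_pow_clog (by norm_num) _)

theorem Idx.label_injective {b : ℕ} {y y' : Idx b} (h : ∀ l, y.label l = y'.label l) : y = y' := by
  funext ⟨l, i⟩
  have := congrArg (fun m => Nat.testBit m i) (h l)
  simpa [Idx.label, Nat.testBit_ofBits_lt] using this

namespace Detector

variable (D : Detector)

theorem seedAt_eq_some {E : EventRecord} {j₀ j₁ j₂ : ℕ} {s : Seed} :
    D.seedAt E j₀ j₁ j₂ = some s ↔ j₀ = s.j₀ ∧ j₁ = s.j₁ ∧ j₂ = s.j₂ ∧ E.hit 0 s.j₀ = some s.x₀ ∧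
      E.hit 1 s.j₁ = some s.x₁ ∧ E.hit 2 s.j₂ = some s.x₂ ∧ D.good s.x₀ s.x₁ s.x₂ = true := by
  constructor
  · intro h
    unfold seedAt at h
    split at h
    · split at h
      · cases h; simp_all
      · cases h
    · cases h
  · rintro ⟨rfl, rfl, rfl, h0, h1, h2, hg⟩
    simp [seedAt, h0, h1, h2, hg]

theorem mem_seedGeneration {E : EventRecord} {s : Seed} :
    s ∈ (D.seedGeneration E).val ↔ D.seedAt E s.j₀ s.j₁ s.j₂ = some s := by
  simp only [seedGeneration, Timed.forEach_val, List.mem_flatMap, seedAt_eq_some, true_and]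
  constructor
  · rintro ⟨h₀, m0, h₁, m1, h₂, m2, hs⟩
    rw [EventRecord.mem_hits] at m0 m1 m2
    split at hs
    · simp only [List.mem_singleton] at hs
      subst hs
      exact ⟨m0, m1, m2, by assumption⟩
    · simp at hs
  · rintro ⟨h0, h1, h2, hg⟩
    exact ⟨(s.j₀, s.x₀), EventRecord.mem_hits.2 h0, (s.j₁, s.x₁), EventRecord.mem_hits.2 h1,
      (s.j₂, s.x₂), EventRecord.mem_hits.2 h2, by simp [hg]⟩

theorem nodup_seedGeneration (E : EventRecord) : (D.seedGeneration E).val.Nodup := by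
  have key : ∀ (h₀ h₁ h₂ : ℕ × Hit) (s : Seed), s ∈
      (if D.good h₀.2 h₁.2 h₂.2 then (⟨[⟨h₀.1, h₁.1, h₂.1, h₀.2, h₁.2, h₂.2⟩], 2⟩ : Timed (List Seed))
      else ⟨[], 2⟩).val → s = ⟨h₀.1, h₁.1, h₂.1, h₀.2, h₁.2, h₂.2⟩ := by
    intro h₀ h₁ h₂ s hs
    split at hs
    · simpa using hs
    · simp at hs
  simp only [seedGeneration, Timed.forEach_val]
  refine List.nodup_flatMap_of_key (fun s => (s.j₀, s.x₀)) ?_ (E.nodup_hits 0) fun h₀ _ =>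
    List.nodup_flatMap_of_key (fun s => (s.j₁, s.x₁)) ?_ (E.nodup_hits 1) fun h₁ _ =>
    List.nodup_flatMap_of_key (fun s => (s.j₂, s.x₂)) ?_ (E.nodup_hits 2) fun h₂ _ => ?_
  · intro h₀ _ s hs
    simp only [List.mem_flatMap] at hs
    obtain ⟨h₁, -, h₂, -, hs⟩ := hs
    rw [key _ _ _ _ hs]
  · intro h₁ _ s hs
    simp only [List.mem_flatMap] at hs
    obtain ⟨h₂, -, hs⟩ := hs
    rw [key _ _ _ _ hs]
  · intro h₂ _ s hs
    rw [key _ _ _ _ hs]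
  · split <;> simp

/-- The good seed whose labels are encoded in a basis state. -/
def seedOf (E : EventRecord) (y : Idx E.bits) : Option Seed :=
  D.seedAt E (y.label 0) (y.label 1) (y.label 2)

theorem mem_seedGeneration_of_seedOf {E : EventRecord} {y : Idx E.bits} {s : Seed}
    (h : D.seedOf E y = some s) : s ∈ (D.seedGeneration E).val := by
  rw [mem_seedGeneration]
  have h' := (D.seedAt_eq_some).1 h
  exact (D.seedAt_eq_some).2 ⟨rfl, rfl, rfl, h'.2.2.2⟩

theorem seedOf_injective {E : EventRecord} {y y' : Idx E.bits} {s : Seed}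
    (h : D.seedOf E y = some s) (h' : D.seedOf E y' = some s) : y = y' := by
  have h := (D.seedAt_eq_some).1 h
  have h' := (D.seedAt_eq_some).1 h'
  refine Idx.label_injective fun l => ?_
  fin_cases l
  · exact h.1.trans h'.1.symm
  · exact h.2.1.trans h'.2.1.symm
  · exact h.2.2.1.trans h'.2.2.1.symm

theorem exists_seedOf {E : EventRecord} {s : Seed} (hs : s ∈ (D.seedGeneration E).val) :
    ∃ y, D.seedOf E y = some s := by
  have h := (D.seedAt_eq_some).1 (D.mem_seedGeneration.1 hs)
  obtain ⟨-, -, -, h0, h1, h2, hg⟩ := h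
  have hl : ∀ j < 2 ^ E.bits, Nat.ofBits (fun i : Fin E.bits => j.testBit i) = j := fun j hj => by
    rw [Nat.ofBits_testBit, Nat.mod_eq_of_lt hj]
  refine ⟨fun li => (![s.j₀, s.j₁, s.j₂] li.1).testBit li.2, (D.seedAt_eq_some).2
    ⟨?_, ?_, ?_, h0, h1, h2, hg⟩⟩
  · exact hl _ (E.lt_two_pow_bits h0)
  · exact hl _ (E.lt_two_pow_bits h1)
  · exact hl _ (E.lt_two_pow_bits h2)

-- Labels of measured hits fit into `b` bits, and a basis state is determined by its labels, so a
-- seed corresponds to exactly one basis state. The statement is for sublists because it serves both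
-- the set of all seeds and the set of those not yet found.
open Classical in
theorem card_seedOf_mem {E : EventRecord} {l : List Seed} (hl : l.Nodup)
    (hs : ∀ s ∈ l, s ∈ (D.seedGeneration E).val) :
    (Finset.univ.filter fun y => ∃ s ∈ l, D.seedOf E y = some s).card = l.length := by
  rw [← List.toFinset_card_of_nodup hl]
  symm
  refine Finset.card_bij (fun s h => (D.exists_seedOf (hs s (List.mem_toFinset.1 h))).choose)
    ?_ ?_ ?_
  · intro s h
    simp only [Finset.mem_filter, Finset.mem_univ, true_and]
    exact ⟨s, List.mem_toFinset.1 h, (D.exists_seedOf (hs s (List.mem_toFinset.1 h))).choose_spec⟩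
  · intro s h s' h' e
    have a := (D.exists_seedOf (hs s (List.mem_toFinset.1 h))).choose_spec
    have b := (D.exists_seedOf (hs s' (List.mem_toFinset.1 h'))).choose_spec
    rw [e, b] at a
    exact (Option.some.inj a).symm
  · intro y hy
    simp only [Finset.mem_filter, Finset.mem_univ, true_and] at hy
    obtain ⟨s, h, hsy⟩ := hy
    exact ⟨s, List.mem_toFinset.2 h, D.seedOf_injective (D.exists_seedOf (hs s h)).choose_spec hsy⟩

theorem markSeed_iff {E : EventRecord} {y : Idx E.bits} :
    D.markSeed E y = true ↔ ∃ s ∈ (D.seedGeneration E).val, D.seedOf E y = some s := by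
  constructor
  · intro h
    obtain ⟨s, hs⟩ := Option.isSome_iff_exists.1 h
    exact ⟨s, D.mem_seedGeneration_of_seedOf hs, hs⟩
  · rintro ⟨s, -, hs⟩
    exact Option.isSome_iff_exists.2 ⟨s, hs⟩

/-- Rounding `n` up to a power of two adds labels without hits, and hence no marked states. -/
theorem countMarked_markSeed (E : EventRecord) : countMarked (D.markSeed E) = D.kSeed E := by
  classical
  rw [kSeed, ← D.card_seedOf_mem (D.nodup_seedGeneration E) fun s h => h, countMarked]
  congr 1
  ext y
  simp only [Finset.mem_filter, Finset.mem_univ, true_and, D.markSeed_iff]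

end Detector

/-! ## Expectations of programs -/

namespace Prog

variable {b : ℕ} {α β : Type} (mark : Idx b → Bool) (g : ℕ)

theorem expect_bind (p : Prog b α) (f : α → Prog b β) (φ : β → ℕ → ℕ → ℝ) :
    (p.bind f).expect mark g φ =
      p.expect mark g fun a t m => (f a).expect mark g fun c s l => φ c (t + s) (m + l) := by
  induction p generalizing φ with
  | ret a => simp [bind, expect]
  | step t p ih =>
    simp only [bind, expect, ih, add_assoc]
  | run q c k ih =>
    simp only [bind, expect, ih, add_assoc]

/-- Only the nonnegativity of the weights matters. That the weights sum to one is not used for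
general programs; it is proved for the circuits that occur, through the expectations of constants.
-/
theorem expect_mono (p : Prog b α) {φ ψ : α → ℕ → ℕ → ℝ} (h : ∀ a t m, φ a t m ≤ ψ a t m) :
    p.expect mark g φ ≤ p.expect mark g ψ := by
  induction p generalizing φ ψ with
  | ret a => exact h a 0 0
  | step t p ih => exact ih fun a s m => h a _ m
  | run q c k ih =>
    exact Finset.sum_le_sum fun x _ => mul_le_mul_of_nonneg_left (ih x fun a s m => h a _ _)
      (by positivity)

theorem expect_add (p : Prog b α) (φ ψ : α → ℕ → ℕ → ℝ) :
    p.expect mark g (fun a t m => φ a t m + ψ a t m) =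
      p.expect mark g φ + p.expect mark g ψ := by
  induction p generalizing φ ψ with
  | ret a => rfl
  | step t p ih => exact ih _ _
  | run q c k ih =>
    simp only [expect, ih, mul_add, Finset.sum_add_distrib]

theorem expect_smul (p : Prog b α) (r : ℝ) (φ : α → ℕ → ℕ → ℝ) :
    p.expect mark g (fun a t m => r * φ a t m) = r * p.expect mark g φ := by
  induction p generalizing φ with
  | ret a => rfl
  | step t p ih => exact ih _
  | run q c k ih =>
    simp only [expect, ih, Finset.mul_sum]
    exact Finset.sum_congr rfl fun x _ => by ring

end Prog

/-! ## The Grover operator -/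

theorem neg_one_pow_card_filter {ι : Type*} [Fintype ι] (p : ι → Prop) [DecidablePred p] :
    (-1 : ℂ) ^ (Finset.univ.filter p).card = ∏ i, if p i then (-1 : ℂ) else 1 := by
  rw [Finset.prod_ite]
  simp

theorem sqrt_two_pow_mul_self (n : ℕ) :
    ((Real.sqrt 2 : ℝ) : ℂ) ^ n * ((Real.sqrt 2 : ℝ) : ℂ) ^ n = 2 ^ n := by
  rw [← mul_pow, ← Complex.ofReal_mul, Real.mul_self_sqrt (by norm_num)]
  norm_num

/-- The sum over all basis states factors into a product over the qubits, where a qubit contributes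
`2` if the two indices agree there and `0` otherwise. -/
theorem walshMatrix_mul_self (b : ℕ) : walshMatrix b * walshMatrix b = 1 := by
  ext x z
  have key : ∑ y : Idx b, (∏ i, if x i = true ∧ y i = true then (-1 : ℂ) else 1) *
      (∏ i, if y i = true ∧ z i = true then (-1 : ℂ) else 1) =
      if x = z then 2 ^ (3 * b) else 0 := by
    simp_rw [← Finset.prod_mul_distrib]
    have h := Finset.prod_univ_sum (fun _ : Fin 3 × Fin b => (Finset.univ : Finset Bool))
      (fun i c => (if x i = true ∧ c = true then (-1 : ℂ) else 1) *
        (if c = true ∧ z i = true then (-1 : ℂ) else 1))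
    rw [Fintype.piFinset_univ] at h
    rw [← h]
    have hi : ∀ i, ∑ c : Bool, (if x i = true ∧ c = true then (-1 : ℂ) else 1) *
        (if c = true ∧ z i = true then (-1 : ℂ) else 1) = if x i = z i then 2 else 0 := by
      intro i
      rw [Fintype.sum_bool]
      cases x i <;> cases z i <;> norm_num
    simp_rw [hi]
    split_ifs with hxz
    · subst hxz
      simp
    · obtain ⟨i, hi⟩ := Function.ne_iff.1 hxz
      exact Finset.prod_eq_zero (Finset.mem_univ i) (if_neg hi)
  rw [Matrix.mul_apply, Matrix.one_apply]
  simp only [walshMatrix, neg_one_pow_card_filter, div_mul_div_comm, sqrt_two_pow_mul_self]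
  rw [← Finset.sum_div, key]
  split_ifs <;> simp

theorem walshMatrix_zero_right (b : ℕ) (x : Idx b) :
    walshMatrix b x (fun _ => false) = 1 / (Real.sqrt 2 : ℂ) ^ (3 * b) := by
  simp [walshMatrix]

theorem walshMatrix_zero_left (b : ℕ) (x : Idx b) :
    walshMatrix b (fun _ => false) x = 1 / (Real.sqrt 2 : ℂ) ^ (3 * b) := by
  simp [walshMatrix]

/-- Conjugating the reflection about the all-zero state by the Walsh-Hadamard transform gives the
inversion about the mean, the matrix with all entries `2 / N` minus the identity. -/
theorem groverMatrix_mulVec {b : ℕ} (mark : Idx b → Bool) (φ : Idx b → ℂ) (y : Idx b) :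
    (groverMatrix mark *ᵥ φ) y =
      2 / 2 ^ (3 * b) * ∑ z, (if mark z then -1 else 1) * φ z - (if mark y then -1 else 1) * φ y := by
  have h1 : walshMatrix b * reflectZero b * walshMatrix b =
      Matrix.of (fun _ _ => (2 / 2 ^ (3 * b) : ℂ)) - 1 := by
    rw [reflectZero, mul_sub, sub_mul, mul_one, walshMatrix_mul_self]
    congr 1
    ext x z
    rw [mul_smul_comm, smul_mul_assoc, Matrix.smul_apply, Matrix.mul_apply]
    rw [Finset.sum_eq_single (fun _ => false)]
    · rw [Matrix.mul_single_apply_same, walshMatrix_zero_left, walshMatrix_zero_right, mul_one,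
        div_mul_div_comm, sqrt_two_pow_mul_self]
      simp [div_eq_mul_inv]
    · intro w _ hw
      rw [Matrix.mul_single_apply_of_ne (hbj := hw), zero_mul]
    · simp
  have h2 : oracleMatrix mark *ᵥ φ = fun z => (if mark z then -1 else 1) * φ z := by
    ext z
    rw [oracleMatrix, Matrix.mulVec_diagonal]
  rw [groverMatrix, ← Matrix.mulVec_mulVec, h1, h2, Matrix.sub_mulVec, Matrix.one_mulVec,
    Pi.sub_apply]
  congr 1
  simp only [Matrix.mulVec, dotProduct]
  rw [Finset.mul_sum]
  rfl

/-- The vector with coordinates `s`, `c` in the plane of the normalized sums of the marked and of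
the unmarked basis states. -/
noncomputable def planeVec {b : ℕ} (mark : Idx b → Bool) (s c : ℝ) : Idx b → ℂ := fun y =>
  if mark y then ((s / √(countMarked mark) : ℝ) : ℂ)
  else ((c / √((2 : ℝ) ^ (3 * b) - countMarked mark) : ℝ) : ℂ)

/-- The angle `θ` with `sin² θ = k / N`. -/
noncomputable def groverAngle (b k : ℕ) : ℝ := Real.arcsin √(k / (2 : ℝ) ^ (3 * b))

theorem groverAngle_nonneg (b k : ℕ) : 0 ≤ groverAngle b k :=
  Real.arcsin_nonneg.2 (Real.sqrt_nonneg _)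

theorem groverAngle_le (b k : ℕ) : groverAngle b k ≤ Real.pi / 2 := Real.arcsin_le_pi_div_two _

theorem card_idx (b : ℕ) : Fintype.card (Idx b) = 2 ^ (3 * b) := by simp

theorem countMarked_le {b : ℕ} (mark : Idx b → Bool) : countMarked mark ≤ 2 ^ (3 * b) :=
  (Finset.card_le_univ _).trans (card_idx b).le

theorem sin_groverAngle {b k : ℕ} (hk : k ≤ 2 ^ (3 * b)) :
    Real.sin (groverAngle b k) = √k / √((2 : ℝ) ^ (3 * b)) := by
  have h : (k : ℝ) ≤ (2 : ℝ) ^ (3 * b) := by exact_mod_cast hk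
  rw [groverAngle, Real.sin_arcsin (by linarith [Real.sqrt_nonneg (k / (2 : ℝ) ^ (3 * b))]),
    Real.sqrt_div (by positivity)]
  exact Real.sqrt_le_iff.2 ⟨zero_le_one, by
    rw [one_pow]; exact div_le_one_of_le₀ h (by positivity)⟩

theorem cos_groverAngle {b k : ℕ} (hk : k ≤ 2 ^ (3 * b)) :
    Real.cos (groverAngle b k) = √((2 : ℝ) ^ (3 * b) - k) / √((2 : ℝ) ^ (3 * b)) := by
  have h : (k : ℝ) ≤ (2 : ℝ) ^ (3 * b) := by exact_mod_cast hk
  rw [groverAngle, Real.cos_arcsin, Real.sq_sqrt (by positivity),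
    ← Real.sqrt_div (by linarith)]
  congr 1
  field_simp

theorem sum_mark {b : ℕ} (mark : Idx b → Bool) (u v : ℂ) :
    ∑ y, (if mark y then u else v) =
      countMarked mark * u + ((2 : ℂ) ^ (3 * b) - countMarked mark) * v := by
  rw [Finset.sum_ite, Finset.sum_const, Finset.sum_const, nsmul_eq_mul, nsmul_eq_mul]
  have h := Finset.card_filter_add_card_filter_not (s := (Finset.univ : Finset (Idx b)))
    (fun y => mark y = true)
  rw [Finset.card_univ, card_idx] at h
  have h' : ((2 : ℂ) ^ (3 * b)) =
      (countMarked mark : ℂ) + (Finset.univ.filter fun y => ¬ mark y = true).card := by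
    exact_mod_cast h.symm
  rw [h', add_sub_cancel_left]
  rfl

/-- After the oracle the coordinates sum to `√N cos (φ + θ)`, so the inversion about the mean adds
`2 cos (φ + θ) / √N` to each negated coordinate. In normalized coordinates this is `2 cos (φ + θ)
sin θ + sin φ = sin (φ + 2θ)`, and likewise for the cosine. -/
theorem grover_planeVec {b : ℕ} (mark : Idx b → Bool) (φ : ℝ) :
    groverMatrix mark *ᵥ planeVec mark (Real.sin φ) (Real.cos φ) =
      planeVec mark (Real.sin (φ + 2 * groverAngle b (countMarked mark)))
        (Real.cos (φ + 2 * groverAngle b (countMarked mark))) := by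
  have hk := countMarked_le mark
  set k := countMarked mark with hkdef
  set θ := groverAngle b k with hθ
  have hs : Real.sin θ = √k / √((2 : ℝ) ^ (3 * b)) := sin_groverAngle hk
  have hc : Real.cos θ = √((2 : ℝ) ^ (3 * b) - k) / √((2 : ℝ) ^ (3 * b)) := cos_groverAngle hk
  have hNk : (0 : ℝ) ≤ (2 : ℝ) ^ (3 * b) - k := by
    have : (k : ℝ) ≤ (2 : ℝ) ^ (3 * b) := by exact_mod_cast hk
    linarith
  have hN : 0 < √((2 : ℝ) ^ (3 * b)) := Real.sqrt_pos.2 (by positivity)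
  have hN2 : √((2 : ℝ) ^ (3 * b)) * √((2 : ℝ) ^ (3 * b)) = (2 : ℝ) ^ (3 * b) :=
    Real.mul_self_sqrt (by positivity)
  have hsum : ∑ z, (if mark z then (-1 : ℂ) else 1) *
      planeVec mark (Real.sin φ) (Real.cos φ) z =
      ((√((2 : ℝ) ^ (3 * b)) * Real.cos (φ + θ) : ℝ) : ℂ) := by
    have e : ∀ z, (if mark z then (-1 : ℂ) else 1) * planeVec mark (Real.sin φ) (Real.cos φ) z =
        if mark z then ((-(Real.sin φ / √k) : ℝ) : ℂ) else
          ((Real.cos φ / √((2 : ℝ) ^ (3 * b) - k) : ℝ) : ℂ) := by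
      intro z
      simp only [planeVec, ← hkdef]
      split_ifs <;> simp
    simp_rw [e, sum_mark, ← hkdef]
    -- The division by `√k` is harmless for `k = 0`, since `k / √k = √k` holds there as well; the
    -- same applies to `N - k` in `e2`.
    have e1 : (k : ℝ) * (-(Real.sin φ / √k)) = - (Real.sin φ * (√((2 : ℝ) ^ (3 * b)) * Real.sin θ)) := by
      have h2 : √((2 : ℝ) ^ (3 * b)) * Real.sin θ = √k := by rw [hs]; field_simp
      have h3 : (k : ℝ) / √k = √k := Real.div_sqrt
      rw [h2]
      calc (k : ℝ) * (-(Real.sin φ / √k)) = -(Real.sin φ * (k / √k)) := by ring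
        _ = _ := by rw [h3]
    have e2 : ((2 : ℝ) ^ (3 * b) - k) * (Real.cos φ / √((2 : ℝ) ^ (3 * b) - k)) =
        Real.cos φ * (√((2 : ℝ) ^ (3 * b)) * Real.cos θ) := by
      have h2 : √((2 : ℝ) ^ (3 * b)) * Real.cos θ = √((2 : ℝ) ^ (3 * b) - k) := by
        rw [hc]; field_simp
      have h3 : ((2 : ℝ) ^ (3 * b) - k) / √((2 : ℝ) ^ (3 * b) - k) = √((2 : ℝ) ^ (3 * b) - k) :=
        Real.div_sqrt
      rw [h2]
      calc ((2 : ℝ) ^ (3 * b) - k) * (Real.cos φ / √((2 : ℝ) ^ (3 * b) - k)) =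
          Real.cos φ * (((2 : ℝ) ^ (3 * b) - k) / √((2 : ℝ) ^ (3 * b) - k)) := by ring
        _ = _ := by rw [h3]
    have e3 : ((k : ℝ) * (-(Real.sin φ / √k)) +
        ((2 : ℝ) ^ (3 * b) - k) * (Real.cos φ / √((2 : ℝ) ^ (3 * b) - k))) =
        √((2 : ℝ) ^ (3 * b)) * Real.cos (φ + θ) := by
      rw [e1, e2, Real.cos_add]; ring
    rw [← e3]
    push_cast
    rfl
  funext y
  rw [groverMatrix_mulVec, hsum]
  simp only [planeVec, ← hkdef]
  have hcoef : (2 : ℂ) / 2 ^ (3 * b) * ((√((2 : ℝ) ^ (3 * b)) * Real.cos (φ + θ) : ℝ) : ℂ) =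
      ((2 * Real.cos (φ + θ) / √((2 : ℝ) ^ (3 * b)) : ℝ) : ℂ) := by
    have : (2 : ℝ) / 2 ^ (3 * b) * (√((2 : ℝ) ^ (3 * b)) * Real.cos (φ + θ)) =
        2 * Real.cos (φ + θ) / √((2 : ℝ) ^ (3 * b)) := by
      rw [div_mul_eq_mul_div, div_eq_div_iff (by positivity) hN.ne']
      linear_combination (2 * Real.cos (φ + θ)) * hN2
    rw [← this]; push_cast; rfl
  rw [hcoef]
  split_ifs with hy
  · have hkpos : 0 < √(k : ℝ) := Real.sqrt_pos.2 (by
      have : 0 < k := Finset.card_pos.2 ⟨y, by simpa using hy⟩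
      exact_mod_cast this)
    have h1 : 1 / √((2 : ℝ) ^ (3 * b)) = Real.sin θ / √k := by rw [hs]; field_simp
    rw [neg_one_mul, sub_neg_eq_add, ← Complex.ofReal_add]
    congr 1
    have h2 : 2 * Real.cos (φ + θ) * Real.sin θ = Real.sin (φ + 2 * θ) - Real.sin φ := by
      rw [show φ + 2 * θ = φ + θ + θ by ring, Real.sin_add (φ + θ) θ,
        show Real.sin φ = Real.sin (φ + θ - θ) by ring_nf, Real.sin_sub]
      ring
    calc 2 * Real.cos (φ + θ) / √((2 : ℝ) ^ (3 * b)) + Real.sin φ / √k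
        = 2 * Real.cos (φ + θ) * (1 / √((2 : ℝ) ^ (3 * b))) + Real.sin φ / √k := by ring
      _ = (2 * Real.cos (φ + θ) * Real.sin θ + Real.sin φ) / √k := by rw [h1]; ring
      _ = _ := by rw [h2]; ring
  · have hkpos : 0 < √((2 : ℝ) ^ (3 * b) - k) := Real.sqrt_pos.2 (by
      have : k < 2 ^ (3 * b) := by
        rw [hkdef, countMarked, ← card_idx b]
        exact Finset.card_lt_univ_of_notMem (x := y) (by simpa using hy)
      have : (k : ℝ) < (2 : ℝ) ^ (3 * b) := by exact_mod_cast this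
      linarith)
    have h1 : 1 / √((2 : ℝ) ^ (3 * b)) = Real.cos θ / √((2 : ℝ) ^ (3 * b) - k) := by
      rw [hc]; field_simp
    rw [one_mul, ← Complex.ofReal_sub]
    congr 1
    have h2 : 2 * Real.cos (φ + θ) * Real.cos θ = Real.cos (φ + 2 * θ) + Real.cos φ := by
      rw [show φ + 2 * θ = φ + θ + θ by ring, Real.cos_add (φ + θ) θ,
        show Real.cos φ = Real.cos (φ + θ - θ) by ring_nf, Real.cos_sub]
      ring
    calc 2 * Real.cos (φ + θ) / √((2 : ℝ) ^ (3 * b)) - Real.cos φ / √((2 : ℝ) ^ (3 * b) - k)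
        = 2 * Real.cos (φ + θ) * (1 / √((2 : ℝ) ^ (3 * b))) -
          Real.cos φ / √((2 : ℝ) ^ (3 * b) - k) := by ring
      _ = (2 * Real.cos (φ + θ) * Real.cos θ - Real.cos φ) / √((2 : ℝ) ^ (3 * b) - k) := by
        rw [h1]; ring
      _ = _ := by rw [h2]; ring

theorem walsh_single {b : ℕ} (mark : Idx b → Bool) :
    walshMatrix b *ᵥ Pi.single (fun _ => false) 1 =
      planeVec mark (Real.sin (groverAngle b (countMarked mark)))
        (Real.cos (groverAngle b (countMarked mark))) := by
  have hk := countMarked_le mark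
  have hpow : ((Real.sqrt 2 : ℝ) : ℂ) ^ (3 * b) = ((√((2 : ℝ) ^ (3 * b)) : ℝ) : ℂ) := by
    rw [← Complex.ofReal_pow]
    congr 1
    rw [eq_comm, Real.sqrt_eq_iff_mul_self_eq (by positivity) (by positivity), ← mul_pow,
      Real.mul_self_sqrt (by norm_num)]
  have hN : 0 < √((2 : ℝ) ^ (3 * b)) := Real.sqrt_pos.2 (by positivity)
  funext y
  rw [Matrix.mulVec_single_one, Matrix.col_apply, walshMatrix_zero_right, hpow,
    sin_groverAngle hk, cos_groverAngle hk]
  simp only [planeVec]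
  split_ifs with hy
  · have hkpos : 0 < √(countMarked mark : ℝ) := Real.sqrt_pos.2 (by
      have : 0 < countMarked mark := Finset.card_pos.2 ⟨y, by simpa using hy⟩
      exact_mod_cast this)
    rw [← Complex.ofReal_one, ← Complex.ofReal_div]
    congr 1
    field_simp
  · have hkpos : 0 < √((2 : ℝ) ^ (3 * b) - countMarked mark) := Real.sqrt_pos.2 (by
      have : countMarked mark < 2 ^ (3 * b) := by
        rw [countMarked, ← card_idx b]
        exact Finset.card_lt_univ_of_notMem (x := y) (by simpa using hy)
      have : (countMarked mark : ℝ) < (2 : ℝ) ^ (3 * b) := by exact_mod_cast this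
      linarith)
    rw [← Complex.ofReal_one, ← Complex.ofReal_div]
    congr 1
    field_simp

theorem iterate_grover_planeVec {b : ℕ} (mark : Idx b → Bool) (m : ℕ) (φ : ℝ) :
    (fun v => groverMatrix mark *ᵥ v)^[m] (planeVec mark (Real.sin φ) (Real.cos φ)) =
      planeVec mark (Real.sin (φ + 2 * m * groverAngle b (countMarked mark)))
        (Real.cos (φ + 2 * m * groverAngle b (countMarked mark))) := by
  induction m generalizing φ with
  | zero => simp
  | succ m ih =>
    rw [Function.iterate_succ_apply, grover_planeVec, ih]
    congr 2 <;> (push_cast; ring)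

/-- Weighted probabilities of the basis states in a vector of the plane. -/
theorem sum_norm_planeVec {b : ℕ} (mark : Idx b → Bool) {s c : ℝ}
    (hs : countMarked mark = 0 → s = 0) (hc : countMarked mark = 2 ^ (3 * b) → c = 0) :
    ∑ y, ‖planeVec mark s c y‖ ^ 2 = s ^ 2 + c ^ 2 := by
  have hk := countMarked_le mark
  set k := countMarked mark with hkdef
  have hkr : (k : ℝ) ≤ (2 : ℝ) ^ (3 * b) := by exact_mod_cast hk
  have e : ∀ y, ‖planeVec mark s c y‖ ^ 2 =
      if mark y then s ^ 2 / k else c ^ 2 / ((2 : ℝ) ^ (3 * b) - k) := by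
    intro y
    simp only [planeVec, ← hkdef]
    split_ifs
    · rw [Complex.norm_real, Real.norm_eq_abs, sq_abs, div_pow, Real.sq_sqrt (by positivity)]
    · rw [Complex.norm_real, Real.norm_eq_abs, sq_abs, div_pow, Real.sq_sqrt (by linarith)]
  have h := sum_mark mark ((s ^ 2 / k : ℝ) : ℂ) ((c ^ 2 / ((2 : ℝ) ^ (3 * b) - k) : ℝ) : ℂ)
  have h' : ∑ y, ‖planeVec mark s c y‖ ^ 2 =
      k * (s ^ 2 / k) + ((2 : ℝ) ^ (3 * b) - k) * (c ^ 2 / ((2 : ℝ) ^ (3 * b) - k)) := by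
    simp_rw [e]
    rw [← hkdef] at h
    apply Complex.ofReal_injective
    push_cast at h ⊢
    rw [← h]
    exact Finset.sum_congr rfl fun y _ => by split_ifs <;> simp
  rw [h']
  -- For an empty class the quotient is `0` by convention, and `hs` and `hc` ensure that its
  -- coordinate vanishes too.
  congr 1
  · by_cases h0 : k = 0
    · rw [hs h0, h0]; simp
    · have : (k : ℝ) ≠ 0 := by exact_mod_cast h0
      field_simp
  · by_cases h0 : k = 2 ^ (3 * b)
    · rw [hc h0, h0]; simp
    · have : (2 : ℝ) ^ (3 * b) - k ≠ 0 := by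
        intro h1
        apply h0
        have : (k : ℝ) = (2 : ℝ) ^ (3 * b) := by linarith
        exact_mod_cast this
      field_simp

theorem groverAngle_zero (b : ℕ) : groverAngle b 0 = 0 := by simp [groverAngle]

theorem groverAngle_full (b : ℕ) : groverAngle b (2 ^ (3 * b)) = Real.pi / 2 := by
  simp [groverAngle]

/-- If all states are marked, then `θ = π / 2`, and the coordinate of the empty unmarked class has
to vanish for the probabilities to sum to one. -/
theorem cos_odd_mul_pi_div_two (m : ℕ) : Real.cos (Real.pi / 2 + 2 * m * (Real.pi / 2)) = 0 := by
  rw [show Real.pi / 2 + 2 * m * (Real.pi / 2) = m * Real.pi + Real.pi / 2 by ring,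
    Real.cos_add_pi_div_two, Real.sin_nat_mul_pi, neg_zero]

/-! ## Circuits -/

/-- The qubits outside `w` are treated as parameters: `F x` is the state of the selected qubits for
the values that `x` gives to the others, and `hF` says that it does not depend on the selected ones.
-/
theorem applyOn_comp {ι : Type} [Fintype ι] [DecidableEq ι] {q : ℕ} (w : ι ↪ Fin q)
    (M : Matrix (ι → Bool) (ι → Bool) ℂ) (F : (Fin q → Bool) → (ι → Bool) → ℂ)
    (hF : ∀ x y, F (Function.extend w y x) = F x) :
    applyOn w M (fun x => F x (x ∘ w)) = fun x => (M *ᵥ F x) (x ∘ w) := by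
  funext x
  simp only [applyOn, Matrix.mulVec, dotProduct]
  refine Finset.sum_congr rfl fun y _ => ?_
  rw [hF, Function.extend_comp w.injective]
  rfl

theorem foldl_replicate_apply {b q : ℕ} (mark : Idx b → Bool)
    (ψ : (Fin q → Bool) → ℂ) (m : ℕ) (g : Gate b q) :
    (List.replicate m g).foldl (fun ψ g => g.apply mark ψ) ψ = (g.apply mark)^[m] ψ := by
  induction m generalizing ψ with
  | zero => rfl
  | succ m ih => rw [List.replicate_succ, List.foldl_cons, ih, Function.iterate_succ_apply]

/-- The state of the index register as a basis state of all its qubits. -/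
def idxEquiv (b : ℕ) : (Fin (3 * b) → Bool) ≃ Idx b :=
  Equiv.arrowCongr finProdFinEquiv.symm (Equiv.refl Bool)

theorem idxEquiv_apply {b : ℕ} (z : Fin (3 * b) → Bool) : idxEquiv b z = z ∘ allWires b := rfl

theorem single_comp_equiv {b : ℕ} (z : Fin (3 * b) → Bool) :
    (Pi.single (fun _ => false) 1 : (Fin (3 * b) → Bool) → ℂ) z =
      (Pi.single (fun _ => false) 1 : Idx b → ℂ) (z ∘ allWires b) := by
  have h : (z = fun _ => false) ↔ (z ∘ allWires b = fun _ => false) := by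
    rw [← idxEquiv_apply, ← (idxEquiv b).injective.eq_iff (a := z)]
    rfl
  simp only [Pi.single_apply, h]

theorem finalState_groverCircuit {b : ℕ} (mark : Idx b → Bool) (m : ℕ) :
    finalState mark (groverCircuit b m) = fun z =>
      planeVec mark (Real.sin ((2 * m + 1) * groverAngle b (countMarked mark)))
        (Real.cos ((2 * m + 1) * groverAngle b (countMarked mark))) (z ∘ allWires b) := by
  have h0 : ∀ (M : Matrix (Idx b) (Idx b) ℂ) (φ : Idx b → ℂ),
      applyOn (allWires b) M (fun z => φ (z ∘ allWires b)) = fun z => (M *ᵥ φ) (z ∘ allWires b) :=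
    fun M φ => applyOn_comp (allWires b) M (fun _ => φ) fun _ _ => rfl
  have h1 : ∀ (m : ℕ) (φ : Idx b → ℂ), (Gate.apply mark (Gate.grover (allWires b)))^[m]
      (fun z => φ (z ∘ allWires b)) =
      fun z => ((fun v => groverMatrix mark *ᵥ v)^[m] φ) (z ∘ allWires b) := by
    intro m
    induction m with
    | zero => intro φ; rfl
    | succ m ih =>
      intro φ
      rw [Function.iterate_succ_apply, Gate.apply, h0, ih, Function.iterate_succ_apply]
  rw [finalState, groverCircuit, List.foldl_cons, foldl_replicate_apply mark]
  rw [show (Pi.single (fun _ => false) 1 : (Fin (3 * b) → Bool) → ℂ) = fun z =>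
    (Pi.single (fun _ => false) 1 : Idx b → ℂ) (z ∘ allWires b) from funext single_comp_equiv,
    Gate.apply, h0, walsh_single mark, h1, iterate_grover_planeVec]
  funext z
  congr 2 <;> ring

theorem sum_norm_groverCircuit {b : ℕ} (mark : Idx b → Bool) (m : ℕ) (V : Idx b → ℝ) :
    ∑ z, ‖finalState mark (groverCircuit b m) z‖ ^ 2 * V (fun i => z (allWires b i)) =
      ∑ y, ‖planeVec mark (Real.sin ((2 * m + 1) * groverAngle b (countMarked mark)))
        (Real.cos ((2 * m + 1) * groverAngle b (countMarked mark))) y‖ ^ 2 * V y := by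
  rw [finalState_groverCircuit]
  exact Fintype.sum_equiv (idxEquiv b) _ _ fun z => rfl

theorem sum_norm_planeVec_angle {b : ℕ} (mark : Idx b → Bool) (m : ℕ) :
    ∑ y, ‖planeVec mark (Real.sin ((2 * m + 1) * groverAngle b (countMarked mark)))
        (Real.cos ((2 * m + 1) * groverAngle b (countMarked mark))) y‖ ^ 2 = 1 := by
  rw [sum_norm_planeVec, Real.sin_sq_add_cos_sq]
  · intro h; simp [h, groverAngle_zero]
  · intro h
    rw [h, groverAngle_full, ← cos_odd_mul_pi_div_two m]
    congr 1; ring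

/-! ### The Hadamard test -/

/-- The Hadamard gate. -/
noncomputable def hadamardMatrix : Matrix (Fin 1 → Bool) (Fin 1 → Bool) ℂ := fun x y =>
  (if x 0 = true ∧ y 0 = true then -1 else 1) / (Real.sqrt 2 : ℂ)

theorem sum_fin_one_bool (f : (Fin 1 → Bool) → ℂ) :
    ∑ y, f y = f (fun _ => true) + f (fun _ => false) := by
  rw [← Fintype.sum_bool fun c => f fun _ => c]
  exact (Fintype.sum_equiv (Equiv.funUnique (Fin 1) Bool).symm _ _ fun c => rfl).symm

theorem hadamardMatrix_mem : hadamardMatrix ∈ Matrix.unitaryGroup (Fin 1 → Bool) ℂ := by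
  rw [Matrix.mem_unitaryGroup_iff]
  have h2 : ((Real.sqrt 2 : ℝ) : ℂ) * ((Real.sqrt 2 : ℝ) : ℂ) = 2 := by
    simpa using sqrt_two_pow_mul_self 1
  ext x z
  have hx : x = z ↔ x 0 = z 0 := by
    rw [funext_iff, Fin.forall_fin_one]
  rw [Matrix.mul_apply, sum_fin_one_bool, Matrix.one_apply]
  simp only [Matrix.star_apply, hadamardMatrix, hx]
  have h3 : (((Real.sqrt 2 : ℝ) : ℂ))⁻¹ * (((Real.sqrt 2 : ℝ) : ℂ))⁻¹ = 1 / 2 := by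
    rw [← mul_inv, h2, one_div]
  cases x 0 <;> cases z 0 <;> simp [div_eq_mul_inv, h3] <;> norm_num

/-- The control qubit of the Hadamard test. -/
def controlWire (b : ℕ) : Fin 1 ↪ Fin (3 * b + 1) := ⟨fun _ => Fin.last _, fun _ _ _ => by
  exact Subsingleton.elim _ _⟩

/-- The index register of the Hadamard test. -/
def testWires (b : ℕ) : IdxWires b (3 * b + 1) := (allWires b).trans Fin.castSuccEmb

theorem last_notMem_range_testWires (b : ℕ) : Fin.last (3 * b) ∉ Set.range (testWires b) := by
  rintro ⟨i, hi⟩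
  exact (Fin.castSucc_lt_last (allWires b i)).ne hi

/-- The Hadamard test for `G ^ m` on the uniform superposition. -/
noncomputable def hadamardTest (b m : ℕ) : List (Gate b (3 * b + 1)) :=
  Gate.small 1 (by norm_num) ⟨hadamardMatrix, hadamardMatrix_mem⟩ (controlWire b) ::
    Gate.walsh (testWires b) ::
    (List.replicate m (Gate.cgrover (Fin.last _) (testWires b) (last_notMem_range_testWires b)) ++
      [Gate.small 1 (by norm_num) ⟨hadamardMatrix, hadamardMatrix_mem⟩ (controlWire b)])

/-- The control qubit and the index register as all the qubits of the Hadamard test. -/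
def testEquiv (b : ℕ) : (Fin (3 * b + 1) → Bool) ≃ Bool × Idx b :=
  (Fin.snocEquiv fun _ : Fin (3 * b + 1) => Bool).symm.trans
    (Equiv.prodCongr (Equiv.refl Bool) (idxEquiv b))

theorem testEquiv_apply {b : ℕ} (x : Fin (3 * b + 1) → Bool) :
    testEquiv b x = (x (Fin.last _), x ∘ testWires b) := by
  simp only [testEquiv, Equiv.trans_apply, Equiv.prodCongr_apply, Fin.snocEquiv_symm_apply,
    Prod.map_apply, Equiv.refl_apply]
  rfl

/-- The state of the Hadamard test with the given components for the values of the control qubit. -/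
def testState {b : ℕ} (Φ : Bool → Idx b → ℂ) : (Fin (3 * b + 1) → Bool) → ℂ := fun x =>
  Φ (x (Fin.last _)) (x ∘ testWires b)

theorem small_apply_test {b : ℕ} (mark : Idx b → Bool) (hm : 1 ≤ 2) (Φ : Bool → Idx b → ℂ) :
    Gate.apply mark (Gate.small 1 hm ⟨hadamardMatrix, hadamardMatrix_mem⟩ (controlWire b))
      (testState Φ) =
    testState fun c => (1 / (Real.sqrt 2 : ℂ)) • (Φ false + (if c then -1 else 1 : ℂ) • Φ true) := by
  have h := applyOn_comp (controlWire b) hadamardMatrix (fun x c => Φ (c 0) (x ∘ testWires b)) (by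
    intro x y
    funext c
    congr 1
    funext i
    refine Function.extend_apply' _ _ _ ?_
    rintro ⟨j, hj⟩
    exact last_notMem_range_testWires b ⟨i, hj.symm⟩)
  refine h.trans ?_
  funext x
  have hx : (x ∘ controlWire b) 0 = x (Fin.last _) := rfl
  simp only [Matrix.mulVec, dotProduct]
  rw [sum_fin_one_bool]
  simp only [hadamardMatrix, hx, and_true, testState, Pi.smul_apply, Pi.add_apply, smul_eq_mul]
  cases x (Fin.last _) <;> simp <;> ring

theorem applyOn_testWires {b : ℕ} (M : Matrix (Idx b) (Idx b) ℂ) (Φ : Bool → Idx b → ℂ) :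
    applyOn (testWires b) M (testState Φ) = testState fun c => M *ᵥ Φ c :=
  applyOn_comp (testWires b) M (fun x => Φ (x (Fin.last _))) fun x y => by
    rw [Function.extend_apply']
    exact last_notMem_range_testWires b

theorem walsh_apply_test {b : ℕ} (mark : Idx b → Bool) (Φ : Bool → Idx b → ℂ) :
    Gate.apply mark (Gate.walsh (testWires b)) (testState Φ) =
      testState fun c => walshMatrix b *ᵥ Φ c :=
  applyOn_testWires _ _

theorem cgrover_iterate_test {b : ℕ} (mark : Idx b → Bool) (m : ℕ) (Φ : Bool → Idx b → ℂ) :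
    (Gate.apply mark (Gate.cgrover (Fin.last _) (testWires b) (last_notMem_range_testWires b)))^[m]
      (testState Φ) =
    testState fun c => if c then (fun v => groverMatrix mark *ᵥ v)^[m] (Φ true) else Φ false := by
  induction m generalizing Φ with
  | zero =>
    refine congrArg testState (funext fun c => ?_)
    cases c <;> rfl
  | succ m ih =>
    have h : Gate.apply mark
        (Gate.cgrover (Fin.last _) (testWires b) (last_notMem_range_testWires b)) (testState Φ) =
        testState fun c => if c then groverMatrix mark *ᵥ Φ true else Φ false := by
      funext x
      simp only [Gate.apply, applyOn_testWires]
      simp only [testState]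
      cases x (Fin.last _) <;> simp
    rw [Function.iterate_succ_apply, h, ih]
    congr 1

theorem single_test (b : ℕ) :
    (Pi.single (fun _ => false) 1 : (Fin (3 * b + 1) → Bool) → ℂ) =
      testState fun c => if c then 0 else Pi.single (fun _ => false) 1 := by
  funext x
  have h : (x = fun _ => false) ↔
      x (Fin.last _) = false ∧ (x ∘ testWires b = fun _ => false) := by
    rw [← (testEquiv b).injective.eq_iff, testEquiv_apply, testEquiv_apply, Prod.ext_iff]
    rfl
  simp only [Pi.single_apply, h, testState]
  cases x (Fin.last _) <;> simp [Pi.single_apply]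

theorem iterate_grover_smul {b : ℕ} (mark : Idx b → Bool) (m : ℕ) (r : ℂ) (v : Idx b → ℂ) :
    (fun v => groverMatrix mark *ᵥ v)^[m] (r • v) =
      r • (fun v => groverMatrix mark *ᵥ v)^[m] v := by
  induction m generalizing v with
  | zero => rfl
  | succ m ih =>
    rw [Function.iterate_succ_apply, Function.iterate_succ_apply, Matrix.mulVec_smul, ih]

theorem planeVec_combination {b : ℕ} (mark : Idx b → Bool) (r u s c s' c' : ℝ) :
    (r : ℂ) • (planeVec mark s c + (u : ℂ) • planeVec mark s' c') =
      planeVec mark (r * (s + u * s')) (r * (c + u * c')) := by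
  funext y
  simp only [Pi.smul_apply, Pi.add_apply, smul_eq_mul, planeVec]
  split_ifs <;> push_cast <;> ring

/-- With `v` the uniform superposition, the two values of the control qubit carry `(v ± G ^ m v) /
2`. Here `v` and `G ^ m v` lie in the plane at the angles `θ` and `(2 m + 1) θ`. -/
theorem finalState_hadamardTest {b : ℕ} (mark : Idx b → Bool) (m : ℕ) :
    finalState mark (hadamardTest b m) = testState fun c => planeVec mark
        ((1 / 2) * (Real.sin (groverAngle b (countMarked mark)) + (if c then -1 else 1) *
          Real.sin ((2 * m + 1) * groverAngle b (countMarked mark))))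
        ((1 / 2) * (Real.cos (groverAngle b (countMarked mark)) + (if c then -1 else 1) *
          Real.cos ((2 * m + 1) * groverAngle b (countMarked mark)))) := by
  have h2 : (1 / ((Real.sqrt 2 : ℝ) : ℂ)) * (1 / ((Real.sqrt 2 : ℝ) : ℂ)) = ((1 / 2 : ℝ) : ℂ) := by
    rw [div_mul_div_comm, show ((Real.sqrt 2 : ℝ) : ℂ) * ((Real.sqrt 2 : ℝ) : ℂ) = 2 by
      simpa using sqrt_two_pow_mul_self 1]
    norm_num
  rw [hadamardTest, finalState, List.foldl_cons, List.foldl_cons, List.foldl_append,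
    foldl_replicate_apply mark, List.foldl_cons, List.foldl_nil, single_test, small_apply_test]
  rw [walsh_apply_test, cgrover_iterate_test, small_apply_test]
  refine congrArg testState (funext fun c => ?_)
  simp only [if_true, Bool.false_eq_true, if_false, smul_zero, add_zero, Matrix.mulVec_smul,
    walsh_single mark, iterate_grover_smul, iterate_grover_planeVec]
  rw [smul_comm _ (1 / ((Real.sqrt 2 : ℝ) : ℂ)), ← smul_add, smul_smul, h2,
    show (if c = true then -1 else 1 : ℂ) = ((if c = true then -1 else 1 : ℝ) : ℂ) by
      split_ifs <;> simp, planeVec_combination]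
  congr 5 <;> ring

/-- The control qubit of the Hadamard test is `1` with probability `sin² (m θ)`. -/
theorem sum_norm_hadamardTest {b : ℕ} (mark : Idx b → Bool) (m : ℕ) (V : Bool → ℝ) :
    ∑ x, ‖finalState mark (hadamardTest b m) x‖ ^ 2 * V (x (Fin.last _)) =
      (1 + Real.cos (2 * m * groverAngle b (countMarked mark))) / 2 * V false +
      (1 - Real.cos (2 * m * groverAngle b (countMarked mark))) / 2 * V true := by
  rw [finalState_hadamardTest]
  set θ := groverAngle b (countMarked mark) with hθ
  have h : ∀ c : Bool, ∑ y, ‖planeVec mark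
        ((1 / 2) * (Real.sin θ + (if c then -1 else 1) * Real.sin ((2 * m + 1) * θ)))
        ((1 / 2) * (Real.cos θ + (if c then -1 else 1) * Real.cos ((2 * m + 1) * θ))) y‖ ^ 2 =
      (1 + (if c then -1 else 1) * Real.cos (2 * m * θ)) / 2 := by
    intro c
    rw [sum_norm_planeVec]
    -- The squared norm of `(v ± G ^ m v) / 2` is `(1 ± cos (2 m θ)) / 2`, as the two unit vectors
    -- enclose the angle `2 m θ`.
    · have e : Real.cos (2 * m * θ) = Real.cos ((2 * m + 1) * θ) * Real.cos θ +
          Real.sin ((2 * m + 1) * θ) * Real.sin θ := by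
        rw [← Real.cos_sub]; congr 1; ring
      have h1 := Real.sin_sq_add_cos_sq θ
      have h2 := Real.sin_sq_add_cos_sq ((2 * m + 1) * θ)
      rw [e]
      split_ifs <;> linear_combination (1 / 4) * h1 + (1 / 4) * h2
    · intro h
      simp [hθ, h, groverAngle_zero]
    · intro h
      have e1 : Real.cos θ = 0 := by rw [hθ, h, groverAngle_full, Real.cos_pi_div_two]
      have e2 : Real.cos ((2 * m + 1) * θ) = 0 := by
        rw [hθ, h, groverAngle_full, ← cos_odd_mul_pi_div_two m]
        congr 1; ring
      rw [e1, e2]; simp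
  refine (Fintype.sum_equiv (testEquiv b) _ (fun cy : Bool × Idx b => ‖planeVec mark
        ((1 / 2) * (Real.sin θ + (if cy.1 then -1 else 1) * Real.sin ((2 * m + 1) * θ)))
        ((1 / 2) * (Real.cos θ + (if cy.1 then -1 else 1) * Real.cos ((2 * m + 1) * θ))) cy.2‖ ^ 2 *
        V cy.1) fun x => by rw [testEquiv_apply]; rfl).trans ?_
  rw [Fintype.sum_prod_type, Fintype.sum_bool]
  refine (congrArg₂ (· + ·) ((Finset.sum_mul _ _ _).symm.trans (congrArg (· * V true) (h true)))
    ((Finset.sum_mul _ _ _).symm.trans (congrArg (· * V false) (h false)))).trans ?_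
  simp only [if_true, Bool.false_eq_true, if_false]
  ring

/-! ## Powers of the Grover operator that separate angles -/

-- Start with `m = 1`, where the scaled interval lies in `[0, π]`, and enlarge `m` as long as the
-- scaled interval is shorter than `π / 6`. If it lies on one side of the midpoint of its
-- half-period, doubling keeps it in one half-period; otherwise tripling does. As `m` grows without
-- bound, the scaled length cannot stay below `π / 6`.
open Real in
theorem exists_power_separating {lo hi : ℝ} (h0 : 0 ≤ lo) (hlt : lo < hi) (hhi : hi ≤ π / 2) :
    ∃ p : ℕ × ℕ, p.2 * π ≤ 2 * p.1 * lo ∧ 2 * p.1 * hi ≤ (p.2 + 1) * π ∧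
      π / 6 ≤ 2 * p.1 * (hi - lo) := by
  by_contra hcon
  push Not at hcon
  have hpi := Real.pi_pos
  have key : ∀ n : ℕ, ∃ m j : ℕ, n + 1 ≤ m ∧ (j : ℝ) * π ≤ 2 * m * lo ∧
      2 * m * hi ≤ ((j : ℝ) + 1) * π := by
    intro n
    induction n with
    | zero => exact ⟨1, 0, le_refl _, by push_cast; linarith, by push_cast; linarith⟩
    | succ n ih =>
      obtain ⟨m, j, hm, h1, h2⟩ := ih
      have h3 := hcon (m, j) h1 h2
      dsimp only at h3
      rcases le_or_gt (2 * m * hi) (j * π + π / 2) with h | h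
      · exact ⟨2 * m, 2 * j, by omega, by push_cast; linarith, by push_cast; linarith⟩
      rcases le_or_gt (j * π + π / 2) (2 * m * lo) with h' | h'
      · exact ⟨2 * m, 2 * j + 1, by omega, by push_cast; linarith, by push_cast; linarith⟩
      -- The midpoint lies inside, so all points are within `π / 6` of it. Tripling moves it to the
      -- midpoint of the half-period with index `3 j + 1` and the points to within `π / 2` of that.
      · exact ⟨3 * m, 3 * j + 1, by omega, by push_cast; linarith, by push_cast; linarith⟩
  obtain ⟨n, hn⟩ := exists_nat_gt (π / (hi - lo))
  obtain ⟨m, j, hm, h1, h2⟩ := key n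
  have h3 := hcon (m, j) h1 h2
  dsimp only at h3
  rw [div_lt_iff₀ (by linarith)] at hn
  have h4 : (n : ℝ) * (hi - lo) ≤ m * (hi - lo) := by
    refine mul_le_mul_of_nonneg_right ?_ (by linarith)
    exact_mod_cast (Nat.le_succ n).trans hm
  linarith

/-- The difference is `2 sin ((y + x) / 2) sin ((y - x) / 2)`, and both half angles lie between `π /
36` and `π - π / 36`. The distance `π / 18` is that of the middle third of an interval of length `π
/ 6`. -/
theorem cos_sub_cos_ge {x y : ℝ} (hx : 0 ≤ x) (hy : y ≤ Real.pi) (hxy : Real.pi / 18 ≤ y - x) :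
    2 * Real.sin (Real.pi / 36) ^ 2 ≤ Real.cos x - Real.cos y := by
  have hpi := Real.pi_pos
  have h1 : Real.sin (Real.pi / 36) ≤ Real.sin ((y - x) / 2) :=
    Real.sin_le_sin_of_le_of_le_pi_div_two (by linarith) (by linarith) (by linarith)
  have h2 : Real.sin (Real.pi / 36) ≤ Real.sin ((y + x) / 2) := by
    rcases le_total ((y + x) / 2) (Real.pi / 2) with h | h
    · exact Real.sin_le_sin_of_le_of_le_pi_div_two (by linarith) h (by linarith)
    · rw [← Real.sin_pi_sub ((y + x) / 2)]
      exact Real.sin_le_sin_of_le_of_le_pi_div_two (by linarith) (by linarith) (by linarith)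
  have h0 : 0 ≤ Real.sin (Real.pi / 36) := Real.sin_nonneg_of_nonneg_of_le_pi (by linarith)
    (by linarith)
  have e : Real.cos x - Real.cos y = 2 * (Real.sin ((y + x) / 2) * Real.sin ((y - x) / 2)) := by
    rw [Real.cos_sub_cos, show (x - y) / 2 = -((y - x) / 2) by ring, Real.sin_neg, add_comm x y]
    ring
  rw [e, sq]
  have := mul_le_mul h2 h1 h0 (h0.trans h2)
  linarith

/-- The distinguishing gap of the Hadamard tests. -/
noncomputable def testGap : ℝ := Real.sin (Real.pi / 36) ^ 2

theorem testGap_pos : 0 < testGap := by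
  have : 0 < Real.sin (Real.pi / 36) := Real.sin_pos_of_pos_of_lt_pi (by positivity)
    (by linarith [Real.pi_pos])
  exact pow_pos this 2

theorem testGap_le_one : testGap ≤ 1 := Real.sin_sq_le_one _

/-! ## Angles of different counts -/

/-- With `x` and `y` the angles of `k` and `i`, `1 / N ≤ sin² x - sin² y = sin (x + y) sin (x - y) ≤
2 sin x (x - y)`, and `N sin x = √(N k)`. -/
theorem groverAngle_spacing {b i k : ℕ} (hik : i < k) (hk : k ≤ 2 ^ (3 * b)) :
    1 ≤ 2 * √((2 : ℝ) ^ (3 * b) * k) * (groverAngle b k - groverAngle b i) := by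
  have hi : i ≤ 2 ^ (3 * b) := hik.le.trans hk
  set N : ℝ := (2 : ℝ) ^ (3 * b) with hN
  have hNpos : 0 < N := by positivity
  have sk := sin_groverAngle hk
  have si := sin_groverAngle hi
  rw [← hN] at sk si
  set x := groverAngle b k
  set y := groverAngle b i
  have hkr : (i : ℝ) + 1 ≤ k := by exact_mod_cast hik
  have hkpos : (0 : ℝ) < k := by linarith [(Nat.cast_nonneg i : (0 : ℝ) ≤ i)]
  have hyx : y ≤ x := Real.monotone_arcsin (Real.sqrt_le_sqrt (by gcongr))
  have hsy : Real.sin y ≤ Real.sin x := by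
    rw [sk, si]; gcongr
  have hsy0 : 0 ≤ Real.sin y := by rw [si]; positivity
  have h1 : Real.sin x ^ 2 - Real.sin y ^ 2 = (k - i) / N := by
    rw [sk, si, div_pow, div_pow, Real.sq_sqrt hkpos.le, Real.sq_sqrt (Nat.cast_nonneg i),
      Real.sq_sqrt hNpos.le]
    ring
  have h2 : Real.sin x ^ 2 - Real.sin y ^ 2 = Real.sin (x + y) * Real.sin (x - y) := by
    rw [Real.sin_add, Real.sin_sub]
    have a := Real.sin_sq_add_cos_sq x
    have b := Real.sin_sq_add_cos_sq y
    linear_combination (Real.sin y ^ 2) * a - (Real.sin x ^ 2) * b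
  have h3 : Real.sin (x + y) ≤ 2 * Real.sin x := by
    rw [Real.sin_add]
    nlinarith [Real.cos_le_one x, Real.cos_le_one y]
  have h4 : Real.sin (x - y) ≤ x - y := Real.sin_le (by linarith)
  have hx := groverAngle_le b k
  have hy0 := groverAngle_nonneg b i
  have h5 : 0 ≤ Real.sin (x - y) :=
    Real.sin_nonneg_of_nonneg_of_le_pi (by linarith) (by linarith [Real.pi_pos])
  have h6 : 1 / N ≤ 2 * Real.sin x * (x - y) := by
    calc 1 / N ≤ (k - i) / N := by gcongr; linarith
      _ = Real.sin (x + y) * Real.sin (x - y) := by rw [← h1, h2]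
      _ ≤ 2 * Real.sin x * Real.sin (x - y) := mul_le_mul_of_nonneg_right h3 h5
      _ ≤ _ := mul_le_mul_of_nonneg_left h4 (by linarith)
  have h7 : N * Real.sin x = √(N * k) := by
    rw [sk, Real.sqrt_mul hNpos.le]
    have := Real.mul_self_sqrt hNpos.le
    have hs := Real.sqrt_pos.2 hNpos
    field_simp
    linarith
  rw [div_le_iff₀ hNpos] at h6
  rw [← h7]
  linarith

theorem groverAngle_mono (b : ℕ) {i k : ℕ} (h : i ≤ k) : groverAngle b i ≤ groverAngle b k :=
  Real.monotone_arcsin (Real.sqrt_le_sqrt (by gcongr))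

/-- A competitor `i` above `k` is at least as far away as `k + 1`, so the spacing depends on the
true count `k` only, however large `i` is. This also covers `k = 0`. -/
theorem groverAngle_spacing_abs {b i k : ℕ} (hik : i ≠ k) (hi : i ≤ 2 ^ (3 * b))
    (hk : k ≤ 2 ^ (3 * b)) :
    1 ≤ 2 * √((2 : ℝ) ^ (3 * b) * (k + 1)) * |groverAngle b k - groverAngle b i| := by
  rcases lt_or_gt_of_ne hik with h | h
  · refine (groverAngle_spacing h hk).trans ?_
    have hm := groverAngle_mono b h.le
    gcongr
    · linarith
    · exact le_abs_self _
  · have h1 := groverAngle_spacing (Nat.lt_succ_self k) ((Nat.succ_le_of_lt h).trans hi)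
    push_cast at h1
    refine h1.trans ?_
    have h2 := groverAngle_mono b (Nat.succ_le_of_lt h)
    gcongr
    rw [abs_sub_comm]
    exact (by linarith : _ ≤ groverAngle b i - groverAngle b k).trans (le_abs_self _)

/-- The uniform version, from `√(N k) ≤ N`. It shows when a single count must be left, and it bounds
the powers even after wrong decisions. -/
theorem groverAngle_spacing_min {b i k : ℕ} (hik : i ≠ k) (hi : i ≤ 2 ^ (3 * b))
    (hk : k ≤ 2 ^ (3 * b)) :
    1 ≤ 2 * (2 : ℝ) ^ (3 * b) * |groverAngle b k - groverAngle b i| := by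
  wlog h : i < k generalizing i k
  · rw [abs_sub_comm]
    exact this hik.symm hk hi (lt_of_le_of_ne (not_lt.1 h) hik.symm)
  refine (groverAngle_spacing h hk).trans ?_
  have hkr : (k : ℝ) ≤ (2 : ℝ) ^ (3 * b) := by exact_mod_cast hk
  have : √((2 : ℝ) ^ (3 * b) * k) ≤ (2 : ℝ) ^ (3 * b) :=
    Real.sqrt_le_iff.2 ⟨by positivity, by rw [sq]; gcongr⟩
  have hm := groverAngle_mono b h.le
  gcongr
  exact le_abs_self _

/-! ## Repeated Hadamard tests -/

/-- The sum of the outcomes (`1` for `false`, `-1` for `true`) of repeated Hadamard tests. -/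
noncomputable def hadamardSum (b m : ℕ) : ℕ → ℤ → Prog b ℤ
  | 0, s => .ret s
  | R + 1, s => .run (3 * b + 1) (hadamardTest b m) fun x =>
      .step 1 (hadamardSum b m R (s + if x (Fin.last _) then -1 else 1))

theorem hadamardTest_cost (b m g : ℕ) :
    ((hadamardTest b m).map (Gate.cost g)).sum = m * g + 3 * b + 2 := by
  simp [hadamardTest, Gate.cost]
  ring

theorem hadamardTest_calls (b m : ℕ) : ((hadamardTest b m).map Gate.calls).sum = m := by
  simp [hadamardTest, Gate.calls]

theorem hadamardSum_expect_succ {b : ℕ} (mark : Idx b → Bool) (g m R : ℕ) (s : ℤ)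
    (φ : ℤ → ℕ → ℕ → ℝ) :
    (hadamardSum b m (R + 1) s).expect mark g φ =
      (1 + Real.cos (2 * m * groverAngle b (countMarked mark))) / 2 *
        (hadamardSum b m R (s + 1)).expect mark g
          (fun a t l => φ a (m * g + 3 * b + 3 + t) (m + l)) +
      (1 - Real.cos (2 * m * groverAngle b (countMarked mark))) / 2 *
        (hadamardSum b m R (s - 1)).expect mark g
          (fun a t l => φ a (m * g + 3 * b + 3 + t) (m + l)) := by
  have h := sum_norm_hadamardTest mark m fun c =>
    (hadamardSum b m R (s + if c then -1 else 1)).expect mark g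
      (fun a t l => φ a (m * g + 3 * b + 3 + t) (m + l))
  simp only [if_true, Bool.false_eq_true, if_false, ← sub_eq_add_neg] at h
  rw [← h]
  simp only [hadamardSum, Prog.expect, hadamardTest_cost, hadamardTest_calls]
  refine Finset.sum_congr rfl fun x _ => ?_
  congr 2
  funext a t l
  congr 1
  ring

/-- Time and number of calls of repeated Hadamard tests do not depend on the outcomes. -/
theorem hadamardSum_expect_eq {b : ℕ} (mark : Idx b → Bool) (g m R : ℕ) (s : ℤ)
    (φ : ℤ → ℕ → ℕ → ℝ) :
    (hadamardSum b m R s).expect mark g φ =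
      (hadamardSum b m R s).expect mark g
        (fun a _ _ => φ a (R * (m * g + 3 * b + 3)) (R * m)) := by
  induction R generalizing s φ with
  | zero => simp [hadamardSum, Prog.expect]
  | succ R ih =>
    rw [hadamardSum_expect_succ, hadamardSum_expect_succ, ih (s + 1), ih (s - 1)]
    have e1 : m * g + 3 * b + 3 + R * (m * g + 3 * b + 3) = (R + 1) * (m * g + 3 * b + 3) := by
      ring
    have e2 : m + R * m = (R + 1) * m := by ring
    rw [e1, e2]

/-- The tests are independent, so the moment generating function of their sum is a power of that of
one sign. -/
theorem hadamardSum_expect_exp {b : ℕ} (mark : Idx b → Bool) (g m R : ℕ) (s : ℤ) (r : ℝ) :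
    (hadamardSum b m R s).expect mark g (fun a _ _ => Real.exp (r * a)) =
      Real.exp (r * s) *
        ((1 + Real.cos (2 * m * groverAngle b (countMarked mark))) / 2 * Real.exp r +
          (1 - Real.cos (2 * m * groverAngle b (countMarked mark))) / 2 * Real.exp (-r)) ^ R := by
  induction R generalizing s with
  | zero => simp [hadamardSum, Prog.expect]
  | succ R ih =>
    rw [hadamardSum_expect_succ, ih, ih, pow_succ]
    push_cast
    rw [show r * ((s : ℝ) + 1) = r * s + r by ring, show r * ((s : ℝ) - 1) = r * s + -r by ring,
      Real.exp_add, Real.exp_add]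
    ring

theorem hadamardSum_expect_const {b : ℕ} (mark : Idx b → Bool) (g m R : ℕ) (s : ℤ) (c : ℝ) :
    (hadamardSum b m R s).expect mark g (fun _ _ _ => c) = c := by
  -- At `r = 0` the moment generating function is the total probability.
  have h := hadamardSum_expect_exp mark g m R s 0
  simp only [zero_mul, Real.exp_zero, neg_zero, mul_one, one_mul] at h
  rw [show ∀ x : ℝ, (1 + x) / 2 + (1 - x) / 2 = 1 by intro x; ring, one_pow] at h
  have h2 := Prog.expect_smul mark g (hadamardSum b m R s) c (fun _ _ _ => 1)
  rw [h] at h2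
  simpa using h2

/-- After the factor `exp (r μ)` is taken out, the variable is centred. In `exp x ≤ 1 + x + x ^ 2`,
valid for `|x| ≤ 1`, the linear terms cancel and the variance is `1 - μ ^ 2 ≤ 1`. The bound on `r`
keeps `r (±1 - μ)` within `[-1, 1]`. -/
theorem exp_moment_le {μ r : ℝ} (hμ : |μ| ≤ 1) (hr : |r| ≤ 1 / 2) :
    (1 + μ) / 2 * Real.exp r + (1 - μ) / 2 * Real.exp (-r) ≤ Real.exp (r * μ + r ^ 2) := by
  obtain ⟨h1, h2⟩ := abs_le.1 hμ
  have key : ∀ c : ℝ, |c| ≤ 2 → Real.exp (r * c) ≤ 1 + r * c + (r * c) ^ 2 := by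
    intro c hc
    have : |r * c| ≤ 1 := by
      rw [abs_mul]
      calc |r| * |c| ≤ 1 / 2 * 2 := mul_le_mul hr hc (abs_nonneg _) (by norm_num)
        _ = 1 := by norm_num
    have := (abs_le.1 (Real.abs_exp_sub_one_sub_id_le this)).2
    linarith
  have k1 := key (1 - μ) (abs_le.2 ⟨by linarith, by linarith⟩)
  have k2 := key (-1 - μ) (abs_le.2 ⟨by linarith, by linarith⟩)
  have e1 : Real.exp r = Real.exp (r * μ) * Real.exp (r * (1 - μ)) := by
    rw [← Real.exp_add]; congr 1; ring
  have e2 : Real.exp (-r) = Real.exp (r * μ) * Real.exp (r * (-1 - μ)) := by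
    rw [← Real.exp_add]; congr 1; ring
  have h3 : (1 + μ) / 2 * Real.exp (r * (1 - μ)) + (1 - μ) / 2 * Real.exp (r * (-1 - μ)) ≤
      Real.exp (r ^ 2) := by
    have h4 := Real.add_one_le_exp (r ^ 2)
    have h5 := mul_le_mul_of_nonneg_left k1 (show 0 ≤ (1 + μ) / 2 by linarith)
    have h6 := mul_le_mul_of_nonneg_left k2 (show 0 ≤ (1 - μ) / 2 by linarith)
    nlinarith [sq_nonneg (r * μ)]
  rw [e1, e2, Real.exp_add]
  have := mul_le_mul_of_nonneg_left h3 (Real.exp_pos (r * μ)).le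
  linarith

/-- Large deviations of repeated Hadamard tests; `σ = 1` and `σ = -1` are the two directions. -/
theorem hadamardSum_tail {b : ℕ} (mark : Idx b → Bool) (g m R : ℕ) {σ γ : ℝ} (hσ : |σ| = 1)
    (hγ : 0 ≤ γ) (hγ1 : γ ≤ 1) (P : ℤ → Prop) [DecidablePred P]
    (hP : ∀ a, P a → R * (σ * Real.cos (2 * m * groverAngle b (countMarked mark)) + γ) ≤ σ * a) :
    (hadamardSum b m R 0).expect mark g (fun a _ _ => if P a then 1 else 0) ≤
      Real.exp (-(R * γ ^ 2 / 4)) := by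
  set μ := Real.cos (2 * m * groverAngle b (countMarked mark)) with hμ
  have hσ2 : σ ^ 2 = 1 := by rw [← sq_abs, hσ]; norm_num
  -- The Chernoff exponent per test is `r ^ 2 - |r| γ`, which is minimal, with value `-γ ^ 2 / 4`,
  -- at `|r| = γ / 2`.
  set r := γ / 2 * σ with hr
  have hrabs : |r| ≤ 1 / 2 := by
    rw [hr, abs_mul, hσ, mul_one, abs_of_nonneg (by linarith)]; linarith
  have hr2 : r ^ 2 = γ ^ 2 / 4 := by rw [hr, mul_pow, hσ2]; ring
  have h1 : ∀ a : ℤ, (if P a then (1 : ℝ) else 0) ≤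
      Real.exp (-(R * (r * μ + γ ^ 2 / 2))) * Real.exp (r * a) := by
    intro a
    split_ifs with h
    · rw [← Real.exp_add]
      refine Real.one_le_exp ?_
      have := mul_le_mul_of_nonneg_left (hP a h) (show 0 ≤ γ / 2 by linarith)
      rw [hr]
      linarith
    · positivity
  refine (Prog.expect_mono mark g _ fun a _ _ => h1 a).trans ?_
  rw [Prog.expect_smul, hadamardSum_expect_exp, ← hμ]
  have h2 := exp_moment_le (Real.abs_cos_le_one (2 * m * groverAngle b (countMarked mark))) hrabs
  rw [← hμ] at h2
  have h0 : 0 ≤ (1 + μ) / 2 * Real.exp r + (1 - μ) / 2 * Real.exp (-r) := by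
    have := abs_le.1 (Real.abs_cos_le_one (2 * m * groverAngle b (countMarked mark)))
    rw [← hμ] at this
    have a1 : 0 ≤ (1 + μ) / 2 := by linarith
    have a2 : 0 ≤ (1 - μ) / 2 := by linarith
    positivity
  have h3 := pow_le_pow_left₀ h0 h2 R
  rw [← Real.exp_nat_mul] at h3
  calc _ ≤ Real.exp (-(R * (r * μ + γ ^ 2 / 2))) * (Real.exp (r * (0 : ℤ)) *
        Real.exp (R * (r * μ + r ^ 2))) := by gcongr
    _ = Real.exp (-(R * γ ^ 2 / 4)) := by
      rw [← Real.exp_add, ← Real.exp_add, hr2]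
      congr 1
      push_cast
      ring

/-! ## The counting algorithm -/

open Classical in
/-- A number `m` of Grover iterations, together with a number `j` such that `cos (2 m ·)` is monotone
on the interval as it is on `[j π, (j + 1) π]`, and changes considerably. -/
noncomputable def testPower (lo hi : ℝ) : ℕ × ℕ :=
  if h : ∃ p : ℕ × ℕ, p.2 * Real.pi ≤ 2 * p.1 * lo ∧ 2 * p.1 * hi ≤ (p.2 + 1) * Real.pi ∧
      Real.pi / 6 ≤ 2 * p.1 * (hi - lo) then h.choose else (0, 0)

theorem testPower_spec {lo hi : ℝ} (h0 : 0 ≤ lo) (hlt : lo < hi) (hhi : hi ≤ Real.pi / 2) :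
    (testPower lo hi).2 * Real.pi ≤ 2 * (testPower lo hi).1 * lo ∧
      2 * (testPower lo hi).1 * hi ≤ ((testPower lo hi).2 + 1) * Real.pi ∧
      Real.pi / 6 ≤ 2 * (testPower lo hi).1 * (hi - lo) := by
  have h := exists_power_separating h0 hlt hhi
  rw [testPower, dif_pos h]
  exact h.choose_spec

/-- The scaled interval lies in one half-period, so the power is at most of the order of the inverse
width; the default value `0` satisfies this as well. -/
theorem testPower_le (lo hi : ℝ) : 2 * (testPower lo hi).1 * (hi - lo) ≤ Real.pi := by
  unfold testPower
  split_ifs with h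
  · have := h.choose_spec
    linarith [this.1, this.2.1]
  · simpa using Real.pi_pos.le

open Classical in
/-- The counts whose angles lie in an interval. -/
noncomputable def candidates (b : ℕ) (lo hi : ℝ) : Finset ℕ :=
  (Finset.range (2 ^ (3 * b) + 1)).filter fun k => lo ≤ groverAngle b k ∧ groverAngle b k ≤ hi

theorem mem_candidates {b : ℕ} {lo hi : ℝ} {k : ℕ} : k ∈ candidates b lo hi ↔
    k ≤ 2 ^ (3 * b) ∧ lo ≤ groverAngle b k ∧ groverAngle b k ≤ hi := by
  simp [candidates]

/-- The value of `(-1) ^ j * cos (2 m ·)` that separates the outer thirds of the interval. -/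
noncomputable def testLevel (lo hi : ℝ) : ℝ :=
  (-1) ^ (testPower lo hi).2 *
    ((Real.cos (2 * (testPower lo hi).1 * (lo + (hi - lo) / 3)) +
      Real.cos (2 * (testPower lo hi).1 * (hi - (hi - lo) / 3))) / 2)

open Classical in
/-- The remaining interval, for the sum `s` of `R` Hadamard tests. -/
noncomputable def narrow (R : ℕ) (lo hi : ℝ) (s : ℤ) : ℝ × ℝ :=
  if R * testLevel lo hi ≤ (-1) ^ (testPower lo hi).2 * s then (lo, hi - (hi - lo) / 3)
  else (lo + (hi - lo) / 3, hi)

open Classical in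
/-- Determine the number of marked basis states, given that its angle lies between `lo` and `hi`:
while several counts are possible, cut off an outer third of the interval with the help of `R`
Hadamard tests. -/
noncomputable def countLoop (b R : ℕ) : ℕ → ℝ → ℝ → Prog b ℕ
  | fuel, lo, hi =>
    if (candidates b lo hi).card ≤ 1 then .ret ((candidates b lo hi).sum id)
    else match fuel with
      | 0 => .ret 0
      | fuel + 1 => (hadamardSum b (testPower lo hi).1 R 0).bind fun s =>
          .step 1 (countLoop b R fuel (narrow R lo hi s).1 (narrow R lo hi s).2)

theorem countLoop_of_card_le {b R fuel : ℕ} {lo hi : ℝ} (h : (candidates b lo hi).card ≤ 1) :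
    countLoop b R fuel lo hi = .ret ((candidates b lo hi).sum id) := by
  cases fuel <;> rw [countLoop, if_pos h]

theorem countLoop_zero {b R : ℕ} {lo hi : ℝ} (h : ¬ (candidates b lo hi).card ≤ 1) :
    countLoop b R 0 lo hi = .ret 0 := by
  rw [countLoop, if_neg h]

theorem countLoop_succ {b R fuel : ℕ} {lo hi : ℝ} (h : ¬ (candidates b lo hi).card ≤ 1) :
    countLoop b R (fuel + 1) lo hi = (hadamardSum b (testPower lo hi).1 R 0).bind fun s =>
      .step 1 (countLoop b R fuel (narrow R lo hi s).1 (narrow R lo hi s).2) := by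
  rw [countLoop, if_neg h]

theorem countLoop_expect_succ {b R fuel : ℕ} {lo hi : ℝ} (h : ¬ (candidates b lo hi).card ≤ 1)
    (mark : Idx b → Bool) (g : ℕ) (φ : ℕ → ℕ → ℕ → ℝ) :
    (countLoop b R (fuel + 1) lo hi).expect mark g φ =
      (hadamardSum b (testPower lo hi).1 R 0).expect mark g fun s _ _ =>
        (countLoop b R fuel (narrow R lo hi s).1 (narrow R lo hi s).2).expect mark g
          fun a t l => φ a (R * ((testPower lo hi).1 * g + 3 * b + 3) + (1 + t))
            (R * (testPower lo hi).1 + l) := by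
  rw [countLoop_succ h, Prog.expect_bind, hadamardSum_expect_eq]
  rfl

theorem countLoop_expect_const {b R fuel : ℕ} {lo hi : ℝ} (mark : Idx b → Bool) (g : ℕ) (c : ℝ) :
    (countLoop b R fuel lo hi).expect mark g (fun _ _ _ => c) = c := by
  induction fuel generalizing lo hi with
  | zero =>
    by_cases h : (candidates b lo hi).card ≤ 1
    · rw [countLoop_of_card_le h]; rfl
    · rw [countLoop_zero h]; rfl
  | succ fuel ih =>
    by_cases h : (candidates b lo hi).card ≤ 1
    · rw [countLoop_of_card_le h]; rfl
    · rw [countLoop_expect_succ h]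
      simp only [ih, hadamardSum_expect_const]

/-- Two remaining counts force the width to be at least their angular distance. The bound does not
need the true count to have survived, so it holds in every branch of the loop. -/
theorem testPower_le_of_card {b : ℕ} {lo hi : ℝ} (h : ¬ (candidates b lo hi).card ≤ 1) :
    ((testPower lo hi).1 : ℝ) ≤ Real.pi * 2 ^ (3 * b) := by
  obtain ⟨i, hi', k, hk', hik⟩ := Finset.one_lt_card.1 (not_le.1 h)
  obtain ⟨hi1, hi2, hi3⟩ := mem_candidates.1 hi'
  obtain ⟨hk1, hk2, hk3⟩ := mem_candidates.1 hk'
  have h1 := groverAngle_spacing_min hik hi1 hk1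
  have h2 : |groverAngle b k - groverAngle b i| ≤ hi - lo := abs_le.2 ⟨by linarith, by linarith⟩
  have h3 : 1 ≤ 2 * (2 : ℝ) ^ (3 * b) * (hi - lo) := h1.trans (by gcongr)
  have h4 := testPower_le lo hi
  have h5 : ((testPower lo hi).1 : ℝ) * 1 ≤
      (testPower lo hi).1 * (2 * (2 : ℝ) ^ (3 * b) * (hi - lo)) := by gcongr
  have h6 := mul_le_mul_of_nonneg_left h4 (show (0 : ℝ) ≤ 2 ^ (3 * b) by positivity)
  linarith

/-- A remaining count has a competitor in the interval, and its distance to that competitor is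
controlled by `k` alone. For the true count this is the cost of a successful run. -/
theorem testPower_le_sqrt {b k : ℕ} {lo hi : ℝ} (h : ¬ (candidates b lo hi).card ≤ 1)
    (hk : k ∈ candidates b lo hi) :
    ((testPower lo hi).1 : ℝ) ≤ Real.pi * √((2 : ℝ) ^ (3 * b) * (k + 1)) := by
  obtain ⟨i, hi', hik⟩ := Finset.exists_mem_ne (not_le.1 h) k
  obtain ⟨hi1, hi2, hi3⟩ := mem_candidates.1 hi'
  obtain ⟨hk1, hk2, hk3⟩ := mem_candidates.1 hk
  have h1 := groverAngle_spacing_abs hik hi1 hk1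
  have h2 : |groverAngle b k - groverAngle b i| ≤ hi - lo := abs_le.2 ⟨by linarith, by linarith⟩
  have h3 : 1 ≤ 2 * √((2 : ℝ) ^ (3 * b) * (k + 1)) * (hi - lo) := h1.trans (by gcongr)
  have h4 := testPower_le lo hi
  have h5 : ((testPower lo hi).1 : ℝ) * 1 ≤
      (testPower lo hi).1 * (2 * √((2 : ℝ) ^ (3 * b) * (k + 1)) * (hi - lo)) := by gcongr
  have h6 := mul_le_mul_of_nonneg_left h4
    (show (0 : ℝ) ≤ √((2 : ℝ) ^ (3 * b) * (k + 1)) by positivity)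
  linarith

/-- Comparison of expectations that uses the bound on the number of calls. -/
theorem countLoop_expect_mono {b R fuel : ℕ} {lo hi : ℝ} (mark : Idx b → Bool) (g : ℕ)
    {φ ψ : ℕ → ℕ → ℕ → ℝ}
    (h : ∀ a t (l : ℕ), (l : ℝ) ≤ fuel * (R * (Real.pi * 2 ^ (3 * b))) → φ a t l ≤ ψ a t l) :
    (countLoop b R fuel lo hi).expect mark g φ ≤ (countLoop b R fuel lo hi).expect mark g ψ := by
  induction fuel generalizing lo hi φ ψ with
  | zero =>
    by_cases hc : (candidates b lo hi).card ≤ 1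
    · rw [countLoop_of_card_le hc]; exact h _ _ _ (by simp)
    · rw [countLoop_zero hc]; exact h _ _ _ (by simp)
  | succ fuel ih =>
    by_cases hc : (candidates b lo hi).card ≤ 1
    · rw [countLoop_of_card_le hc]
      exact h _ _ _ (by
        push_cast
        have := Real.pi_pos
        positivity)
    · rw [countLoop_expect_succ hc, countLoop_expect_succ hc]
      refine Prog.expect_mono mark g _ fun s _ _ => ih fun a t l hl => h _ _ _ ?_
      push_cast
      have h1 := testPower_le_of_card hc
      have h2 : (R : ℝ) * (testPower lo hi).1 ≤ R * (Real.pi * 2 ^ (3 * b)) := by gcongr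
      linarith

theorem neg_one_pow_mul_cos (j : ℕ) (x : ℝ) :
    (-1) ^ j * Real.cos x = Real.cos (x - j * Real.pi) := by
  rw [Real.cos_sub_nat_mul_pi]

/-- If the angle of the true count is cut off, then the Hadamard tests deviate from their mean. -/
theorem narrow_spec {R : ℕ} {lo hi θ : ℝ} (h0 : 0 ≤ lo) (hlt : lo < hi) (hhi : hi ≤ Real.pi / 2)
    (h1 : lo ≤ θ) (h2 : θ ≤ hi) (s : ℤ)
    (hn : ¬ ((narrow R lo hi s).1 ≤ θ ∧ θ ≤ (narrow R lo hi s).2)) :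
    R * ((-1) ^ (testPower lo hi).2 * Real.cos (2 * (testPower lo hi).1 * θ) + testGap) ≤
        (-1) ^ (testPower lo hi).2 * (s : ℝ) ∨
      R * (-(-1) ^ (testPower lo hi).2 * Real.cos (2 * (testPower lo hi).1 * θ) + testGap) ≤
        -(-1) ^ (testPower lo hi).2 * (s : ℝ) := by
  obtain ⟨p1, p2, p3⟩ := testPower_spec h0 hlt hhi
  have hlev : testLevel lo hi = (-1) ^ (testPower lo hi).2 *
    ((Real.cos (2 * (testPower lo hi).1 * (lo + (hi - lo) / 3)) +
      Real.cos (2 * (testPower lo hi).1 * (hi - (hi - lo) / 3))) / 2) := rfl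
  unfold narrow at hn
  set m := (testPower lo hi).1
  set j := (testPower lo hi).2
  have hm : (0 : ℝ) ≤ m := Nat.cast_nonneg m
  -- Subtracting `j π` absorbs the sign `(-1) ^ j` and moves everything to `[0, π]`, where the
  -- cosine decreases. The test level is halfway between `cos u` and `cos v`, hence at distance at
  -- least `testGap` from both.
  set u := 2 * (m : ℝ) * (lo + (hi - lo) / 3) - j * Real.pi with hu
  set v := 2 * (m : ℝ) * (hi - (hi - lo) / 3) - j * Real.pi with hv
  set x := 2 * (m : ℝ) * θ - j * Real.pi with hx
  have hmlo : 2 * (m : ℝ) * lo ≤ 2 * m * hi := by gcongr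
  have gap := cos_sub_cos_ge (x := u) (y := v) (by rw [hu]; nlinarith) (by rw [hv]; nlinarith)
    (by rw [hu, hv]; nlinarith)
  have hlev' : testLevel lo hi = (Real.cos u + Real.cos v) / 2 := by
    rw [hlev, ← mul_div_assoc, mul_add, neg_one_pow_mul_cos, neg_one_pow_mul_cos]
  rw [neg_mul, neg_mul, neg_one_pow_mul_cos, ← hx]
  rw [hlev'] at hn
  have hR : (0 : ℝ) ≤ R := Nat.cast_nonneg R
  have hx0 : 0 ≤ x := by
    have : 2 * (m : ℝ) * lo ≤ 2 * m * θ := by gcongr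
    linarith
  have hxpi : x ≤ Real.pi := by
    have : 2 * (m : ℝ) * θ ≤ 2 * m * hi := by gcongr
    linarith
  split_ifs at hn with hs
  · left
    have hθ : hi - (hi - lo) / 3 < θ := by
      by_contra hcon
      exact hn ⟨h1, not_lt.1 hcon⟩
    have hvx : v ≤ x := by
      have : 2 * (m : ℝ) * (hi - (hi - lo) / 3) ≤ 2 * m * θ := by gcongr
      linarith
    have hc : Real.cos x ≤ Real.cos v :=
      Real.cos_le_cos_of_nonneg_of_le_pi (by rw [hv]; nlinarith) hxpi hvx
    refine le_trans (mul_le_mul_of_nonneg_left ?_ hR) hs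
    rw [testGap]; linarith
  · right
    have hθ : θ < lo + (hi - lo) / 3 := by
      by_contra hcon
      exact hn ⟨not_lt.1 hcon, h2⟩
    have hxu : x ≤ u := by
      have : 2 * (m : ℝ) * θ ≤ 2 * m * (lo + (hi - lo) / 3) := by gcongr
      linarith
    have hc : Real.cos u ≤ Real.cos x :=
      Real.cos_le_cos_of_nonneg_of_le_pi hx0 (by rw [hu]; nlinarith) hxu
    have : (R : ℝ) * (-Real.cos x + testGap) ≤ R * -((Real.cos u + Real.cos v) / 2) := by
      refine mul_le_mul_of_nonneg_left ?_ hR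
      rw [testGap]; linarith
    linarith

theorem narrow_width (R : ℕ) (lo hi : ℝ) (s : ℤ) :
    (narrow R lo hi s).2 - (narrow R lo hi s).1 = (hi - lo) * (2 / 3) := by
  unfold narrow
  split_ifs <;> ring

theorem narrow_bounds {R : ℕ} {lo hi : ℝ} (h : lo ≤ hi) (s : ℤ) :
    lo ≤ (narrow R lo hi s).1 ∧ (narrow R lo hi s).2 ≤ hi := by
  unfold narrow
  split_ifs
  · exact ⟨le_rfl, by dsimp only; linarith⟩
  · exact ⟨by dsimp only; linarith, le_rfl⟩

open Classical in
/-- The counting loop returns the wrong result or takes too long only with small probability. -/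
theorem countLoop_fail {b R : ℕ} (mark : Idx b → Bool) (g : ℕ) (fuel : ℕ) {lo hi : ℝ}
    (h0 : 0 ≤ lo) (hhi : hi ≤ Real.pi / 2) (h1 : lo ≤ groverAngle b (countMarked mark))
    (h2 : groverAngle b (countMarked mark) ≤ hi)
    (hw : 2 * 2 ^ (3 * b) * ((hi - lo) * (2 / 3) ^ fuel) < 1) {M : ℝ}
    (hM : M = Real.pi * √((2 : ℝ) ^ (3 * b) * (countMarked mark + 1))) :
    (countLoop b R fuel lo hi).expect mark g (fun a t l =>
      if a = countMarked mark ∧ (t : ℝ) ≤ fuel * (R * (M * g + 3 * b + 3) + 1) ∧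
        (l : ℝ) ≤ fuel * (R * M) then 0 else 1) ≤
      fuel * (2 * Real.exp (-(R * testGap ^ 2 / 4))) := by
  have hkN := countMarked_le mark
  have hM0 : 0 ≤ M := by rw [hM]; have := Real.pi_pos; positivity
  induction fuel generalizing lo hi with
  | zero =>
    -- When the rounds are used up, `hw` says that the width is below the minimal spacing of the
    -- angles.
    have hc : (candidates b lo hi).card ≤ 1 := by
      by_contra hc
      obtain ⟨i, hi', k, hk', hik⟩ := Finset.one_lt_card.1 (not_le.1 hc)
      obtain ⟨hi1, hi2, hi3⟩ := mem_candidates.1 hi'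
      obtain ⟨hk1, hk2, hk3⟩ := mem_candidates.1 hk'
      have h1 := groverAngle_spacing_min hik hi1 hk1
      have h2 : |groverAngle b k - groverAngle b i| ≤ hi - lo :=
        abs_le.2 ⟨by linarith, by linarith⟩
      have h3 : 1 ≤ 2 * (2 : ℝ) ^ (3 * b) * (hi - lo) := h1.trans (by gcongr)
      rw [pow_zero, mul_one] at hw
      linarith
    have hs : candidates b lo hi = {countMarked mark} := by
      refine (Finset.card_eq_one.1 (le_antisymm hc (Finset.card_pos.2
        ⟨_, mem_candidates.2 ⟨hkN, h1, h2⟩⟩))).elim fun a ha => ?_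
      have := mem_candidates.2 ⟨hkN, h1, h2⟩
      rw [ha, Finset.mem_singleton] at this
      rw [ha, this]
    rw [countLoop_of_card_le hc, hs]
    simp [Prog.expect]
  | succ fuel ih =>
    by_cases hc : (candidates b lo hi).card ≤ 1
    · have hs : candidates b lo hi = {countMarked mark} := by
        refine (Finset.card_eq_one.1 (le_antisymm hc (Finset.card_pos.2
          ⟨_, mem_candidates.2 ⟨hkN, h1, h2⟩⟩))).elim fun a ha => ?_
        have := mem_candidates.2 ⟨hkN, h1, h2⟩
        rw [ha, Finset.mem_singleton] at this
        rw [ha, this]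
      rw [countLoop_of_card_le hc, hs]
      simp only [Prog.expect, Finset.sum_singleton, id]
      rw [if_pos]
      · positivity
      · refine ⟨trivial, ?_, ?_⟩ <;> (push_cast; positivity)
    · have hlt : lo < hi := by
        obtain ⟨i, hi', k, hk', hik⟩ := Finset.one_lt_card.1 (not_le.1 hc)
        obtain ⟨hi1, hi2, hi3⟩ := mem_candidates.1 hi'
        obtain ⟨hk1, hk2, hk3⟩ := mem_candidates.1 hk'
        have h1 := groverAngle_spacing_min hik hi1 hk1
        have h2 : |groverAngle b k - groverAngle b i| ≤ hi - lo :=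
          abs_le.2 ⟨by linarith, by linarith⟩
        have h3 : 1 ≤ 2 * (2 : ℝ) ^ (3 * b) * (hi - lo) := h1.trans (by gcongr)
        by_contra hcon
        have : 2 * (2 : ℝ) ^ (3 * b) * (hi - lo) ≤ 0 :=
          mul_nonpos_of_nonneg_of_nonpos (by positivity) (by linarith)
        linarith
      have hmM : ((testPower lo hi).1 : ℝ) ≤ M := by
        rw [hM]; exact testPower_le_sqrt hc (mem_candidates.2 ⟨hkN, h1, h2⟩)
      set σ : ℝ := (-1) ^ (testPower lo hi).2 with hσ
      have hσ1 : |σ| = 1 := by rw [hσ, abs_pow, abs_neg, abs_one, one_pow]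
      set θ := groverAngle b (countMarked mark) with hθ
      set m := (testPower lo hi).1 with hm
      set ε := Real.exp (-(R * testGap ^ 2 / 4)) with hε
      rw [countLoop_expect_succ hc]
      -- Either the true angle survives the cut and the induction hypothesis applies to the shorter
      -- interval, or the sum of the tests deviates from its mean in one of two directions. Summing
      -- the failure probabilities over the rounds is a union bound.
      have hstep : ∀ s : ℤ, (countLoop b R fuel (narrow R lo hi s).1 (narrow R lo hi s).2).expect
          mark g (fun a t l => if a = countMarked mark ∧
            ((R * (m * g + 3 * b + 3) + (1 + t) : ℕ) : ℝ) ≤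
              (fuel + 1 : ℕ) * (R * (M * g + 3 * b + 3) + 1) ∧
            ((R * m + l : ℕ) : ℝ) ≤ (fuel + 1 : ℕ) * (R * M) then 0 else 1) ≤
          ((if R * (σ * Real.cos (2 * m * θ) + testGap) ≤ σ * s then 1 else 0) +
            (if R * (-σ * Real.cos (2 * m * θ) + testGap) ≤ -σ * s then 1 else 0)) +
            fuel * (2 * ε) := by
        intro s
        by_cases hn : (narrow R lo hi s).1 ≤ θ ∧ θ ≤ (narrow R lo hi s).2
        · have hb := narrow_bounds (R := R) hlt.le s
          have hih := ih (lo := (narrow R lo hi s).1) (hi := (narrow R lo hi s).2)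
            (by linarith) (by linarith) hn.1 hn.2 (by
              rw [narrow_width]
              calc _ = 2 * 2 ^ (3 * b) * ((hi - lo) * (2 / 3) ^ (fuel + 1)) := by ring
                _ < 1 := hw)
          have hpos : (0 : ℝ) ≤ (if R * (σ * Real.cos (2 * m * θ) + testGap) ≤ σ * s then 1 else 0) +
            (if R * (-σ * Real.cos (2 * m * θ) + testGap) ≤ -σ * s then 1 else 0) := by
            split_ifs <;> norm_num
          refine (le_trans ?_ hih).trans (by linarith)
          refine Prog.expect_mono mark g _ fun a t l => ?_
          have e1 : (R : ℝ) * (m * g + 3 * b + 3) ≤ R * (M * g + 3 * b + 3) := by gcongr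
          have e2 : (R : ℝ) * m ≤ R * M := by gcongr
          split_ifs with c1 c2 c2
          · exact le_rfl
          · norm_num
          · exfalso
            apply c1
            obtain ⟨d1, d2, d3⟩ := c2
            refine ⟨d1, ?_, ?_⟩
            · push_cast; linarith
            · push_cast; linarith
          · exact le_rfl
        · have hor := narrow_spec h0 hlt hhi h1 h2 s hn
          have hge : (1 : ℝ) ≤ (if R * (σ * Real.cos (2 * m * θ) + testGap) ≤ σ * s then 1 else 0) +
            (if R * (-σ * Real.cos (2 * m * θ) + testGap) ≤ -σ * s then 1 else 0) := by
            rcases hor with h | h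
            · rw [if_pos h]; split_ifs <;> norm_num
            · rw [if_pos h]; split_ifs <;> norm_num
          have hle : (countLoop b R fuel (narrow R lo hi s).1 (narrow R lo hi s).2).expect
            mark g (fun a t l => if a = countMarked mark ∧
            ((R * (m * g + 3 * b + 3) + (1 + t) : ℕ) : ℝ) ≤
              (fuel + 1 : ℕ) * (R * (M * g + 3 * b + 3) + 1) ∧
            ((R * m + l : ℕ) : ℝ) ≤ (fuel + 1 : ℕ) * (R * M) then (0 : ℝ) else 1) ≤ 1 := by
            refine (Prog.expect_mono mark g _ (ψ := fun _ _ _ => 1) fun a t l => ?_).trans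
              (countLoop_expect_const mark g 1).le
            split_ifs <;> norm_num
          have : 0 ≤ (fuel : ℝ) * (2 * ε) := by positivity
          linarith
      refine (Prog.expect_mono mark g _ fun s _ _ => hstep s).trans ?_
      rw [Prog.expect_add, Prog.expect_add, hadamardSum_expect_const]
      have t1 := hadamardSum_tail mark g m R hσ1 testGap_pos.le testGap_le_one
        (fun s => R * (σ * Real.cos (2 * m * θ) + testGap) ≤ σ * s) fun a h => h
      have t2 := hadamardSum_tail mark g m R (σ := -σ) (by rw [abs_neg, hσ1]) testGap_pos.le
        testGap_le_one (fun s => R * (-σ * Real.cos (2 * m * θ) + testGap) ≤ -σ * s) fun a h => h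
      push_cast
      linarith

/-- The number of repetitions of a Hadamard test is this number times the number of qubits. -/
noncomputable def testReps : ℕ := ⌈4 * Real.log 64 / testGap ^ 2⌉₊

theorem exp_testReps_le (b : ℕ) :
    Real.exp (-((testReps * (b + 1) : ℕ) * testGap ^ 2 / 4)) ≤ (1 / 64) ^ (b + 1) := by
  have hγ : 0 < testGap ^ 2 := pow_pos testGap_pos 2
  have h1 : 4 * Real.log 64 / testGap ^ 2 ≤ testReps := Nat.le_ceil _
  rw [div_le_iff₀ hγ] at h1
  have h2 : (1 / 64 : ℝ) ^ (b + 1) = Real.exp (-((b + 1 : ℕ) * Real.log 64)) := by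
    rw [Real.exp_neg, Real.exp_nat_mul, Real.exp_log (by norm_num), one_div, inv_pow]
  rw [h2, Real.exp_le_exp]
  push_cast
  have h3 := mul_le_mul_of_nonneg_right h1 (show (0 : ℝ) ≤ b + 1 by positivity)
  linarith

/-- Quantum counting. -/
noncomputable def quantumCount (b : ℕ) : Prog b ℕ :=
  countLoop b (testReps * (b + 1)) (6 * b + 4) 0 (Real.pi / 2)

/-- The number of calls to `G` in one Hadamard test during a successful run. -/
noncomputable def testSize (b k : ℕ) : ℝ := Real.pi * √((2 : ℝ) ^ (3 * b) * (k + 1))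

/-- Six rounds per bit outweigh `N = 8 ^ b`, as `8 (2 / 3) ^ 6 < 1`. The four additional rounds take
care of the initial length, as `π (2 / 3) ^ 4 < 1`. -/
theorem two_thirds_pow_le (b : ℕ) :
    2 * 2 ^ (3 * b) * ((Real.pi / 2 - 0) * (2 / 3 : ℝ) ^ (6 * b + 4)) < 1 := by
  have h1 : (2 / 3 : ℝ) ^ (6 * b + 4) = (64 / 729) ^ b * (16 / 81) := by
    rw [pow_add, pow_mul]; norm_num
  have h2 : (2 : ℝ) ^ (3 * b) = 8 ^ b := by rw [pow_mul]; norm_num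
  have h3 : (8 : ℝ) ^ b * (64 / 729) ^ b ≤ 1 := by
    rw [← mul_pow]; exact pow_le_one₀ (by norm_num) (by norm_num)
  rw [h1, h2]
  have := Real.pi_lt_d2
  have hpi := Real.pi_pos
  calc 2 * (8 : ℝ) ^ b * ((Real.pi / 2 - 0) * ((64 / 729) ^ b * (16 / 81)))
      = ((8 : ℝ) ^ b * (64 / 729) ^ b) * (Real.pi * (16 / 81)) := by ring
    _ ≤ 1 * (Real.pi * (16 / 81)) := by gcongr
    _ < 1 := by linarith

-- The failure probability has to compensate the up to order `N = 8 ^ b` calls per test in a failing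
-- run. Each of the `6 b + 4` rounds fails with probability at most `2 / 64 ^ (b + 1)`, and one
-- factor `1 / 8 ^ b` of this pays for the number of rounds.
open Classical in
theorem quantumCount_fail {b : ℕ} (mark : Idx b → Bool) (g : ℕ) :
    (quantumCount b).expect mark g (fun a t l =>
      if a = countMarked mark ∧ (t : ℝ) ≤ (6 * b + 4 : ℕ) * ((testReps * (b + 1) : ℕ) *
          (testSize b (countMarked mark) * g + 3 * b + 3) + 1) ∧
        (l : ℝ) ≤ (6 * b + 4 : ℕ) * ((testReps * (b + 1) : ℕ) * testSize b (countMarked mark))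
      then 0 else 1) ≤ 1 / 8 * (1 / 8) ^ b := by
  refine (countLoop_fail mark g (6 * b + 4) le_rfl le_rfl (groverAngle_nonneg _ _)
    (groverAngle_le _ _) (two_thirds_pow_le b) rfl).trans ?_
  have h1 := exp_testReps_le b
  have h2 : (1 / 64 : ℝ) ^ (b + 1) = 1 / 64 * ((1 / 8) ^ b * (1 / 8) ^ b) := by
    rw [← mul_pow, pow_succ]; norm_num; ring
  have h3 : (1 : ℝ) + b * 7 ≤ 8 ^ b := by
    have := one_add_mul_le_pow (a := (7 : ℝ)) (by norm_num) b
    norm_num at this ⊢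
    linarith
  have h4 : (8 : ℝ) ^ b * (1 / 8) ^ b = 1 := by rw [← mul_pow]; norm_num
  have hpos : (0 : ℝ) < (1 / 8) ^ b := by positivity
  calc ((6 * b + 4 : ℕ) : ℝ) * (2 * Real.exp (-((testReps * (b + 1) : ℕ) * testGap ^ 2 / 4)))
      ≤ ((6 * b + 4 : ℕ) : ℝ) * (2 * (1 / 64) ^ (b + 1)) := by gcongr
    _ = ((6 * b + 4) / 32 * (1 / 8) ^ b) * (1 / 8) ^ b := by rw [h2]; push_cast; ring
    _ ≤ (1 / 8 * 8 ^ b * (1 / 8) ^ b) * (1 / 8) ^ b := by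
      gcongr
      linarith [(Nat.cast_nonneg b : (0 : ℝ) ≤ b)]
    _ = _ := by rw [mul_assoc (1 / 8 : ℝ), h4]; ring

theorem testSize_le (b k : ℕ) :
    testSize b k ≤ 5 * √((2 : ℝ) ^ (3 * b) * (max 1 k : ℕ)) := by
  have h1 : √((2 : ℝ) ^ (3 * b) * (k + 1)) ≤ √(2 * ((2 : ℝ) ^ (3 * b) * (max 1 k : ℕ))) := by
    refine Real.sqrt_le_sqrt ?_
    have h2 : (k : ℝ) ≤ (max 1 k : ℕ) := by exact_mod_cast le_max_right 1 k
    have h3 : (1 : ℝ) ≤ (max 1 k : ℕ) := by exact_mod_cast le_max_left 1 k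
    have h4 : (0 : ℝ) < 2 ^ (3 * b) := by positivity
    nlinarith
  have h5 : √(2 : ℝ) ≤ 1.5 := Real.sqrt_le_iff.2 ⟨by norm_num, by norm_num⟩
  have hpi := Real.pi_lt_d2
  have hpi0 := Real.pi_pos
  rw [Real.sqrt_mul (show (0 : ℝ) ≤ 2 by norm_num)] at h1
  calc testSize b k ≤ Real.pi * (√2 * √((2 : ℝ) ^ (3 * b) * (max 1 k : ℕ))) := by
        unfold testSize; gcongr
    _ ≤ 3.15 * (1.5 * √((2 : ℝ) ^ (3 * b) * (max 1 k : ℕ))) := by gcongr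
    _ ≤ _ := by nlinarith [Real.sqrt_nonneg ((2 : ℝ) ^ (3 * b) * (max 1 k : ℕ))]

theorem one_le_sqrt_two_pow_mul (b k : ℕ) : 1 ≤ √((2 : ℝ) ^ (3 * b) * (max 1 k : ℕ)) := by
  rw [Real.one_le_sqrt]
  have h3 : (1 : ℝ) ≤ (max 1 k : ℕ) := by exact_mod_cast le_max_left 1 k
  exact one_le_mul_of_one_le_of_one_le (one_le_pow₀ (by norm_num)) h3

theorem isQuantumCounting_quantumCount : IsQuantumCounting quantumCount := by
  classical
  refine ⟨fun b mark g => ?_, 36 * testReps, 2, fun b mark => ?_⟩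
  · have h1 := quantumCount_fail mark g
    have h2 : (1 / 8 : ℝ) ^ b ≤ 1 := pow_le_one₀ (by norm_num) (by norm_num)
    have h3 := countLoop_expect_const (b := b) (R := testReps * (b + 1)) (fuel := 6 * b + 4)
      (lo := 0) (hi := Real.pi / 2) mark g 1
    have h4 : (quantumCount b).expect mark g (fun _ _ _ => 1) ≤
        (quantumCount b).expect mark g (fun a t l => (if a = countMarked mark then 1 else 0) +
        if a = countMarked mark ∧ (t : ℝ) ≤ (6 * b + 4 : ℕ) * ((testReps * (b + 1) : ℕ) *
          (testSize b (countMarked mark) * g + 3 * b + 3) + 1) ∧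
        (l : ℝ) ≤ (6 * b + 4 : ℕ) * ((testReps * (b + 1) : ℕ) * testSize b (countMarked mark))
        then 0 else 1) := by
      refine Prog.expect_mono mark g _ fun a t l => ?_
      by_cases h : a = countMarked mark
      · rw [if_pos h]; split_ifs <;> norm_num
      · rw [if_neg h, if_neg fun h' => h h'.1]; norm_num
    rw [Prog.expect_add] at h4
    have h5 : (quantumCount b).expect mark g (fun _ _ _ => 1) = 1 := h3
    have h6 : (quantumCount b).prob mark g (fun k _ => k = countMarked mark) =
        (quantumCount b).expect mark g
          (fun a _ _ => if a = countMarked mark then 1 else 0) := by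
      refine congrArg _ (funext fun a => funext fun t => funext fun l => ?_)
      by_cases h : a = countMarked mark <;> simp [h]
    rw [h6]
    linarith
  · set k := countMarked mark with hk
    set F : ℝ := ((6 * b + 4 : ℕ) : ℝ) with hF
    set R : ℝ := ((testReps * (b + 1) : ℕ) : ℝ) with hR
    set X := √((2 : ℝ) ^ (3 * b) * (max 1 k : ℕ)) with hX
    have hpi := Real.pi_pos
    have hX1 : 1 ≤ X := one_le_sqrt_two_pow_mul b k
    have hsz : testSize b k ≤ 5 * X := testSize_le b k
    have h1 := quantumCount_fail mark 0
    have hF0 : 0 ≤ F := Nat.cast_nonneg _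
    have hR0 : 0 ≤ R := Nat.cast_nonneg _
    have hs0 : 0 ≤ testSize b k := by unfold testSize; positivity
    -- The number of calls is at most the bound for a successful run, plus the worst-case bound on
    -- the event of failure. In the latter, `N` cancels against the failure probability.
    have h2 : (quantumCount b).expectedCalls mark ≤ (quantumCount b).expect mark 0 (fun a t l =>
        F * (R * testSize b k) + (F * (R * (Real.pi * 2 ^ (3 * b)))) *
        if a = k ∧ (t : ℝ) ≤ F * (R * (testSize b k * (0 : ℕ) + 3 * b + 3) + 1) ∧
          (l : ℝ) ≤ F * (R * testSize b k) then 0 else 1) := by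
      refine countLoop_expect_mono mark 0 fun a t l hl => ?_
      split_ifs with h
      · rw [mul_zero, add_zero]; exact h.2.2
      · rw [mul_one]
        have : 0 ≤ F * (R * testSize b k) := by positivity
        have hl' : (l : ℝ) ≤ F * (R * (Real.pi * 2 ^ (3 * b))) := hl
        linarith
    rw [Prog.expect_add] at h2
    have h3 : (quantumCount b).expect mark 0 (fun _ _ _ => F * (R * testSize b k)) =
        F * (R * testSize b k) := countLoop_expect_const mark 0 _
    rw [h3, Prog.expect_smul] at h2
    have h4 : F * (R * (Real.pi * 2 ^ (3 * b))) * (1 / 8 * (1 / 8) ^ b) =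
        F * R * (Real.pi / 8) := by
      have : (2 : ℝ) ^ (3 * b) * (1 / 8) ^ b = 1 := by
        rw [pow_mul, ← mul_pow]; norm_num
      linear_combination (F * R * Real.pi / 8) * this
    have h5 := mul_le_mul_of_nonneg_left h1
      (show 0 ≤ F * (R * (Real.pi * 2 ^ (3 * b))) by positivity)
    rw [h4] at h5
    have h6 : F * R ≤ 6 * testReps * (b + 1) ^ 2 := by
      rw [hF, hR]
      push_cast
      have : (0 : ℝ) ≤ testReps * (b + 1) := by positivity
      nlinarith
    have hpi4 := Real.pi_lt_four
    calc (quantumCount b).expectedCalls mark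
        ≤ F * (R * testSize b k) + F * R * (Real.pi / 8) := h2.trans (by gcongr)
      _ ≤ F * (R * (5 * X)) + F * R * (1 * X) := by gcongr; linarith
      _ = F * R * (6 * X) := by ring
      _ ≤ 6 * testReps * (b + 1) ^ 2 * (6 * X) := by gcongr
      _ = _ := by ring

/-! ## Quantum search for the seeds -/

theorem groverCircuit_cost (b m g : ℕ) :
    ((groverCircuit b m).map (Gate.cost g)).sum = 3 * b + m * g := by
  simp [groverCircuit, Gate.cost]

/-- The probability of measuring a marked basis state after `m` Grover iterations. -/
noncomputable def hitProb (b k m : ℕ) : ℝ := Real.sin ((2 * m + 1) * groverAngle b k) ^ 2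

theorem hitProb_le_one (b k m : ℕ) : hitProb b k m ≤ 1 := Real.sin_sq_le_one _

theorem groverAngle_pos {b k : ℕ} (hk : 0 < k) : 0 < groverAngle b k := by
  refine Real.arcsin_pos.2 (Real.sqrt_pos.2 ?_)
  have : (0 : ℝ) < k := by exact_mod_cast hk
  positivity

/-- Rounding `π / (4θ)` down puts `(2 m + 1) θ` within `θ` of `π / 2`, which suffices for `θ ≤ π /
4`. For larger `θ` no iteration is made, and `θ` itself lies between `π / 4` and `π / 2`. -/
theorem half_le_hitProb {b k : ℕ} (hk : 0 < k) :
    1 / 2 ≤ hitProb b k (groverIterations b k) := by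
  have hθ := groverAngle_pos (b := b) hk
  have hθ2 := groverAngle_le b k
  have hm : groverIterations b k = ⌊Real.pi / (4 * groverAngle b k)⌋₊ := rfl
  rw [hitProb, hm]
  set θ := groverAngle b k
  have hpi := Real.pi_pos
  rcases le_or_gt θ (Real.pi / 4) with h | h
  · have h1 := Nat.floor_le (show 0 ≤ Real.pi / (4 * θ) by positivity)
    have h2 := Nat.lt_floor_add_one (Real.pi / (4 * θ))
    set m := ⌊Real.pi / (4 * θ)⌋₊
    rw [le_div_iff₀ (by positivity)] at h1
    rw [div_lt_iff₀ (by positivity)] at h2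
    set x := (2 * (m : ℝ) + 1) * θ with hx
    have hx1 : x - Real.pi / 2 ≤ θ := by rw [hx]; linarith
    have hx2 : -θ ≤ x - Real.pi / 2 := by rw [hx]; linarith
    have h3 : Real.cos (Real.pi / 4) ≤ Real.sin x := by
      rw [show Real.sin x = Real.cos (x - Real.pi / 2) by rw [Real.cos_sub_pi_div_two],
        ← Real.cos_abs (x - Real.pi / 2)]
      exact Real.cos_le_cos_of_nonneg_of_le_pi (abs_nonneg _) (by linarith)
        ((abs_le.2 ⟨hx2, hx1⟩).trans h)
    rw [Real.cos_pi_div_four] at h3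
    calc (1 / 2 : ℝ) = (√2 / 2) ^ 2 := by rw [div_pow, Real.sq_sqrt (by norm_num)]; norm_num
      _ ≤ _ := pow_le_pow_left₀ (by positivity) h3 2
  · have h0 : ⌊Real.pi / (4 * θ)⌋₊ = 0 := by
      rw [Nat.floor_eq_zero, div_lt_one (by positivity)]
      linarith
    rw [h0]
    have h3 : Real.sin (Real.pi / 4) ≤ Real.sin θ :=
      Real.sin_le_sin_of_le_of_le_pi_div_two (by linarith) hθ2 h.le
    rw [Real.sin_pi_div_four] at h3
    simp only [Nat.cast_zero, mul_zero, zero_add, one_mul]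
    calc (1 / 2 : ℝ) = (√2 / 2) ^ 2 := by rw [div_pow, Real.sq_sqrt (by norm_num)]; norm_num
      _ ≤ _ := pow_le_pow_left₀ (by positivity) h3 2

/-- `m ≤ π / (4θ) ≤ 1 / θ`, and `θ ≥ sin θ = √(k / N)`. -/
theorem mul_groverIterations_le {b k : ℕ} (hk : k ≤ 2 ^ (3 * b)) :
    (k : ℝ) * groverIterations b k ≤ √((2 : ℝ) ^ (3 * b) * k) := by
  rcases Nat.eq_zero_or_pos k with h0 | hpos
  · simp [h0]
  have hθ := groverAngle_pos (b := b) hpos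
  have hm : groverIterations b k = ⌊Real.pi / (4 * groverAngle b k)⌋₊ := rfl
  have hs := sin_groverAngle hk
  have h1 := Nat.floor_le (show 0 ≤ Real.pi / (4 * groverAngle b k) by
    have := Real.pi_pos; positivity)
  rw [← hm, le_div_iff₀ (by positivity)] at h1
  have h2 : √(k : ℝ) / √((2 : ℝ) ^ (3 * b)) ≤ groverAngle b k := by
    rw [← hs]; exact Real.sin_le hθ.le
  have hN : 0 < √((2 : ℝ) ^ (3 * b)) := Real.sqrt_pos.2 (by positivity)
  rw [div_le_iff₀ hN] at h2
  set m : ℝ := (groverIterations b k : ℝ)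
  have hm0 : 0 ≤ m := Nat.cast_nonneg _
  have hpi := Real.pi_lt_four
  have h3 : m * groverAngle b k ≤ 1 := by linarith
  have hk2 : √(k : ℝ) * √(k : ℝ) = k := Real.mul_self_sqrt (Nat.cast_nonneg k)
  rw [Real.sqrt_mul (by positivity)]
  calc (k : ℝ) * m = √(k : ℝ) * m * √(k : ℝ) := by linear_combination (-m) * hk2
    _ ≤ √(k : ℝ) * m * (groverAngle b k * √((2 : ℝ) ^ (3 * b))) := by gcongr
    _ = (m * groverAngle b k) * (√((2 : ℝ) ^ (3 * b)) * √(k : ℝ)) := by ring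
    _ ≤ 1 * (√((2 : ℝ) ^ (3 * b)) * √(k : ℝ)) := by gcongr
    _ = _ := one_mul _

namespace Detector

variable (D : Detector)

theorem seedLoop_of_le {E : EventRecord} {k m fuel : ℕ} {found : List Seed} {T : KeyTree}
    (h : k ≤ found.length) : D.seedLoop E k m fuel found T = .step 1 (.ret (some found)) := by
  cases fuel <;> rw [seedLoop, if_pos h]

theorem seedLoop_zero {E : EventRecord} {k m : ℕ} {found : List Seed} {T : KeyTree}
    (h : ¬ k ≤ found.length) : D.seedLoop E k m 0 found T = .ret none := by
  rw [seedLoop, if_neg h]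

/-- One round of the search, as a function of the measured basis state. -/
noncomputable def seedRound (E : EventRecord) (k m fuel : ℕ) (found : List Seed) (T : KeyTree)
    (y : Idx E.bits) : Prog E.bits (Option (List Seed)) :=
  match D.seedOf E y with
  | none => .step 5 (D.seedLoop E k m fuel found T)
  | some s =>
    if (T.search [s.j₀, s.j₁, s.j₂]).val then
      .step ((T.search [s.j₀, s.j₁, s.j₂]).time + 5) (D.seedLoop E k m fuel found T)
    else
      .step ((T.search [s.j₀, s.j₁, s.j₂]).time + (T.add [s.j₀, s.j₁, s.j₂]).time + 6)
        (D.seedLoop E k m fuel (s :: found) (T.add [s.j₀, s.j₁, s.j₂]).val)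

theorem seedLoop_expect_succ {E : EventRecord} {k m fuel : ℕ} {found : List Seed} {T : KeyTree}
    (h : ¬ k ≤ found.length) (g : ℕ) (φ : Option (List Seed) → ℕ → ℕ → ℝ) :
    (D.seedLoop E k m (fuel + 1) found T).expect (D.markSeed E) g φ =
      ∑ y, ‖planeVec (D.markSeed E) (Real.sin ((2 * m + 1) * groverAngle E.bits (D.kSeed E)))
        (Real.cos ((2 * m + 1) * groverAngle E.bits (D.kSeed E))) y‖ ^ 2 *
        (D.seedRound E k m fuel found T y).expect (D.markSeed E) g fun a t l =>
          φ a (3 * E.bits + m * g + t) (((groverCircuit E.bits m).map Gate.calls).sum + l) := by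
  rw [← D.countMarked_markSeed E, ← sum_norm_groverCircuit, seedLoop, if_neg h]
  simp only [Prog.expect, groverCircuit_cost]
  rfl

theorem seedLoop_expect_const {E : EventRecord} {k m fuel : ℕ} {found : List Seed} {T : KeyTree}
    (g : ℕ) (c : ℝ) :
    (D.seedLoop E k m fuel found T).expect (D.markSeed E) g (fun _ _ _ => c) = c := by
  induction fuel generalizing found T with
  | zero =>
    by_cases h : k ≤ found.length
    · rw [seedLoop_of_le D h]; rfl
    · rw [seedLoop_zero D h]; rfl
  | succ fuel ih =>
    by_cases h : k ≤ found.length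
    · rw [seedLoop_of_le D h]; rfl
    · rw [D.seedLoop_expect_succ h]
      have hr : ∀ y, (D.seedRound E k m fuel found T y).expect (D.markSeed E) g
          (fun _ _ _ => c) = c := by
        intro y
        unfold seedRound
        split
        · exact ih
        · split_ifs
          · exact ih
          · exact ih
      simp_rw [hr]
      rw [← Finset.sum_mul, ← D.countMarked_markSeed E, sum_norm_planeVec_angle, one_mul]

/-- The keys of the search tree are those of the seeds found so far. -/
structure SeedInv (E : EventRecord) (found : List Seed) (T : KeyTree) : Prop where
  nodup : found.Nodup
  subset : ∀ s ∈ found, s ∈ (D.seedGeneration E).val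
  contains_iff : ∀ s ∈ (D.seedGeneration E).val,
    T.contains [s.j₀, s.j₁, s.j₂] = true ↔ s ∈ found
  size_le : T.size ≤ found.length

theorem seed_eq_of_labels {E : EventRecord} {s u : Seed} (hs : s ∈ (D.seedGeneration E).val)
    (hu : u ∈ (D.seedGeneration E).val) (h : [s.j₀, s.j₁, s.j₂] = [u.j₀, u.j₁, u.j₂]) : s = u := by
  simp only [List.cons.injEq, and_true] at h
  have h1 := D.mem_seedGeneration.1 hs
  have h2 := D.mem_seedGeneration.1 hu
  rw [h.1, h.2.1, h.2.2, h2] at h1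
  exact (Option.some.inj h1).symm

theorem seedInv_nil (E : EventRecord) : D.SeedInv E [] ∅ where
  nodup := List.nodup_nil
  subset := by simp
  contains_iff := by simp
  size_le := by simp

theorem SeedInv.cons {D : Detector} {E : EventRecord} {found : List Seed} {T : KeyTree}
    (h : D.SeedInv E found T) {s : Seed} (hs : s ∈ (D.seedGeneration E).val) (hn : s ∉ found) :
    D.SeedInv E (s :: found) (T.add [s.j₀, s.j₁, s.j₂]).val where
  nodup := List.nodup_cons.2 ⟨hn, h.nodup⟩
  subset := by
    intro u hu
    rcases List.mem_cons.1 hu with rfl | hu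
    · exact hs
    · exact h.subset u hu
  contains_iff := by
    intro u hu
    have e : (T.add [s.j₀, s.j₁, s.j₂]).val = T.insert [s.j₀, s.j₁, s.j₂] := rfl
    rw [e, Std.TreeSet.contains_insert, Bool.or_eq_true, h.contains_iff u hu, List.mem_cons,
      beq_iff_eq, Std.LawfulEqCmp.compare_eq_iff_eq]
    refine or_congr ⟨fun h' => D.seed_eq_of_labels hu hs h'.symm, fun h' => by rw [h']⟩ Iff.rfl
  size_le := (KeyTree.size_add_le T _).trans (Nat.succ_le_succ h.size_le)

-- The states whose measurement makes progress correspond to the seeds not yet found. As all marked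
-- states are equally likely, this yields the probability of progress in one round.
open Classical in
theorem SeedInv.card_new {D : Detector} {E : EventRecord} {found : List Seed} {T : KeyTree}
    (h : D.SeedInv E found T) :
    (Finset.univ.filter fun y => ∃ s ∈ (D.seedGeneration E).val, s ∉ found ∧
      D.seedOf E y = some s).card + found.length = D.kSeed E := by
  have h1 := D.card_seedOf_mem (l := (D.seedGeneration E).val.filter fun s => s ∉ found)
    ((D.nodup_seedGeneration E).filter _) fun s hs => List.mem_of_mem_filter hs
  have h2 : ((D.seedGeneration E).val.filter fun s => s ∈ found).length = found.length := by
    refine List.Perm.length_eq ((List.perm_ext_iff_of_nodup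
      ((D.nodup_seedGeneration E).filter _) h.nodup).2 fun s => ?_)
    simp only [List.mem_filter, decide_eq_true_eq]
    exact ⟨fun h => h.2, fun hs => ⟨h.subset s hs, hs⟩⟩
  have h3 := List.length_eq_length_filter_add (l := (D.seedGeneration E).val)
    (fun s => decide (s ∈ found))
  rw [kSeed, h3, h2, add_comm]
  congr 1
  rw [show (fun s => !decide (s ∈ found)) = fun s => decide (s ∉ found) by
    funext s; simp, ← h1]
  congr 1
  ext y
  simp only [Finset.mem_filter, Finset.mem_univ, true_and, List.mem_filter, decide_eq_true_eq,
    and_assoc]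

/-- A bound for the time of one round of the search. -/
def roundTime (b k m g : ℕ) : ℕ := 3 * b + m * g + 3 * pathBound k + 8

open Classical in
/-- The search fails to find all seeds in time only with small probability. -/
theorem seedLoop_fail (E : EventRecord) (m g fuel : ℕ) {found : List Seed} {T : KeyTree}
    (h : D.SeedInv E found T) :
    (D.seedLoop E (D.kSeed E) m fuel found T).expect (D.markSeed E) g (fun o t _ =>
      if (∃ seeds : List Seed, o = some seeds ∧ seeds.Perm (D.seedGeneration E).val) ∧
        t ≤ fuel * roundTime E.bits (D.kSeed E) m g + 1 then 0 else 1) ≤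
      ((D.kSeed E : ℝ) - found.length) *
        (1 - hitProb E.bits (D.kSeed E) m / D.kSeed E) ^ fuel := by
  set k := D.kSeed E with hk
  have hq1 : hitProb E.bits k m / k ≤ 1 := by
    rcases Nat.eq_zero_or_pos k with h0 | hpos
    · simp [h0]
    · have : (1 : ℝ) ≤ k := by exact_mod_cast hpos
      rw [div_le_one (by linarith)]
      exact (hitProb_le_one _ _ _).trans this
  induction fuel generalizing found T with
  | zero =>
    have hcard := h.card_new
    by_cases hle : k ≤ found.length
    · rw [seedLoop_of_le D hle]
      have hp : found.Perm (D.seedGeneration E).val :=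
        (List.subperm_of_subset h.nodup h.subset).perm_of_length_le hle
      simp only [Prog.expect]
      rw [if_pos ⟨⟨found, rfl, hp⟩, by simp⟩]
      have : (found.length : ℝ) ≤ k := by exact_mod_cast (by omega : found.length ≤ k)
      rw [pow_zero, mul_one]; linarith
    · rw [seedLoop_zero D hle]
      simp only [Prog.expect]
      -- Here failure is certain, and the bound is the number of missing seeds, which is at least
      -- one.
      have : (found.length : ℝ) + 1 ≤ k := by exact_mod_cast not_le.1 hle
      rw [pow_zero, mul_one]
      split_ifs <;> linarith
  | succ fuel ih =>
    have hcard := h.card_new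
    by_cases hle : k ≤ found.length
    · rw [seedLoop_of_le D hle]
      have hp : found.Perm (D.seedGeneration E).val :=
        (List.subperm_of_subset h.nodup h.subset).perm_of_length_le hle
      simp only [Prog.expect]
      rw [if_pos ⟨⟨found, rfl, hp⟩, by simp⟩]
      have : (found.length : ℝ) ≤ k := by exact_mod_cast (by omega : found.length ≤ k)
      exact mul_nonneg (by linarith) (pow_nonneg (by linarith) _)
    rw [D.seedLoop_expect_succ hle, ← hk]
    set A : ℝ := (1 - hitProb E.bits k m / k) ^ fuel with hA
    have hA0 : 0 ≤ A := pow_nonneg (by linarith) _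
    set j : ℝ := (k : ℝ) - found.length with hj
    have hpath : pathBound found.length ≤ pathBound k := pathBound_mono (by omega)
    have hround : ∀ y, (D.seedRound E k m fuel found T y).expect (D.markSeed E) g (fun o t _ =>
        if (∃ seeds : List Seed, o = some seeds ∧ seeds.Perm (D.seedGeneration E).val) ∧
          3 * E.bits + m * g + t ≤ (fuel + 1) * roundTime E.bits k m g + 1 then 0 else 1) ≤
        j * A - (if ∃ s ∈ (D.seedGeneration E).val, s ∉ found ∧ D.seedOf E y = some s
          then 1 else 0) * A := by
      intro y
      have hmono : ∀ (t₀ : ℕ) (found' : List Seed) (T' : KeyTree),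
          t₀ ≤ 3 * pathBound k + 8 →
          (D.seedLoop E k m fuel found' T').expect (D.markSeed E) g (fun o t _ =>
            if (∃ seeds : List Seed, o = some seeds ∧ seeds.Perm (D.seedGeneration E).val) ∧
              3 * E.bits + m * g + (t₀ + t) ≤ (fuel + 1) * roundTime E.bits k m g + 1
              then (0 : ℝ) else 1) ≤
          (D.seedLoop E k m fuel found' T').expect (D.markSeed E) g (fun o t _ =>
            if (∃ seeds : List Seed, o = some seeds ∧ seeds.Perm (D.seedGeneration E).val) ∧
              t ≤ fuel * roundTime E.bits k m g + 1 then (0 : ℝ) else 1) := by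
        intro t₀ found' T' ht₀
        refine Prog.expect_mono _ g _ fun o t _ => ?_
        split_ifs with c1 c2 c2
        · exact le_rfl
        · norm_num
        · exfalso
          apply c1
          refine ⟨c2.1, ?_⟩
          have := c2.2
          have e : (fuel + 1) * roundTime E.bits k m g =
            fuel * roundTime E.bits k m g + (3 * E.bits + m * g + 3 * pathBound k + 8) := by
            rw [Nat.add_mul, one_mul]; rfl
          omega
        · exact le_rfl
      rw [seedRound]
      split
      · rename_i hnone
        rw [if_neg (by rintro ⟨s, -, -, hs⟩; rw [hnone] at hs; cases hs), zero_mul, sub_zero]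
        exact (hmono 5 found T (by omega)).trans (ih h)
      · rename_i s hsome
        have hs := D.mem_seedGeneration_of_seedOf hsome
        have ht1 := KeyTree.search_time_le h.size_le [s.j₀, s.j₁, s.j₂]
        have ht2 := KeyTree.add_time_le h.size_le [s.j₀, s.j₁, s.j₂]
        split_ifs with hc hnew hnew
        · exfalso
          obtain ⟨u, hu, hnu, hsu⟩ := hnew
          rw [hsome] at hsu
          cases hsu
          exact hnu ((h.contains_iff s hs).1 hc)
        · rw [zero_mul, sub_zero]
          exact (hmono _ found T (by omega)).trans (ih h)
        · have hn : s ∉ found := fun hin => hc ((h.contains_iff s hs).2 hin)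
          refine (hmono _ (s :: found) _ (by omega)).trans ((ih (h.cons hs hn)).trans ?_)
          rw [List.length_cons, hj]
          push_cast
          exact le_of_eq (by ring)
        · exfalso
          exact hnew ⟨s, hs, fun hin => hc ((h.contains_iff s hs).2 hin), hsome⟩
    have hkpos : (0 : ℝ) < k := by
      have : 0 < k := by omega
      exact_mod_cast this
    set P : Idx E.bits → ℝ := fun y => ‖planeVec (D.markSeed E)
      (Real.sin ((2 * m + 1) * groverAngle E.bits k))
        (Real.cos ((2 * m + 1) * groverAngle E.bits k)) y‖ ^ 2 with hP
    have hP1 : ∑ y, P y = 1 := by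
      rw [hP, hk, ← D.countMarked_markSeed E]; exact sum_norm_planeVec_angle _ _
    have hPq : ∀ y, (∃ s ∈ (D.seedGeneration E).val, s ∉ found ∧ D.seedOf E y = some s) →
        P y = hitProb E.bits k m / k := by
      rintro y ⟨s, hs, -, hsy⟩
      have hy : D.markSeed E y = true := D.markSeed_iff.2 ⟨s, hs, hsy⟩
      simp only [hP, planeVec, hy, if_true, D.countMarked_markSeed, ← hk]
      rw [Complex.norm_real, Real.norm_eq_abs, sq_abs, div_pow, Real.sq_sqrt hkpos.le, hitProb]
    have hsum : ∑ y, P y * (if ∃ s ∈ (D.seedGeneration E).val, s ∉ found ∧ D.seedOf E y = some s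
          then 1 else 0) = j * (hitProb E.bits k m / k) := by
      simp only [mul_ite, mul_one, mul_zero]
      rw [← Finset.sum_filter, Finset.sum_congr rfl fun y hy =>
        hPq y (Finset.mem_filter.1 hy).2, Finset.sum_const, nsmul_eq_mul]
      congr 1
      rw [hj, eq_sub_iff_add_eq]
      exact_mod_cast hcard
    -- A round finds a new seed with probability `j p / k`, where `j` is the number of missing seeds
    -- and `p` the probability of a marked outcome. The expected number of missing seeds thus drops
    -- from `j` to `j (1 - p / k)`.
    calc _ ≤ ∑ y, P y * (j * A - (if ∃ s ∈ (D.seedGeneration E).val, s ∉ found ∧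
          D.seedOf E y = some s then 1 else 0) * A) :=
        Finset.sum_le_sum fun y _ => mul_le_mul_of_nonneg_left (hround y) (by positivity)
      _ = j * A * ∑ y, P y - A * ∑ y, P y * (if ∃ s ∈ (D.seedGeneration E).val, s ∉ found ∧
          D.seedOf E y = some s then 1 else 0) := by
        rw [Finset.mul_sum, Finset.mul_sum, ← Finset.sum_sub_distrib]
        exact Finset.sum_congr rfl fun y _ => by ring
      _ = j * (1 - hitProb E.bits k m / k) ^ (fuel + 1) := by
        rw [hP1, hsum, pow_succ, ← hA]; ring

/-- A sufficient number of rounds of the search. -/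
def seedFuel (b k : ℕ) : ℕ := 2 * k * (3 * b + 2)

-- As `p ≥ 1 / 2`, every `2 k` rounds reduce the expected number of missing seeds by a factor `e >
-- 2`. Repeating this `3 b + 2` times brings it from `k ≤ 2 ^ (3 * b)` below `1 / 4`.
open Classical in
theorem seedLoop_fail_le (E : EventRecord) (g : ℕ) :
    (D.seedLoop E (D.kSeed E) (groverIterations E.bits (D.kSeed E))
      (seedFuel E.bits (D.kSeed E)) [] ∅).expect (D.markSeed E) g (fun o t _ =>
      if (∃ seeds : List Seed, o = some seeds ∧ seeds.Perm (D.seedGeneration E).val) ∧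
        t ≤ seedFuel E.bits (D.kSeed E) * roundTime E.bits (D.kSeed E)
          (groverIterations E.bits (D.kSeed E)) g + 1 then 0 else 1) ≤ 1 / 4 := by
  refine (D.seedLoop_fail E _ g _ (D.seedInv_nil E)).trans ?_
  have hkN : D.kSeed E ≤ 2 ^ (3 * E.bits) := by
    rw [← D.countMarked_markSeed E]; exact countMarked_le _
  set k := D.kSeed E
  set b := E.bits
  rcases Nat.eq_zero_or_pos k with h0 | hpos
  · rw [h0]; norm_num
  have hk : (0 : ℝ) < k := by exact_mod_cast hpos
  set p := hitProb b k (groverIterations b k)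
  have hp : 1 / 2 ≤ p := half_le_hitProb hpos
  have hp1 : p ≤ 1 := hitProb_le_one _ _ _
  have hq : 0 ≤ 1 - p / k := by
    have : (1 : ℝ) ≤ k := by exact_mod_cast hpos
    have : p / k ≤ 1 := by rw [div_le_one hk]; linarith
    linarith
  have h1 : 1 - p / k ≤ Real.exp (-(p / k)) := by
    have := Real.add_one_le_exp (-(p / k)); linarith
  have h2 : (1 - p / k) ^ seedFuel b k ≤ Real.exp (-1) ^ (3 * b + 2) := by
    refine (pow_le_pow_left₀ hq h1 _).trans ?_
    rw [← Real.exp_nat_mul, ← Real.exp_nat_mul, Real.exp_le_exp]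
    have e : ((seedFuel b k : ℕ) : ℝ) * -(p / k) = -((3 * b + 2 : ℕ) * (2 * p)) := by
      simp only [seedFuel]; push_cast; field_simp
    rw [e]
    have : (0 : ℝ) ≤ (3 * b + 2 : ℕ) := Nat.cast_nonneg _
    nlinarith
  have h3 : Real.exp (-1) ≤ 1 / 2 := by
    rw [Real.exp_neg, ← one_div]
    have := Real.add_one_le_exp (1 : ℝ)
    exact one_div_le_one_div_of_le (by norm_num) (by linarith)
  have h4 : Real.exp (-1) ^ (3 * b + 2) ≤ (1 / 2) ^ (3 * b + 2) :=
    pow_le_pow_left₀ (Real.exp_pos _).le h3 _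
  have hkr : (k : ℝ) ≤ 2 ^ (3 * b) := by exact_mod_cast hkN
  calc ((k : ℝ) - ([] : List Seed).length) * (1 - p / k) ^ seedFuel b k
      ≤ k * (1 / 2) ^ (3 * b + 2) := by
        rw [List.length_nil, Nat.cast_zero, sub_zero]
        exact mul_le_mul_of_nonneg_left (h2.trans h4) hk.le
    _ ≤ 2 ^ (3 * b) * (1 / 2) ^ (3 * b + 2) := by gcongr
    _ = 1 / 4 := by
      rw [pow_add, ← mul_assoc, ← mul_pow]; norm_num

end Detector

/-! ### Total time of the quantum version -/

namespace Detector

variable (D : Detector)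

theorem QuantumCTFWithin.mono {D : Detector} {Q : (b : ℕ) → Prog b ℕ} {E : EventRecord} {T T' : ℝ}
    (h : D.QuantumCTFWithin Q E T) (hT : T ≤ T') : D.QuantumCTFWithin Q E T' := by
  classical
  obtain ⟨fuel, hf⟩ := h
  refine ⟨fuel, hf.trans (Prog.expect_mono _ _ _ fun o t _ => ?_)⟩
  split_ifs with h1 h2 h2
  · exact le_rfl
  · exfalso
    obtain ⟨seeds, a, b, c⟩ := h1
    exact h2 ⟨seeds, a, b, c.trans hT⟩
  · norm_num
  · exact le_rfl

open Classical in
/-- The improved CTF with quantum seed generation succeeds within the sum of the times of a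
successful counting run, of sufficiently many rounds of the search, and of the later stages. -/
theorem quantumCTFWithin_sum (E : EventRecord) {T₁ T₂ T₃ : ℝ}
    (h₁ : (6 * E.bits + 4 : ℕ) * ((testReps * (E.bits + 1) : ℕ) *
      (testSize E.bits (D.kSeed E) * D.groverGates E.bits + 3 * E.bits + 3) + 1) ≤ T₁)
    (h₂ : ((seedFuel E.bits (D.kSeed E) * roundTime E.bits (D.kSeed E)
      (groverIterations E.bits (D.kSeed E)) (D.groverGates E.bits) + 1 : ℕ) : ℝ) ≤ T₂)
    (h₃ : ∀ seeds : List Seed, seeds.Perm (D.seedGeneration E).val →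
      ((D.laterStages E seeds).time : ℝ) ≤ T₃) :
    D.QuantumCTFWithin quantumCount E (T₁ + 2 + T₂ + T₃) := by
  set b := E.bits with hb
  set k := D.kSeed E with hk
  set g := D.groverGates b with hg
  set mark := D.markSeed E with hmark
  set fuel := seedFuel b k with hfuel
  set good : Option (List Seed × List Track) → ℕ → Prop := fun o t =>
    ∃ seeds : List Seed, o = some (seeds, (D.laterStages E seeds).val) ∧
      seeds.Perm (D.seedGeneration E).val ∧ (t : ℝ) ≤ T₁ + 2 + T₂ + T₃ with hgood
  refine ⟨fuel, ?_⟩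
  change 1 / 2 ≤ (D.quantumCTF quantumCount E fuel).prob mark g good
  set cont : Option (List Seed) → Prog E.bits (Option (List Seed × List Track)) := fun o =>
    match o with
    | none => .ret none
    | some seeds => (Prog.ofTimed (D.laterStages E seeds)).bind fun ts => .ret (some (seeds, ts))
    with hcont
  have hexp : ∀ φ : Option (List Seed × List Track) → ℕ → ℕ → ℝ,
      (D.quantumCTF quantumCount E fuel).expect mark g φ =
      (quantumCount b).expect mark g fun k' t l =>
        (D.seedLoop E k' (groverIterations b k') fuel [] ∅).expect mark g fun o t' l' =>
          (cont o).expect mark g fun a u v => φ a (t + (2 + t') + u) (l + l' + v) := by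
    intro φ
    rw [quantumCTF, Prog.expect_bind, quantumSeeding, Prog.expect_bind]
    rfl
  have hcontc : ∀ (o : Option (List Seed)) (c : ℝ),
      (cont o).expect mark g (fun _ _ _ => c) = c := by
    intro o c
    cases o <;> rfl
  -- The total probability is needed to turn the bound on failure into one on success.
  have hone : (D.quantumCTF quantumCount E fuel).expect mark g (fun _ _ _ => 1) = 1 := by
    rw [hexp]
    have hseedc : ∀ (k' m : ℕ), (D.seedLoop E k' m fuel [] ∅).expect mark g (fun _ _ _ => 1) = 1 :=
      fun k' m => D.seedLoop_expect_const g 1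
    simp only [hcontc, hseedc]
    exact countLoop_expect_const _ g 1
  have hbad : (D.quantumCTF quantumCount E fuel).expect mark g
      (fun o t _ => if good o t then 0 else 1) ≤ 1 / 8 * (1 / 8) ^ b + 1 / 4 := by
    rw [hexp]
    have hcm : countMarked mark = k := D.countMarked_markSeed E
    have hc := quantumCount_fail mark g
    rw [hcm] at hc
    have hs := D.seedLoop_fail_le E g
    -- After a good counting run the search fails with probability at most `1 / 4`, since the later
    -- stages are deterministic and within `T₃`. After a bad one the trivial bound `1` is used.
    have hle : ∀ (k' t l : ℕ), (D.seedLoop E k' (groverIterations b k') fuel [] ∅).expect mark g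
        (fun o t' l' => (cont o).expect mark g fun a u v =>
          if good a (t + (2 + t') + u) then (0 : ℝ) else 1) ≤
        (if k' = k ∧ (t : ℝ) ≤ (6 * b + 4 : ℕ) * ((testReps * (b + 1) : ℕ) *
          (testSize b k * g + 3 * b + 3) + 1) ∧
          (l : ℝ) ≤ (6 * b + 4 : ℕ) * ((testReps * (b + 1) : ℕ) * testSize b k)
          then 0 else 1) + 1 / 4 := by
      intro k' t l
      split_ifs with h
      · obtain ⟨rfl, ht, -⟩ := h
        rw [zero_add]
        refine le_trans (Prog.expect_mono _ _ _ fun o t' l' => ?_) hs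
        split_ifs with h'
        · obtain ⟨⟨seeds, rfl, hp⟩, ht'⟩ := h'
          refine le_of_eq ?_
          change (if good (some (seeds, (D.laterStages E seeds).val))
            (t + (2 + t') + ((D.laterStages E seeds).time + 0 + 0)) then (0 : ℝ) else 1) = 0
          rw [if_pos]
          refine ⟨seeds, rfl, hp, ?_⟩
          have e1 := h₃ seeds hp
          have e2 : (t' : ℝ) ≤ T₂ := le_trans (by exact_mod_cast ht') h₂
          push_cast
          linarith
        · refine (Prog.expect_mono _ _ _ (ψ := fun _ _ _ => 1) fun a t l => ?_).trans
            (hcontc o 1).le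
          split_ifs <;> norm_num
      · refine le_trans (Prog.expect_mono _ _ _ (ψ := fun _ _ _ => 1) fun o t' l' => ?_)
          ((D.seedLoop_expect_const g 1).le.trans (by norm_num))
        refine (Prog.expect_mono _ _ _ (ψ := fun _ _ _ => 1) fun a t l => ?_).trans
            (hcontc o 1).le
        split_ifs <;> norm_num
    refine (Prog.expect_mono _ _ _ hle).trans ?_
    rw [Prog.expect_add]
    have : (quantumCount b).expect mark g (fun _ _ _ => 1 / 4) = 1 / 4 :=
      countLoop_expect_const _ g _
    rw [this]
    linarith
  have hsplit := Prog.expect_add mark g (D.quantumCTF quantumCount E fuel)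
    (fun o t _ => if good o t then 1 else 0) (fun o t _ => if good o t then 0 else 1)
  have hsum : (D.quantumCTF quantumCount E fuel).expect mark g (fun o t _ =>
      (if good o t then (1 : ℝ) else 0) + if good o t then 0 else 1) = 1 := by
    refine (congrArg _ (funext fun o => funext fun t => funext fun _ => ?_)).trans hone
    split_ifs <;> norm_num
  have h8 : (1 / 8 : ℝ) ^ b ≤ 1 := pow_le_one₀ (by norm_num) (by norm_num)
  rw [hsum] at hsplit
  unfold Prog.prob
  linarith

/-- The complexity bound in terms of the number of qubits. -/
theorem exists_quantumCTFWithin_bits : ∃ C : ℝ, 0 ≤ C ∧ ∀ E : EventRecord, 1 ≤ E.n →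
    D.QuantumCTFWithin quantumCount E (C * ((E.bits : ℝ) + 1) ^ 3 *
      (√((2 : ℝ) ^ (3 * E.bits) * (max 1 (D.kSeed E) : ℕ)) +
        (E.n : ℝ) * (max 1 (D.kSeed E) : ℕ))) := by
  obtain ⟨K, hK⟩ := D.laterStages_time_le
  -- `G` bounds the gates of the Grover operator per unit of `b + 1`.
  set G : ℕ := 6 + 3 * D.reflectGates + 6 * D.qram + D.seedGates + 1 with hG
  refine ⟨6 * (testReps * (5 * G + 3) + 1) + 2 + (6 * G + 228 + 1) + 12 * K, by positivity,
    fun E hn => ?_⟩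
  have hkN : D.kSeed E ≤ 2 ^ (3 * E.bits) := by
    rw [← D.countMarked_markSeed E]; exact countMarked_le _
  have hg : (D.groverGates E.bits : ℝ) ≤ G * (E.bits + 1) := by
    have : D.groverGates E.bits ≤ G * (E.bits + 1) := by
      simp only [groverGates, oracleGates, hG]; nlinarith
    exact_mod_cast this
  have hX1 := one_le_sqrt_two_pow_mul E.bits (D.kSeed E)
  have hsz := testSize_le E.bits (D.kSeed E)
  have hit := mul_groverIterations_le hkN
  have hclog : Nat.clog 2 (D.kSeed E + 1) ≤ 3 * E.bits + 1 := by
    refine (Nat.clog_le_iff_le_pow (by norm_num)).2 ?_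
    rw [pow_succ]
    have := Nat.one_le_two_pow (n := 3 * E.bits)
    omega
  have hpath : (pathBound (D.kSeed E) : ℝ) ≤ 9 * (E.bits + 1) := by
    have : pathBound (D.kSeed E) ≤ 9 * (E.bits + 1) := by simp only [pathBound]; omega
    exact_mod_cast this
  have hkκ : (D.kSeed E : ℝ) ≤ (max 1 (D.kSeed E) : ℕ) := by exact_mod_cast le_max_right 1 _
  have h1κ : (1 : ℝ) ≤ (max 1 (D.kSeed E) : ℕ) := by exact_mod_cast le_max_left 1 _
  have hitX : (D.kSeed E : ℝ) * groverIterations E.bits (D.kSeed E) ≤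
      √((2 : ℝ) ^ (3 * E.bits) * (max 1 (D.kSeed E) : ℕ)) :=
    hit.trans (Real.sqrt_le_sqrt (by gcongr))
  have hnr : (1 : ℝ) ≤ E.n := by exact_mod_cast hn
  have hs0 : 0 ≤ testSize E.bits (D.kSeed E) := by
    unfold testSize; have := Real.pi_pos; positivity
  set B : ℝ := (E.bits : ℝ) + 1 with hB
  have hB1 : 1 ≤ B := by rw [hB]; linarith [(Nat.cast_nonneg E.bits : (0 : ℝ) ≤ E.bits)]
  set X := √((2 : ℝ) ^ (3 * E.bits) * (max 1 (D.kSeed E) : ℕ)) with hX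
  set κ : ℝ := ((max 1 (D.kSeed E) : ℕ) : ℝ) with hκ
  set Y : ℝ := (E.n : ℝ) * κ with hY
  have hκY : κ ≤ Y := by rw [hY]; nlinarith
  have hY1 : 1 ≤ Y := h1κ.trans hκY
  have hB23 : B ^ 2 ≤ B ^ 3 := pow_le_pow_right₀ hB1 (by norm_num)
  have hB13 : B ≤ B ^ 3 := by simpa using pow_le_pow_right₀ hB1 (show 1 ≤ 3 by norm_num)
  have hB03 : 1 ≤ B ^ 3 := one_le_pow₀ hB1
  have hbB : (E.bits : ℝ) = B - 1 := by rw [hB]; ring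
  -- Counting needs all three factors `B`: rounds, repetitions and gates of the Grover operator. The
  -- search needs only two and the later stages one.
  refine (D.quantumCTFWithin_sum E (T₁ := 6 * (testReps * (5 * G + 3) + 1) * (B ^ 3 * X))
    (T₂ := (6 * G + 228 + 1) * (B ^ 3 * (X + Y))) (T₃ := 12 * K * (B ^ 3 * Y)) ?_ ?_ ?_).mono ?_
  · have e1 : (((6 * E.bits + 4 : ℕ)) : ℝ) ≤ 6 * B := by push_cast; rw [hB]; linarith
    have e2 : ((testReps * (E.bits + 1) : ℕ) : ℝ) = testReps * B := by push_cast; rw [hB]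
    have e3 : testSize E.bits (D.kSeed E) * D.groverGates E.bits + 3 * E.bits + 3 ≤
        (5 * G + 3) * (B * X) := by
      have : testSize E.bits (D.kSeed E) * D.groverGates E.bits ≤ 5 * X * (G * B) := by gcongr
      have : B ≤ B * X := le_mul_of_one_le_right (by linarith) hX1
      rw [hbB]
      linarith
    rw [e2]
    calc _ ≤ 6 * B * (testReps * B * ((5 * G + 3) * (B * X)) + 1) := by
          gcongr
      _ = 6 * (testReps * (5 * G + 3)) * (B ^ 3 * X) + 6 * (B * 1) := by ring
      _ ≤ 6 * (testReps * (5 * G + 3)) * (B ^ 3 * X) + 6 * (B ^ 3 * X) := by gcongr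
      _ = _ := by ring
  · simp only [seedFuel, roundTime]
    push_cast
    have e1 : 3 * (E.bits : ℝ) + 2 ≤ 3 * B := by rw [hB]; linarith
    -- The factor `k` comes from the number of rounds. It is combined with the number of iterations
    -- to give `k m ≤ X`; the rest of a round is linear in `B`.
    have e2 : (D.kSeed E : ℝ) * (3 * E.bits + groverIterations E.bits (D.kSeed E) *
        D.groverGates E.bits + 3 * pathBound (D.kSeed E) + 8) ≤ B * (G * X + 38 * Y) := by
      calc (D.kSeed E : ℝ) * (3 * E.bits + groverIterations E.bits (D.kSeed E) *
            D.groverGates E.bits + 3 * pathBound (D.kSeed E) + 8) =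
          (D.kSeed E * groverIterations E.bits (D.kSeed E)) * D.groverGates E.bits +
            D.kSeed E * (3 * E.bits + 3 * pathBound (D.kSeed E) + 8) := by ring
        _ ≤ X * (G * B) + Y * (3 * B + 3 * (9 * B) + 8 * B) := by
          gcongr
          · exact hkκ.trans hκY
          · linarith
          · linarith
        _ = _ := by ring
    calc _ = 2 * (3 * (E.bits : ℝ) + 2) * (D.kSeed E * (3 * E.bits +
            groverIterations E.bits (D.kSeed E) *
            D.groverGates E.bits + 3 * pathBound (D.kSeed E) + 8)) + 1 := by ring
      _ ≤ 2 * (3 * B) * (B * (G * X + 38 * Y)) + 1 := by gcongr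
      _ = 6 * G * (B ^ 2 * X) + 228 * (B ^ 2 * Y) + 1 * 1 := by ring
      _ ≤ 6 * G * (B ^ 3 * (X + Y)) + 228 * (B ^ 3 * (X + Y)) + 1 * (B ^ 3 * (X + Y)) := by
        gcongr
        · linarith
        · linarith
        · exact one_le_mul_of_one_le_of_one_le hB03 (by linarith)
      _ = _ := by ring
  · intro seeds hp
    have h := hK E seeds
    rw [hp.length_eq] at h
    change _ ≤ K * ((E.n + 1) * (D.kSeed E + 1) * (Nat.clog 2 (D.kSeed E + 1) + 1)) at h
    have h' : ((D.laterStages E seeds).time : ℝ) ≤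
        K * ((E.n + 1) * (D.kSeed E + 1) * (Nat.clog 2 (D.kSeed E + 1) + 1)) := by exact_mod_cast h
    have hc : (Nat.clog 2 (D.kSeed E + 1) : ℝ) + 1 ≤ 3 * B := by
      have : (Nat.clog 2 (D.kSeed E + 1) : ℝ) ≤ 3 * E.bits + 1 := by exact_mod_cast hclog
      rw [hB]; linarith
    calc _ ≤ K * (((E.n : ℝ) + 1) * (D.kSeed E + 1) * (Nat.clog 2 (D.kSeed E + 1) + 1)) := h'
      _ ≤ K * ((2 * E.n) * (2 * κ) * (3 * B)) := by
        gcongr <;> linarith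
      _ = 12 * K * (B * Y) := by rw [hY]; ring
      _ ≤ _ := by gcongr
  · have e0 : (0 : ℝ) ≤ 6 * (testReps * (5 * G + 3) + 1) := by positivity
    have e1 : B ^ 3 * X ≤ B ^ 3 * (X + Y) := by gcongr; linarith
    have e2 : B ^ 3 * Y ≤ B ^ 3 * (X + Y) := by gcongr; linarith
    have e3 : 1 ≤ B ^ 3 * (X + Y) := one_le_mul_of_one_le_of_one_le hB03 (by linarith)
    have e4 := mul_le_mul_of_nonneg_left e1 e0
    have e5 := mul_le_mul_of_nonneg_left e2 (show (0 : ℝ) ≤ 12 * K by positivity)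
    linarith

/-- Rounding up to a power of two less than doubles `n`, by minimality of `Nat.clog`, so `N` exceeds
`n ^ 3` at most eightfold. The hypothesis `2 < n` makes `log n ≥ 1`, which absorbs additive
constants. -/
theorem _root_.EventRecord.bits_add_one_le {E : EventRecord} (hn : 2 < E.n) :
    (E.bits : ℝ) + 1 ≤ 4 * Real.log E.n ∧ 1 ≤ Real.log E.n ∧
      (2 : ℝ) ^ (3 * E.bits) ≤ 8 * (E.n : ℝ) ^ 3 := by
  have h3 : (3 : ℝ) ≤ E.n := by exact_mod_cast hn
  have hlog : 1 ≤ Real.log E.n := by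
    rw [Real.le_log_iff_exp_le (by linarith)]
    exact Real.exp_one_lt_d9.le.trans (by linarith)
  have hpow : (2 : ℝ) ^ E.bits ≤ 2 * E.n := by
    have hb : E.bits ≠ 0 := by
      intro h0
      have := Nat.le_pow_clog (b := 2) (by norm_num) E.n
      change E.n ≤ 2 ^ E.bits at this
      rw [h0] at this
      omega
    obtain ⟨c, hc⟩ := Nat.exists_eq_succ_of_ne_zero hb
    have h1 : 2 ^ c < E.n := by
      refine (Nat.lt_clog_iff_pow_lt (by norm_num)).1 ?_
      change c < E.bits
      omega
    have h2 : (2 : ℝ) ^ c ≤ E.n := by exact_mod_cast h1.le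
    rw [hc, pow_succ]; linarith
  refine ⟨?_, hlog, ?_⟩
  · have h1 : (E.bits : ℝ) * Real.log 2 ≤ Real.log 2 + Real.log E.n := by
      rw [← Real.log_pow, ← Real.log_mul (by norm_num) (by linarith)]
      exact Real.log_le_log (by positivity) hpow
    have h2 := Real.log_two_gt_d9
    nlinarith [(Nat.cast_nonneg E.bits : (0 : ℝ) ≤ E.bits)]
  · calc (2 : ℝ) ^ (3 * E.bits) = ((2 : ℝ) ^ E.bits) ^ 3 := by rw [mul_comm, pow_mul]
      _ ≤ (2 * (E.n : ℝ)) ^ 3 := by gcongr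
      _ = _ := by ring

/-- The complexity of the improved CTF with quantum seed generation. -/
theorem exists_quantumCTFWithin : ∃ C : ℝ, 0 ≤ C ∧ ∀ E : EventRecord, 2 < E.n →
    D.QuantumCTFWithin quantumCount E (C * Real.log E.n ^ 3 *
      (√((E.n : ℝ) ^ 3 * (max 1 (D.kSeed E) : ℕ)) + (E.n : ℝ) * (max 1 (D.kSeed E) : ℕ))) := by
  obtain ⟨C, hC, h⟩ := D.exists_quantumCTFWithin_bits
  refine ⟨C * 64 * 3, by positivity, fun E hn => (h E (by omega)).mono ?_⟩
  obtain ⟨h1, h2, h3⟩ := E.bits_add_one_le hn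
  -- The factor `3` is an upper bound for `√8`.
  have h4 : √((2 : ℝ) ^ (3 * E.bits) * (max 1 (D.kSeed E) : ℕ)) ≤
      3 * √((E.n : ℝ) ^ 3 * (max 1 (D.kSeed E) : ℕ)) := by
    refine Real.sqrt_le_iff.2 ⟨by positivity, ?_⟩
    rw [mul_pow, Real.sq_sqrt (by positivity)]
    have : (0 : ℝ) ≤ (E.n : ℝ) ^ 3 * (max 1 (D.kSeed E) : ℕ) := by positivity
    calc _ ≤ 8 * (E.n : ℝ) ^ 3 * (max 1 (D.kSeed E) : ℕ) := by gcongr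
      _ ≤ _ := by linarith
  have h5 : (0 : ℝ) ≤ (E.n : ℝ) * (max 1 (D.kSeed E) : ℕ) := by positivity
  calc _ ≤ C * (4 * Real.log E.n) ^ 3 * (3 * √((E.n : ℝ) ^ 3 * (max 1 (D.kSeed E) : ℕ)) +
        3 * ((E.n : ℝ) * (max 1 (D.kSeed E) : ℕ))) :=
        mul_le_mul (by gcongr) (by linarith) (by positivity) (by positivity)
    _ = _ := by ring

end Detector

/-! ### Few or many seeds, and the comparison with the classical version -/

open Filter in
/-- Powers of the logarithm are absorbed by any increase of the exponent. -/
theorem Real.exists_nat_log_pow_mul_rpow_le (C : ℝ) (d : ℕ) {p q : ℝ} (hpq : p < q) :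
    ∃ n₀ : ℕ, ∀ n : ℕ, n₀ < n → C * Real.log n ^ d * (n : ℝ) ^ p ≤ (n : ℝ) ^ q := by
  have hc : (0 : ℝ) < 1 / (|C| + 1) := by positivity
  have h := ((isLittleO_log_rpow_rpow_atTop (d : ℝ) (sub_pos.2 hpq)).comp_tendsto
    tendsto_natCast_atTop_atTop).bound hc
  obtain ⟨n₀, hn₀⟩ := eventually_atTop.1 h
  refine ⟨n₀, fun n hn => ?_⟩
  have h1 := hn₀ n hn.le
  have hn1 : (1 : ℝ) ≤ n := by exact_mod_cast (by omega : 1 ≤ n)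
  have hl : 0 ≤ Real.log n := Real.log_nonneg hn1
  have hn0 : (0 : ℝ) < n := by linarith
  simp only [Function.comp_apply, Real.rpow_natCast, Real.norm_eq_abs,
    abs_of_nonneg (pow_nonneg hl d), abs_of_pos (Real.rpow_pos_of_pos hn0 (q - p))] at h1
  have hC : C ≤ |C| + 1 := by linarith [le_abs_self C]
  calc C * Real.log n ^ d * (n : ℝ) ^ p
      ≤ (|C| + 1) * (1 / (|C| + 1) * (n : ℝ) ^ (q - p)) * (n : ℝ) ^ p := by gcongr
    _ = (n : ℝ) ^ (q - p) * (n : ℝ) ^ p := by field_simp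
    _ = (n : ℝ) ^ q := by rw [← Real.rpow_add hn0]; congr 1; ring

namespace Detector

variable (D : Detector)

/-- Replacing `a` by `max a 0` and `c` by `max c 1` lets the power bound also cover the `1` in the
maximum, even for negative `a`. -/
theorem max_kSeed_le {E : EventRecord} {a c : ℝ} (hn : 1 ≤ E.n)
    (hk : (D.kSeed E : ℝ) ≤ c * (E.n : ℝ) ^ a) :
    ((max 1 (D.kSeed E) : ℕ) : ℝ) ≤ max c 1 * (E.n : ℝ) ^ max a 0 := by
  have hn1 : (1 : ℝ) ≤ E.n := by exact_mod_cast hn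
  have h1 : (1 : ℝ) ≤ (E.n : ℝ) ^ max a 0 := Real.one_le_rpow hn1 (le_max_right _ _)
  have h2 : (E.n : ℝ) ^ a ≤ (E.n : ℝ) ^ max a 0 :=
    Real.rpow_le_rpow_of_exponent_le hn1 (le_max_left _ _)
  push_cast
  refine max_le (one_le_mul_of_one_le_of_one_le (le_max_right _ _) h1) (hk.trans ?_)
  exact mul_le_mul (le_max_left _ _) h2 (by positivity) (by positivity)

/-- Many seeds: the time is linear in the number of hits times the number of seeds. -/
theorem exists_quantumCTFWithin_of_le_kSeed {c' : ℝ} (hc' : 0 < c') :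
    ∃ C : ℝ, ∀ E : EventRecord, 2 < E.n → c' * (E.n : ℝ) ≤ D.kSeed E →
      D.QuantumCTFWithin quantumCount E
        (C * Real.log E.n ^ 3 * ((E.n : ℝ) * D.kSeed E)) := by
  obtain ⟨C, hC, h⟩ := D.exists_quantumCTFWithin
  refine ⟨C * (√(1 / c') + 1), fun E hn hk => (h E hn).mono ?_⟩
  obtain ⟨-, hlog, -⟩ := E.bits_add_one_le hn
  have hn0 : (0 : ℝ) < E.n := by exact_mod_cast (by omega : 0 < E.n)
  have hk0 : (0 : ℝ) < D.kSeed E := (mul_pos hc' hn0).trans_le hk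
  rw [max_eq_right (Nat.cast_pos.1 hk0)]
  -- With `n ≤ k / c'`, one factor `n` of `n ^ 3 k` is traded for `k / c'`, which leaves `(n k) ^ 2
  -- / c'`.
  have hs : √((E.n : ℝ) ^ 3 * D.kSeed E) ≤ √(1 / c') * ((E.n : ℝ) * D.kSeed E) := by
    rw [← Real.sqrt_sq (by positivity : 0 ≤ (E.n : ℝ) * D.kSeed E),
      ← Real.sqrt_mul (by positivity)]
    refine Real.sqrt_le_sqrt ?_
    have : (E.n : ℝ) ≤ 1 / c' * D.kSeed E := by
      rw [one_div, ← div_eq_inv_mul, le_div_iff₀ hc']; linarith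
    calc (E.n : ℝ) ^ 3 * D.kSeed E = (E.n : ℝ) ^ 2 * D.kSeed E * E.n := by ring
      _ ≤ (E.n : ℝ) ^ 2 * D.kSeed E * (1 / c' * D.kSeed E) := by gcongr
      _ = _ := by ring
  calc _ ≤ C * Real.log E.n ^ 3 * (√(1 / c') * ((E.n : ℝ) * D.kSeed E) +
        (E.n : ℝ) * D.kSeed E) := by gcongr
    _ = _ := by ring

/-- Few seeds: the exponent of the quantum time is smaller than three. -/
theorem exists_quantumCTFWithin_rpow {a : ℝ} (ha : a < 2) (c : ℝ) :
    ∃ δ : ℝ, 0 < δ ∧ ∃ n₀ : ℕ, ∀ E : EventRecord, n₀ < E.n →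
      (D.kSeed E : ℝ) ≤ c * (E.n : ℝ) ^ a →
      D.QuantumCTFWithin quantumCount E ((E.n : ℝ) ^ (3 - δ)) := by
  obtain ⟨C, hC, h⟩ := D.exists_quantumCTFWithin
  set a' := max a 0 with ha'
  set c₁ := max c 1 with hc₁
  have ha0 : 0 ≤ a' := le_max_right _ _
  have ha2 : a' < 2 := max_lt ha (by norm_num)
  have hc1 : 1 ≤ c₁ := le_max_right _ _
  -- The exponent `(4 + a') / 2` dominates both `(3 + a') / 2`, from the square root, and `1 + a'`,
  -- from `n k`, as `a' ≤ 2`. It lies `(2 - a') / 2` below `3`; half of this is `δ`, and the other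
  -- half absorbs the logarithms.
  obtain ⟨n₀, hn₀⟩ := Real.exists_nat_log_pow_mul_rpow_le (C * (√c₁ + c₁)) 3
    (show (4 + a') / 2 < 3 - (2 - a') / 4 by linarith)
  refine ⟨(2 - a') / 4, by linarith, max n₀ 2, fun E hn hk => (h E ?_).mono ?_⟩
  · exact (le_max_right _ _).trans_lt hn
  have hn2 : 2 < E.n := (le_max_right _ _).trans_lt hn
  obtain ⟨-, hlog, -⟩ := E.bits_add_one_le hn2
  have hκ := D.max_kSeed_le (by omega) hk
  have hn1 : (1 : ℝ) ≤ E.n := by exact_mod_cast (by omega : 1 ≤ E.n)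
  have hn0 : (0 : ℝ) < E.n := by linarith
  refine le_trans ?_ (hn₀ E.n ((le_max_left _ _).trans_lt hn))
  have e1 : √((E.n : ℝ) ^ 3 * (max 1 (D.kSeed E) : ℕ)) ≤ √c₁ * (E.n : ℝ) ^ ((4 + a') / 2) := by
    refine Real.sqrt_le_iff.2 ⟨by positivity, ?_⟩
    rw [mul_pow, Real.sq_sqrt (by linarith), ← Real.rpow_natCast ((E.n : ℝ) ^ _),
      ← Real.rpow_mul hn0.le]
    calc (E.n : ℝ) ^ 3 * (max 1 (D.kSeed E) : ℕ)
        ≤ (E.n : ℝ) ^ 3 * (c₁ * (E.n : ℝ) ^ a') := by gcongr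
      _ = c₁ * (E.n : ℝ) ^ (3 + a') := by
        rw [Real.rpow_add hn0, ← Real.rpow_natCast]; push_cast; ring
      _ ≤ _ := by
        gcongr
        push_cast
        linarith
  have e2 : (E.n : ℝ) * (max 1 (D.kSeed E) : ℕ) ≤ c₁ * (E.n : ℝ) ^ ((4 + a') / 2) :=
    calc (E.n : ℝ) * (max 1 (D.kSeed E) : ℕ) ≤ (E.n : ℝ) * (c₁ * (E.n : ℝ) ^ a') := by gcongr
      _ = c₁ * (E.n : ℝ) ^ (1 + a') := by rw [Real.rpow_add hn0, Real.rpow_one]; ring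
      _ ≤ _ := by
        gcongr
        linarith
  calc _ ≤ C * Real.log E.n ^ 3 * (√c₁ * (E.n : ℝ) ^ ((4 + a') / 2) +
        c₁ * (E.n : ℝ) ^ ((4 + a') / 2)) := by gcongr
    _ = _ := by ring

theorem classicalCTF_time (E : EventRecord) : (D.classicalCTF E).time =
    (D.seedGeneration E).time + (D.laterStages E (D.seedGeneration E).val).time := rfl

/-- The time of the classical version is cubic, if there are few seeds. -/
theorem exists_classicalCTF_time_le {a : ℝ} (ha : a < 2) (c : ℝ) :
    ∃ (C : ℝ) (n₀ : ℕ), ∀ E : EventRecord, n₀ < E.n →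
      (D.kSeed E : ℝ) ≤ c * (E.n : ℝ) ^ a →
      ((D.classicalCTF E).time : ℝ) ≤ C * (E.n : ℝ) ^ 3 := by
  obtain ⟨K, hK⟩ := D.laterStages_time_le
  set a' := max a 0 with ha'
  set c₁ := max c 1 with hc₁
  have ha2 : a' < 2 := max_lt ha (by norm_num)
  have hc1 : 1 ≤ c₁ := le_max_right _ _
  -- The later stages take time of order `n ^ (1 + a') log n`, which stays below `n ^ 3` for large
  -- `n` because `a' < 2`. Seed generation contributes `21 (n + 1) ^ 3 ≤ 168 n ^ 3`.
  obtain ⟨n₀, hn₀⟩ := Real.exists_nat_log_pow_mul_rpow_le (48 * K * c₁) 1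
    (show 1 + a' < (3 : ℕ) by push_cast; linarith)
  refine ⟨168 + 1, max n₀ 2, fun E hn hk => ?_⟩
  have hn2 : 2 < E.n := (le_max_right _ _).trans_lt hn
  obtain ⟨hbits, hlog, -⟩ := E.bits_add_one_le hn2
  have hκ := D.max_kSeed_le (by omega) hk
  have hn1 : (1 : ℝ) ≤ E.n := by exact_mod_cast (by omega : 1 ≤ E.n)
  have hn0 : (0 : ℝ) < E.n := by linarith
  have hfin := hn₀ E.n ((le_max_left _ _).trans_lt hn)
  rw [pow_one, Real.rpow_natCast] at hfin
  have h1 : ((D.seedGeneration E).time : ℝ) ≤ 21 * ((E.n : ℝ) + 1) ^ 3 := by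
    exact_mod_cast D.seedGeneration_time_le E
  have h2 : ((D.laterStages E (D.seedGeneration E).val).time : ℝ) ≤
      K * (((E.n : ℝ) + 1) * (D.kSeed E + 1) * (Nat.clog 2 (D.kSeed E + 1) + 1)) := by
    exact_mod_cast hK E (D.seedGeneration E).val
  have hclog : (Nat.clog 2 (D.kSeed E + 1) : ℝ) + 1 ≤ 12 * Real.log E.n := by
    have h : Nat.clog 2 (D.kSeed E + 1) ≤ 3 * E.bits + 1 := by
      refine (Nat.clog_le_iff_le_pow (by norm_num)).2 ?_
      have hkN : D.kSeed E ≤ 2 ^ (3 * E.bits) := by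
        rw [← D.countMarked_markSeed E]; exact countMarked_le _
      have := Nat.one_le_two_pow (n := 3 * E.bits)
      rw [pow_succ]
      omega
    have h' : (Nat.clog 2 (D.kSeed E + 1) : ℝ) ≤ 3 * E.bits + 1 := by exact_mod_cast h
    linarith
  have hkκ : (D.kSeed E : ℝ) ≤ (max 1 (D.kSeed E) : ℕ) := by exact_mod_cast le_max_right 1 _
  have h1κ : (1 : ℝ) ≤ (max 1 (D.kSeed E) : ℕ) := by exact_mod_cast le_max_left 1 _
  rw [classicalCTF_time]
  push_cast
  have h3 : (K : ℝ) * (((E.n : ℝ) + 1) * (D.kSeed E + 1) * (Nat.clog 2 (D.kSeed E + 1) + 1)) ≤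
      (E.n : ℝ) ^ 3 :=
    calc _ ≤ (K : ℝ) * ((2 * E.n) * (2 * (c₁ * (E.n : ℝ) ^ a')) * (12 * Real.log E.n)) := by
          gcongr <;> linarith
      _ = 48 * K * c₁ * Real.log E.n * (E.n : ℝ) ^ (1 + a') := by
          rw [Real.rpow_add hn0, Real.rpow_one]; ring
      _ ≤ _ := hfin
  have h4 : 21 * ((E.n : ℝ) + 1) ^ 3 ≤ 168 * (E.n : ℝ) ^ 3 :=
    calc 21 * ((E.n : ℝ) + 1) ^ 3 ≤ 21 * (2 * (E.n : ℝ)) ^ 3 := by gcongr; linarith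
      _ = _ := by ring
  linarith

end Detector

theorem mainTheorem8 :
    ∃ QCount : (b : ℕ) → Prog b ℕ, IsQuantumCounting QCount ∧
      ∀ D : Detector,
        -- complexity `Õ(√(n³ k) + n k)`
        (∃ (C : ℝ) (d n₀ : ℕ), ∀ E : EventRecord, n₀ < E.n →
          D.QuantumCTFWithin QCount E (C * Real.log E.n ^ d *
            (Real.sqrt ((E.n : ℝ) ^ 3 * (max 1 (D.kSeed E) : ℕ)) +
              (E.n : ℝ) * (max 1 (D.kSeed E) : ℕ)))) ∧
        -- the case `k = O(n ^ a)` with `a < 2`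
        (∀ a c : ℝ, a < 2 → 0 < c →
          -- `Õ(n k)`, if there are at least of the order of `n` seeds
          (∀ c' : ℝ, 0 < c' → ∃ (C : ℝ) (d n₀ : ℕ), ∀ E : EventRecord, n₀ < E.n →
            (D.kSeed E : ℝ) ≤ c * (E.n : ℝ) ^ a → c' * (E.n : ℝ) ≤ D.kSeed E →
            D.QuantumCTFWithin QCount E (C * Real.log E.n ^ d * ((E.n : ℝ) * D.kSeed E))) ∧
          -- the quantum time is smaller than `n ^ 3` by a power of `n`
          (∃ δ : ℝ, 0 < δ ∧ ∃ n₀ : ℕ, ∀ E : EventRecord, n₀ < E.n →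
            (D.kSeed E : ℝ) ≤ c * (E.n : ℝ) ^ a →
            D.QuantumCTFWithin QCount E ((E.n : ℝ) ^ (3 - δ))) ∧
          -- the classical version takes time `O(n ^ 3)`
          (∃ (C : ℝ) (n₀ : ℕ), ∀ E : EventRecord, n₀ < E.n →
            (D.kSeed E : ℝ) ≤ c * (E.n : ℝ) ^ a →
            ((D.classicalCTF E).time : ℝ) ≤ C * (E.n : ℝ) ^ 3)) ∧
        -- and never less than the number of hit triplets, which is `n ^ 3` without missing hits
        (∀ E : EventRecord,
          (E.hits 0).length * (E.hits 1).length * (E.hits 2).length ≤ (D.classicalCTF E).time) := by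
  refine ⟨quantumCount, isQuantumCounting_quantumCount, fun D => ⟨?_, fun a c ha _ => ⟨?_,
    D.exists_quantumCTFWithin_rpow ha c, D.exists_classicalCTF_time_le ha c⟩,
    fun E => (D.mul_le_seedGeneration_time E).trans ?_⟩⟩
  · obtain ⟨C, -, h⟩ := D.exists_quantumCTFWithin
    exact ⟨C, 3, 2, h⟩
  · intro c' hc'
    obtain ⟨C, h⟩ := D.exists_quantumCTFWithin_of_le_kSeed hc'
    exact ⟨C, 3, 2, fun E hn _ => h E hn⟩
  · rw [D.classicalCTF_time]
    exact Nat.le_add_right _ _
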